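/- Let $k$ be a field of characteristic $0$, let $A$ be a unital associative $k$-algebra, and let $G$ be a (discrete) group acting on $A$ by unital $k$-algebra automorphisms. The crossed product $A\rtimes G$ is the algebra of finite sums $\sum a_g g$ with $(ag)(bh)=a\,g(b)\,gh$. *Cyclic modules.* A cyclic $k$-module $M$ is a contravariant functor from the cyclic category to $k$-modules, with faces $\delta_i$, degeneracies $\sigma_i$ and rotations $t_n$ ($t_n^{n+1}=1$). Put $b=\sum_{i}(-1)^i\delta_i$ and $B_n=(t_{n+1}^{-1}+(-1)^n)\,\sigma_n\sum_{i=0}^n(-1)^{in}t_n^i$. With a formal variable $u$ of degree $-2$, let $CC^{F}_n(M)$ be the module of formal sums $\sum_j x_ju^j$ with $x_j\in M([n+2j])$, where $j$ runs over $\{0\}$ for $F=$ Hochschild, over $j<0$ for $F=$ cyclic, over $j\ge 0$ for $F=$ negative cyclic, and over $\mathbb Z$ for $F=$ periodic cyclic. The differential is $b+uB$, where powers of $u$ that do not occur in $CC^F$ are dropped. For a unital algebra $R$, $R^\natural([n])=R^{\otimes n+1}$ is the usual cyclic module, with $\delta_i$ multiplying neighbours, $\sigma_i$ inserting $1$, and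 $t_n(a_0\otimes\dots\otimes a_n)=a_1\otimes\dots\otimes a_n\otimes a_0$. The cyclic module $G^{k\natural}$ has $G^{k\natural}([n])=(kG)^{\otimes n+1}$, with faces omitting an entry, degeneracies repeating an entry and $t_n$ rotating. $A\natural G$ is the levelwise tensor product $A^\natural\otimes G^{k\natural}$. $G$ acts on $A^\natural$ diagonally, on $G^{k\natural}$ by left multiplication on all entries, on $A\natural G$ diagonally; as right modules these carry $x\cdot g=g^{-1}x$. $(A\natural G)_G$ is the cyclic module of coinvariants. The homogeneous summand $(A\rtimes G)^\natural_e\subset (A\rtimes G)^\natural$ is spanned by the tensors $a_0g_0\otimes\dots\otimes a_ng_n$ with $g_0g_1\cdots g_n=e$. *Group homology.* Let $C_\bullet(G)=(G^{k\natural}([\bullet]),b)$. For a complex $(M_\bullet,\partial)$ of right $kG$-modules let $C_n(G;M)=\prod_{p+q=n}M_p\otimes_{kG}C_q(G)$, with differential $\partial\otimes\mathrm{Id}+\mathrm{Id}\otimes b$ (Koszul signs). For a cyclic module $M$ with $G$-action, let $\widehat C_\bullet(G;CC^F(M))$ be the same complex formed with the $u$-adically completed tensor product: in $\prod_{p+q=n}$,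 the factor with index $(p,q)$ consists of the formal sums $\sum_jx_ju^j$ with $x_j\in M([p+2j])\otimes_{kG}C_q(G)$, $j$ ranging as in $CC^F$. There is an evident comparison map $\kappa:C_\bullet(G;CC^F(M))\to\widehat C_\bullet(G;CC^F(M))$. **Theorem.** 1. There is an isomorphism of cyclic modules $\theta:(A\rtimes G)^\natural_e\to(A\natural G)_G$ which sends $a_0g_0\otimes\dots\otimes a_ng_n$ (with $g_0\cdots g_n=e$) to the class of $$\bigl(g_0^{-1}(a_0)\otimes a_1\otimes g_1(a_2)\otimes\dots\otimes g_1\cdots g_{n-1}(a_n)\bigr)\natural\bigl(e\otimes g_1\otimes g_1g_2\otimes\dots\otimes g_1\cdots g_n\bigr).$$ 2. For each $m\ge0$ choose $\ell_m\in\{0,\dots,m\}$, let $\partial$ be the differential of $CC^F(A\natural G)$ and $\delta_G=\mathrm{Id}\otimes b$ (with its Koszul sign), and let $H$ be the map which on the coefficients of the powers of $u$ is given by $$H\bigl((x\natural(g_0\otimes\dots\otimes g_m))\otimes(h_0\otimes\dots\otimes h_q)\bigr)=(-1)^p\,(x\natural(g_0\otimes\dots\otimes g_m))\otimes(g_{\ell_m}\otimes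 h_0\otimes\dots\otimes h_q)$$ in the column of total degree $p$ of $CC^F(A\natural G)$. For each of the four flavours $F$ there is a morphism of complexes $Q:CC^F((A\natural G)_G)\to\widehat C_\bullet(G;CC^F(A\natural G))$ such that, identifying $f\in CC^F(A\natural G)$ with $f\otimes e$, $$Q([f])=f-\delta_GHf+\sum_{q\ge1}\Bigl((-H\partial)^qf-\partial(-H\partial)^{q-1}Hf-\delta_G(-H\partial)^qHf\Bigr).$$ 3. For each of the four flavours $F$ the composite $$CC^F\bigl((A\rtimes G)^\natural_e\bigr)\xrightarrow{\ \theta\ }CC^F\bigl((A\natural G)_G\bigr)\xrightarrow{\ Q\ }\widehat C_\bullet\bigl(G;CC^F(A\natural G)\bigr)\longrightarrow\widehat C_\bullet\bigl(G;CC^F(A^\natural)\bigr),$$ whose last map is induced by $(a_0\otimes\dots\otimes a_n)\natural(g_0\otimes\dots\otimes g_n)\mapsto a_0\otimes\dots\otimes a_n$, is a quasi-isomorphism. 4. If $F$ is Hochschild or cyclic, or if $G$ is finite, then $\kappa:C_\bullet(G;CC^F(A^\natural))\to\widehat C_\bullet(G;CC^F(A^\natural))$ is an isomorphism of complexes, and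 the composite in 3 is $\kappa\circ\Phi$ for a quasi-isomorphism $\Phi:CC^F((A\rtimes G)^\natural_e)\to C_\bullet(G;CC^F(A^\natural))$. -/

import Mathlib

open CategoryTheory TensorProduct

noncomputable section

namespace CrossedCyclic

set_option linter.unusedSimpArgs false
set_option linter.unusedSectionVars false

universe u v v' w

/-! ## Cyclic modules -/

/-- A cyclic `k`-module: a contravariant functor from the cyclic category to `k`-modules, written
out on generators and relations. `d n i`, `s n i`, `t n` are the images of
`δ_i^{n+1} : [n] → [n+1]`, `σ_i^n : [n+1] → [n]` and `t_n : [n] → [n]`. -/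
structure CyclicModule (k : Type u) [CommRing k] where
  X : ℕ → Type v
  [grp : ∀ n, AddCommGroup (X n)]
  [mod : ∀ n, Module k (X n)]
  d : ∀ n, Fin (n + 2) → (X (n + 1) →ₗ[k] X n)
  s : ∀ n, Fin (n + 1) → (X n →ₗ[k] X (n + 1))
  t : ∀ n, X n →ₗ[k] X n
  d_d : ∀ n (i j : Fin (n + 2)), i ≤ j →
    d n i ∘ₗ d (n + 1) j.succ = d n j ∘ₗ d (n + 1) i.castSucc
  s_s : ∀ n (i j : Fin (n + 1)), i ≤ j →
    s (n + 1) i.castSucc ∘ₗ s n j = s (n + 1) j.succ ∘ₗ s n i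
  d_s_lt : ∀ n (i : Fin (n + 2)) (j : Fin (n + 1)), i ≤ j.castSucc →
    d (n + 1) i.castSucc ∘ₗ s (n + 1) j.succ = s n j ∘ₗ d n i
  d_s_self : ∀ n (j : Fin (n + 1)), d n j.castSucc ∘ₗ s n j = LinearMap.id
  d_s_succ : ∀ n (j : Fin (n + 1)), d n j.succ ∘ₗ s n j = LinearMap.id
  d_s_gt : ∀ n (i : Fin (n + 2)) (j : Fin (n + 1)), j.castSucc < i →
    d (n + 1) i.succ ∘ₗ s (n + 1) j.castSucc = s n j ∘ₗ d n i
  t_pow : ∀ n, (t n : Module.End k (X n)) ^ (n + 1) = 1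
  d_t : ∀ n (i : Fin (n + 1)), d n i.castSucc ∘ₗ t (n + 1) = t n ∘ₗ d n i.succ
  d_last_t : ∀ n, d n (Fin.last (n + 1)) ∘ₗ t (n + 1) = d n 0
  s_t : ∀ n (i : Fin n), s n i.castSucc ∘ₗ t n = t (n + 1) ∘ₗ s n i.succ
  s_last_t : ∀ n, s n (Fin.last n) ∘ₗ t n = t (n + 1) ∘ₗ t (n + 1) ∘ₗ s n 0

attribute [instance] CyclicModule.grp CyclicModule.mod

/-- A morphism of cyclic modules. -/
structure CyclicHom {k : Type u} [CommRing k] (M : CyclicModule.{u, v} k)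
    (N : CyclicModule.{u, w} k) where
  f : ∀ n, M.X n →ₗ[k] N.X n
  comm_d : ∀ n i, f n ∘ₗ M.d n i = N.d n i ∘ₗ f (n + 1)
  comm_s : ∀ n i, f (n + 1) ∘ₗ M.s n i = N.s n i ∘ₗ f n
  comm_t : ∀ n, f n ∘ₗ M.t n = N.t n ∘ₗ f n

theorem sum_lcomp {k ι U V W : Type*} [CommRing k] [AddCommGroup U] [AddCommGroup V]
    [AddCommGroup W] [Module k U] [Module k V] [Module k W] (s : Finset ι) (f : ι → V →ₗ[k] W)
    (g : U →ₗ[k] V) : (∑ i ∈ s, f i) ∘ₗ g = ∑ i ∈ s, f i ∘ₗ g := by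
  ext x; simp

theorem lcomp_sum {k ι U V W : Type*} [CommRing k] [AddCommGroup U] [AddCommGroup V]
    [AddCommGroup W] [Module k U] [Module k V] [Module k W] (s : Finset ι) (f : V →ₗ[k] W)
    (g : ι → U →ₗ[k] V) : f ∘ₗ (∑ i ∈ s, g i) = ∑ i ∈ s, f ∘ₗ g i := by
  ext x; simp

namespace CyclicModule

variable {k : Type u} [CommRing k] (M : CyclicModule.{u, v} k)

/-- The Hochschild boundary `b = ∑ (-1)^i δ_i`. -/
def b (n : ℕ) : M.X (n + 1) →ₗ[k] M.X n :=
  ∑ i : Fin (n + 2), (-1 : k) ^ (i : ℕ) • M.d n i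

/-- The inverse of `t_n`, which is `t_n ^ n` because `t_n ^ (n + 1) = 1`. -/
def tInv (n : ℕ) : Module.End k (M.X n) := (M.t n : Module.End k (M.X n)) ^ n

/-- `∑_{i=0}^n (-1)^{in} t_n^i`. -/
def norm (n : ℕ) : Module.End k (M.X n) :=
  ∑ i ∈ Finset.range (n + 1), (-1 : k) ^ (i * n) • (M.t n : Module.End k (M.X n)) ^ i

/-- The operator `B_n = (t_{n+1}^{-1} + (-1)^n) ∘ σ_n^n ∘ ∑_{i=0}^n (-1)^{in} t_n^i`. -/
def B (n : ℕ) : M.X n →ₗ[k] M.X (n + 1) :=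
  (M.tInv (n + 1) + (-1 : k) ^ n • (1 : Module.End k (M.X (n + 1)))) ∘ₗ
    M.s n (Fin.last n) ∘ₗ M.norm n

theorem b_b (n : ℕ) : M.b n ∘ₗ M.b (n + 1) = 0 := by
  simp only [b, sum_lcomp, lcomp_sum]
  rw [Finset.sum_comm, ← Finset.sum_product']
  let P := Fin (n + 2) × Fin (n + 3)
  let S : Finset P := {ij : P | (ij.2 : ℕ) ≤ (ij.1 : ℕ)}
  rw [Finset.univ_product_univ, ← Finset.sum_add_sum_compl S, ← eq_neg_iff_add_eq_zero,
    ← Finset.sum_neg_distrib]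
  let φ : ∀ ij : P, ij ∈ S → P := fun ij hij =>
    (Fin.castLT ij.2 (lt_of_le_of_lt (Finset.mem_filter.mp hij).right (Fin.is_lt ij.1)),
      ij.1.succ)
  apply Finset.sum_bij φ
  · intro ij hij
    simp_rw [S, φ, Finset.compl_filter, Finset.mem_filter_univ, Fin.val_succ,
      Fin.val_castLT] at hij ⊢
    lia
  · rintro ⟨i, j⟩ hij ⟨i', j'⟩ hij' h
    rw [Prod.mk_inj]
    exact ⟨by simpa [φ] using! congr_arg Prod.snd h,
      by simpa [φ, Fin.castSucc_castLT] using! congr_arg Fin.castSucc (congr_arg Prod.fst h)⟩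
  · rintro ⟨i', j'⟩ hij'
    simp_rw [S, Finset.compl_filter, Finset.mem_filter_univ, not_le] at hij'
    refine ⟨(j'.pred <| ?_, Fin.castSucc i'), ?_, ?_⟩
    · rintro rfl
      simp only [Fin.val_zero, not_lt_zero] at hij'
    · simpa [S] using! Nat.le_sub_one_of_lt hij'
    · simp only [φ, Fin.castLT_castSucc, Fin.succ_pred]
  · rintro ⟨i, j⟩ hij
    have hij2 : (j : ℕ) ≤ (i : ℕ) := by simpa [S] using! hij
    have key := M.d_d n (Fin.castLT j (lt_of_le_of_lt hij2 i.is_lt)) i (by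
      rw [Fin.le_def]; simpa using hij2)
    rw [Fin.castSucc_castLT] at key
    simp only [φ, LinearMap.smul_comp, LinearMap.comp_smul, smul_smul, key, Fin.val_succ,
      Fin.val_castLT, ← neg_smul]
    congr 1
    ring

/-- The signed operator `(-1)^n t_n`. -/
def L (n : ℕ) : Module.End k (M.X n) := (-1 : k) ^ n • (M.t n : Module.End k (M.X n))

theorem L_pow_apply (n i : ℕ) :
    M.L n ^ i = (-1 : k) ^ (i * n) • (M.t n : Module.End k (M.X n)) ^ i := by
  rw [L, smul_pow, ← pow_mul, mul_comm]

theorem L_pow (n : ℕ) : M.L n ^ (n + 1) = 1 := by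
  rw [L_pow_apply, M.t_pow, Even.neg_one_pow, one_smul]
  rw [mul_comm]; exact Nat.even_mul_succ_self n

theorem norm_eq (n : ℕ) : M.norm n = ∑ i ∈ Finset.range (n + 1), M.L n ^ i := by
  simp only [norm, L_pow_apply]

theorem norm_mul_L (n : ℕ) : M.norm n * M.L n = M.norm n := by
  rw [norm_eq, Finset.sum_mul]
  simp only [← pow_succ]
  have := Finset.sum_range_succ' (fun i => M.L n ^ i) (n + 1)
  rw [Finset.sum_range_succ, L_pow, pow_zero] at this
  exact (add_right_cancel this).symm

theorem norm_mul_L_pow (n i : ℕ) : M.norm n * M.L n ^ i = M.norm n := by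
  induction i with
  | zero => simp
  | succ i ih => rw [pow_succ, ← mul_assoc, ih, norm_mul_L]

theorem L_pow_mul_norm (n i : ℕ) : M.L n ^ i * M.norm n = M.norm n := by
  conv_rhs => rw [← norm_mul_L_pow M n i]
  rw [norm_eq]
  exact (Commute.sum_right _ _ _ fun j _ => Commute.pow_pow_self _ _ _).eq

theorem norm_eq_succ (n : ℕ) : M.norm n = ∑ i ∈ Finset.range (n + 1), M.L n ^ (i + 1) := by
  conv_lhs => rw [← norm_mul_L, norm_eq, Finset.sum_mul]
  simp only [pow_succ]

/-- The last face with its sign. -/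
def e (n : ℕ) : M.X (n + 1) →ₗ[k] M.X n := (-1 : k) ^ (n + 1) • M.d n (Fin.last (n + 1))

theorem d_eq (n : ℕ) (j : Fin (n + 2)) :
    (-1 : k) ^ (j : ℕ) • M.d n j =
      (M.L n ^ (n + 1 - (j : ℕ))) ∘ₗ M.e n ∘ₗ (M.L (n + 1) ^ ((j : ℕ) + 1)) := by
  obtain ⟨j, hj⟩ := j
  induction j with
  | zero =>
    simp only [pow_zero, one_smul, Nat.sub_zero, L_pow, zero_add, pow_one]
    simp only [e, L, LinearMap.smul_comp, LinearMap.comp_smul, smul_smul, ← pow_add]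
    rw [d_last_t, Even.neg_one_pow ⟨n + 1, rfl⟩, one_smul]
    rfl
  | succ j ih =>
    have hj' : j < n + 1 := by omega
    have ih := ih (by omega)
    have h1 : M.L n ∘ₗ ((-1 : k) ^ (j + 1) • M.d n ⟨j + 1, hj⟩) =
        ((-1 : k) ^ j • M.d n ⟨j, by omega⟩) ∘ₗ M.L (n + 1) := by
      have := M.d_t n ⟨j, hj'⟩
      simp only [Fin.castSucc_mk, Fin.succ_mk] at this
      simp only [L, LinearMap.smul_comp, LinearMap.comp_smul, smul_smul, this, ← pow_add]
      congr 1
      ring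
    have h2 : (-1 : k) ^ (j + 1) • M.d n ⟨j + 1, hj⟩ =
        (M.L n ^ n) ∘ₗ (M.L n ∘ₗ ((-1 : k) ^ (j + 1) • M.d n ⟨j + 1, hj⟩)) := by
      rw [← LinearMap.comp_assoc, ← Module.End.mul_eq_comp, ← pow_succ, L_pow]
      rfl
    simp only at ih ⊢
    rw [h2, h1, ih]
    have h3 : M.L n ^ n * M.L n ^ (n + 1 - j) = M.L n ^ (n + 1 - (j + 1)) := by
      rw [← pow_add, show n + (n + 1 - j) = (n + 1) + (n + 1 - (j + 1)) by omega, pow_add, L_pow,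
        one_mul]
    rw [← h3, pow_succ (M.L (n + 1)) (j + 1)]
    rfl

theorem b_eq (n : ℕ) : M.b n = ∑ j ∈ Finset.range (n + 2),
    (M.L n ^ (n + 1 - j)) ∘ₗ M.e n ∘ₗ (M.L (n + 1) ^ (j + 1)) := by
  rw [b, Finset.sum_range]
  exact Finset.sum_congr rfl fun j _ => M.d_eq n j

/-- The alternating sum of all faces but the last one. -/
def b' (n : ℕ) : M.X (n + 1) →ₗ[k] M.X n :=
  ∑ i : Fin (n + 1), (-1 : k) ^ (i : ℕ) • M.d n i.castSucc

theorem b'_eq (n : ℕ) : M.b' n = ∑ j ∈ Finset.range (n + 1),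
    (M.L n ^ (n + 1 - j)) ∘ₗ M.e n ∘ₗ (M.L (n + 1) ^ (j + 1)) := by
  rw [b', Finset.sum_range]
  exact Finset.sum_congr rfl fun j _ => M.d_eq n j.castSucc

theorem norm_b (n : ℕ) : M.norm n ∘ₗ M.b n = M.norm n ∘ₗ M.e n ∘ₗ M.norm (n + 1) := by
  rw [b_eq, lcomp_sum, norm_eq_succ M (n + 1), lcomp_sum, lcomp_sum]
  refine Finset.sum_congr rfl fun j _ => ?_
  rw [← LinearMap.comp_assoc, ← Module.End.mul_eq_comp, norm_mul_L_pow]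

theorem b'_norm (n : ℕ) : M.b' n ∘ₗ M.norm (n + 1) = M.norm n ∘ₗ M.e n ∘ₗ M.norm (n + 1) := by
  rw [b'_eq, sum_lcomp]
  conv_rhs => rw [norm_eq_succ M n, ← Finset.sum_range_reflect, sum_lcomp]
  refine Finset.sum_congr rfl fun j hj => ?_
  rw [Finset.mem_range] at hj
  rw [LinearMap.comp_assoc, LinearMap.comp_assoc, ← Module.End.mul_eq_comp (M.L (n + 1) ^ (j + 1)),
    L_pow_mul_norm]
  congr 2
  omega

theorem b_one_sub (n : ℕ) : M.b n ∘ₗ (1 - M.L (n + 1) ^ (n + 1)) =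
    (1 - M.L n ^ n) ∘ₗ M.b' n := by
  have h1 : M.b n ∘ₗ (M.L (n + 1) ^ (n + 1)) = ∑ j ∈ Finset.range (n + 2),
      (M.L n ^ (n + 1 - j)) ∘ₗ M.e n ∘ₗ (M.L (n + 1) ^ j) := by
    rw [b_eq, sum_lcomp]
    refine Finset.sum_congr rfl fun j _ => ?_
    rw [LinearMap.comp_assoc, LinearMap.comp_assoc, ← Module.End.mul_eq_comp (_ ^ (j + 1)),
      ← pow_add, show j + 1 + (n + 1) = j + (n + 1 + 1) by ring, pow_add _ j, L_pow, mul_one]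
  have h2 : (M.L n ^ n) ∘ₗ M.b' n = ∑ j ∈ Finset.range (n + 1),
      (M.L n ^ (n + 1 - (j + 1))) ∘ₗ M.e n ∘ₗ (M.L (n + 1) ^ (j + 1)) := by
    rw [b'_eq, lcomp_sum]
    refine Finset.sum_congr rfl fun j hj => ?_
    rw [Finset.mem_range] at hj
    rw [← LinearMap.comp_assoc, ← Module.End.mul_eq_comp, ← pow_add,
      show n + (n + 1 - j) = (n + 1) + (n + 1 - (j + 1)) by omega, pow_add, L_pow, one_mul]
  have h3 : M.b n = M.b' n + M.e n := by
    rw [b_eq, Finset.sum_range_succ, ← b'_eq, L_pow]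
    simp [Module.End.one_eq_id]
  rw [LinearMap.comp_sub, LinearMap.sub_comp, h1, h2, Finset.sum_range_succ']
  simp only [Nat.sub_zero, L_pow, pow_zero, Module.End.one_eq_id, LinearMap.comp_id,
    LinearMap.id_comp, h3]
  abel

theorem b'_s_zero : M.b' 0 ∘ₗ M.s 0 (Fin.last 0) = LinearMap.id := by
  have := M.d_s_self 0 (Fin.last 0)
  simpa [b'] using this

theorem b'_s (n : ℕ) : M.b' (n + 1) ∘ₗ M.s (n + 1) (Fin.last (n + 1)) =
    M.s n (Fin.last n) ∘ₗ M.b' n + (-1 : k) ^ (n + 1) • LinearMap.id := by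
  rw [b', Fin.sum_univ_castSucc, LinearMap.add_comp, sum_lcomp, b', lcomp_sum]
  congr 1
  · refine Finset.sum_congr rfl fun i _ => ?_
    have := M.d_s_lt n i.castSucc (Fin.last n) (by rw [Fin.le_def]; simp; omega)
    rw [Fin.succ_last] at this
    rw [LinearMap.smul_comp, this, LinearMap.comp_smul]
    rfl
  · rw [LinearMap.smul_comp, M.d_s_self]
    rfl

theorem B_eq (n : ℕ) : M.B n = (-1 : k) ^ n • (1 - M.L (n + 1) ^ (n + 1)) ∘ₗ
    M.s n (Fin.last n) ∘ₗ M.norm n := by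
  rw [B, ← LinearMap.smul_comp, L_pow_apply, smul_sub, smul_smul, ← pow_add]
  have : Odd (n + (n + 1) * (n + 1)) := by
    have : n + (n + 1) * (n + 1) = n * (n + 1) + (2 * n + 1) := by ring
    rw [this]
    exact (Nat.even_mul_succ_self n).add_odd ⟨n, rfl⟩
  rw [this.neg_one_pow, neg_smul, one_smul, sub_neg_eq_add,
    add_comm ((-1 : k) ^ n • (1 : Module.End k (M.X (n + 1))))]
  rfl

theorem B_B (n : ℕ) : M.B (n + 1) ∘ₗ M.B n = 0 := by
  have : M.norm (n + 1) ∘ₗ (1 - M.L (n + 1) ^ (n + 1)) = 0 := by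
    rw [← Module.End.mul_eq_comp, mul_sub, mul_one, norm_mul_L_pow, sub_self]
  rw [B_eq M n, LinearMap.comp_smul, B, LinearMap.comp_assoc, LinearMap.comp_assoc,
    ← LinearMap.comp_assoc _ _ (M.norm (n + 1)), this]
  simp

theorem b_B (n : ℕ) : M.b n ∘ₗ M.B n =
    (-1 : k) ^ n • (1 - M.L n ^ n) ∘ₗ (M.b' n ∘ₗ M.s n (Fin.last n)) ∘ₗ M.norm n := by
  rw [B_eq, LinearMap.comp_smul, ← LinearMap.comp_assoc, b_one_sub]
  rfl

theorem b_B_zero : M.b 0 ∘ₗ M.B 0 = 0 := by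
  rw [b_B, b'_s_zero]
  simp

theorem b_B_add_B_b (n : ℕ) : M.b (n + 1) ∘ₗ M.B (n + 1) + M.B n ∘ₗ M.b n = 0 := by
  have h0 : (1 - M.L (n + 1) ^ (n + 1)) ∘ₗ M.norm (n + 1) = 0 := by
    rw [← Module.End.mul_eq_comp, sub_mul, L_pow_mul_norm, one_mul, sub_self]
  rw [b_B, b'_s, LinearMap.add_comp, LinearMap.comp_add, LinearMap.smul_comp, LinearMap.comp_smul,
    LinearMap.id_comp, h0, smul_zero, add_zero, LinearMap.comp_assoc, b'_norm, ← norm_b, B_eq,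
    LinearMap.smul_comp, pow_succ]
  simp only [LinearMap.comp_assoc]
  rw [← add_smul]
  simp

end CyclicModule


/-! ## Sub-, quotient and product cyclic modules -/

namespace CyclicModule

variable {k : Type u} [CommRing k]

/-- The cyclic submodule given by a family of submodules stable under the structure maps. -/
def sub (M : CyclicModule.{u, v} k) (N : ∀ n, Submodule k (M.X n))
    (hd : ∀ n i, ∀ x ∈ N (n + 1), M.d n i x ∈ N n) (hs : ∀ n i, ∀ x ∈ N n, M.s n i x ∈ N (n + 1))
    (ht : ∀ n, ∀ x ∈ N n, M.t n x ∈ N n) : CyclicModule.{u, v} k where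
  X n := N n
  d n i := (M.d n i).restrict (hd n i)
  s n i := (M.s n i).restrict (hs n i)
  t n := (M.t n).restrict (ht n)
  d_d n i j h := LinearMap.ext fun x => Subtype.ext (LinearMap.congr_fun (M.d_d n i j h) x)
  s_s n i j h := LinearMap.ext fun x => Subtype.ext (LinearMap.congr_fun (M.s_s n i j h) x)
  d_s_lt n i j h := LinearMap.ext fun x => Subtype.ext (LinearMap.congr_fun (M.d_s_lt n i j h) x)
  d_s_self n j := LinearMap.ext fun x => Subtype.ext (LinearMap.congr_fun (M.d_s_self n j) x)
  d_s_succ n j := LinearMap.ext fun x => Subtype.ext (LinearMap.congr_fun (M.d_s_succ n j) x)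
  d_s_gt n i j h := LinearMap.ext fun x => Subtype.ext (LinearMap.congr_fun (M.d_s_gt n i j h) x)
  t_pow n := by
    rw [Module.End.pow_restrict (n + 1) (ht n)]
    exact LinearMap.ext fun x => Subtype.ext (LinearMap.congr_fun (M.t_pow n) x)
  d_t n i := LinearMap.ext fun x => Subtype.ext (LinearMap.congr_fun (M.d_t n i) x)
  d_last_t n := LinearMap.ext fun x => Subtype.ext (LinearMap.congr_fun (M.d_last_t n) x)
  s_t n i := LinearMap.ext fun x => Subtype.ext (LinearMap.congr_fun (M.s_t n i) x)
  s_last_t n := LinearMap.ext fun x => Subtype.ext (LinearMap.congr_fun (M.s_last_t n) x)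

/-- The quotient cyclic module by a family of submodules stable under the structure maps. -/
def quot (M : CyclicModule.{u, v} k) (N : ∀ n, Submodule k (M.X n))
    (hd : ∀ n i, N (n + 1) ≤ (N n).comap (M.d n i))
    (hs : ∀ n i, N n ≤ (N (n + 1)).comap (M.s n i))
    (ht : ∀ n, N n ≤ (N n).comap (M.t n)) : CyclicModule.{u, v} k where
  X n := M.X n ⧸ N n
  d n i := (N (n + 1)).mapQ (N n) (M.d n i) (hd n i)
  s n i := (N n).mapQ (N (n + 1)) (M.s n i) (hs n i)
  t n := (N n).mapQ (N n) (M.t n) (ht n)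
  d_d n i j h := Submodule.linearMap_qext _ (LinearMap.ext fun x =>
    congrArg (N n).mkQ (LinearMap.congr_fun (M.d_d n i j h) x))
  s_s n i j h := Submodule.linearMap_qext _ (LinearMap.ext fun x =>
    congrArg (N (n + 2)).mkQ (LinearMap.congr_fun (M.s_s n i j h) x))
  d_s_lt n i j h := Submodule.linearMap_qext _ (LinearMap.ext fun x =>
    congrArg (N (n + 1)).mkQ (LinearMap.congr_fun (M.d_s_lt n i j h) x))
  d_s_self n j := Submodule.linearMap_qext _ (LinearMap.ext fun x =>
    congrArg (N n).mkQ (LinearMap.congr_fun (M.d_s_self n j) x))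
  d_s_succ n j := Submodule.linearMap_qext _ (LinearMap.ext fun x =>
    congrArg (N n).mkQ (LinearMap.congr_fun (M.d_s_succ n j) x))
  d_s_gt n i j h := Submodule.linearMap_qext _ (LinearMap.ext fun x =>
    congrArg (N (n + 1)).mkQ (LinearMap.congr_fun (M.d_s_gt n i j h) x))
  t_pow n := by
    have key : ∀ r x, (((N n).mapQ (N n) (M.t n) (ht n) : Module.End k (M.X n ⧸ N n)) ^ r)
        ((N n).mkQ x) = (N n).mkQ (((M.t n : Module.End k (M.X n)) ^ r) x) := by
      intro r
      induction r with
      | zero => intro x; rfl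
      | succ r ih => intro x; rw [pow_succ, pow_succ]; exact ih (M.t n x)
    refine Submodule.linearMap_qext _ (LinearMap.ext fun x => (key (n + 1) x).trans ?_)
    rw [M.t_pow]
    rfl
  d_t n i := Submodule.linearMap_qext _ (LinearMap.ext fun x =>
    congrArg (N n).mkQ (LinearMap.congr_fun (M.d_t n i) x))
  d_last_t n := Submodule.linearMap_qext _ (LinearMap.ext fun x =>
    congrArg (N n).mkQ (LinearMap.congr_fun (M.d_last_t n) x))
  s_t n i := Submodule.linearMap_qext _ (LinearMap.ext fun x =>
    congrArg (N (n + 1)).mkQ (LinearMap.congr_fun (M.s_t n i) x))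
  s_last_t n := Submodule.linearMap_qext _ (LinearMap.ext fun x =>
    congrArg (N (n + 1)).mkQ (LinearMap.congr_fun (M.s_last_t n) x))

/-- The product `M ♮ N`: levelwise tensor product with the diagonal cyclic structure. -/
def tensor (M : CyclicModule.{u, v} k) (N : CyclicModule.{u, w} k) :
    CyclicModule.{u, max v w} k where
  X n := M.X n ⊗[k] N.X n
  d n i := TensorProduct.map (M.d n i) (N.d n i)
  s n i := TensorProduct.map (M.s n i) (N.s n i)
  t n := TensorProduct.map (M.t n) (N.t n)
  d_d n i j h := by simp only [← TensorProduct.map_comp, M.d_d n i j h, N.d_d n i j h]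
  s_s n i j h := by simp only [← TensorProduct.map_comp, M.s_s n i j h, N.s_s n i j h]
  d_s_lt n i j h := by simp only [← TensorProduct.map_comp, M.d_s_lt n i j h, N.d_s_lt n i j h]
  d_s_self n j := by
    simp only [← TensorProduct.map_comp, M.d_s_self, N.d_s_self, TensorProduct.map_id]
  d_s_succ n j := by
    simp only [← TensorProduct.map_comp, M.d_s_succ, N.d_s_succ, TensorProduct.map_id]
  d_s_gt n i j h := by simp only [← TensorProduct.map_comp, M.d_s_gt n i j h, N.d_s_gt n i j h]
  t_pow n := by rw [TensorProduct.map_pow, M.t_pow, N.t_pow, TensorProduct.map_one]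
  d_t n i := by simp only [← TensorProduct.map_comp, M.d_t, N.d_t]
  d_last_t n := by simp only [← TensorProduct.map_comp, M.d_last_t, N.d_last_t]
  s_t n i := by simp only [← TensorProduct.map_comp, M.s_t, N.s_t]
  s_last_t n := by simp only [← TensorProduct.map_comp, M.s_last_t, N.s_last_t]

/-- The constant cyclic module on a `k`-module `W`. -/
def const (W : Type w) [AddCommGroup W] [Module k W] : CyclicModule.{u, w} k where
  X _ := W
  d _ _ := LinearMap.id
  s _ _ := LinearMap.id
  t _ := LinearMap.id
  d_d _ _ _ _ := rfl
  s_s _ _ _ _ := rfl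
  d_s_lt _ _ _ _ := rfl
  d_s_self _ _ := rfl
  d_s_succ _ _ := rfl
  d_s_gt _ _ _ _ := rfl
  t_pow _ := one_pow _
  d_t _ _ := rfl
  d_last_t _ := rfl
  s_t _ _ := rfl
  s_last_t _ := rfl

end CyclicModule

/-! ## Cyclic modules with a group action -/

/-- A cyclic `k`-module with an action of `G` by automorphisms. The action is recorded as a left
action `ρ`; the corresponding right action is `x · g = ρ g⁻¹ x`. -/
structure CyclicRep (k : Type u) (G : Type w) [CommRing k] [Group G] extends
    CyclicModule.{u, v} k where
  ρ : ∀ n, Representation k G (X n)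
  ρ_d : ∀ g n i, ρ n g ∘ₗ d n i = d n i ∘ₗ ρ (n + 1) g
  ρ_s : ∀ g n i, ρ (n + 1) g ∘ₗ s n i = s n i ∘ₗ ρ n g
  ρ_t : ∀ g n, ρ n g ∘ₗ t n = t n ∘ₗ ρ n g

/-- The tensor product `V ⊗_{kG} W` of the right `kG`-module `V`, with `x · g = ρ g⁻¹ x`, and the
left `kG`-module `W`: the quotient of `V ⊗_k W` by `x · g ⊗ y - x ⊗ g y`. -/
def balancedRel {k G V W : Type*} [CommRing k] [Group G] [AddCommGroup V] [Module k V]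
    [AddCommGroup W] [Module k W] (ρ : Representation k G V) (σ : Representation k G W) :
    Submodule k (V ⊗[k] W) :=
  Submodule.span k {z | ∃ (g : G) (x : V) (y : W), z = ρ g⁻¹ x ⊗ₜ y - x ⊗ₜ σ g y}

/-- `V ⊗_{kG} W`; see `balancedRel`. -/
abbrev Balanced {k G V W : Type*} [CommRing k] [Group G] [AddCommGroup V] [Module k V]
    [AddCommGroup W] [Module k W] (ρ : Representation k G V) (σ : Representation k G W) :=
  (V ⊗[k] W) ⧸ balancedRel ρ σ

theorem balancedRel_le {k G V V' W W' : Type*} [CommRing k] [Group G]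
    [AddCommGroup V] [Module k V] [AddCommGroup W] [Module k W]
    [AddCommGroup V'] [Module k V'] [AddCommGroup W'] [Module k W']
    (ρ : Representation k G V) (σ : Representation k G W)
    (ρ' : Representation k G V') (σ' : Representation k G W')
    (f : V →ₗ[k] V') (h : W →ₗ[k] W') (hf : ∀ g, ρ' g ∘ₗ f = f ∘ₗ ρ g)
    (hh : ∀ g, σ' g ∘ₗ h = h ∘ₗ σ g) :
    balancedRel ρ σ ≤ (balancedRel ρ' σ').comap (TensorProduct.map f h) := by
  rw [balancedRel, Submodule.span_le]
  rintro _ ⟨g, x, y, rfl⟩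
  refine Submodule.subset_span ⟨g, f x, h y, ?_⟩
  have h1 := LinearMap.congr_fun (hf g⁻¹) x
  have h2 := LinearMap.congr_fun (hh g) y
  simp only [LinearMap.comp_apply] at h1 h2
  rw [map_sub, TensorProduct.map_tmul, TensorProduct.map_tmul, h1, h2]

/-- The map `f ⊗ h : V ⊗_{kG} W → V' ⊗_{kG} W'` induced by two `G`-equivariant maps. -/
def balancedMap {k G V V' W W' : Type*} [CommRing k] [Group G]
    [AddCommGroup V] [Module k V] [AddCommGroup W] [Module k W]
    [AddCommGroup V'] [Module k V'] [AddCommGroup W'] [Module k W']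
    (ρ : Representation k G V) (σ : Representation k G W)
    (ρ' : Representation k G V') (σ' : Representation k G W')
    (f : V →ₗ[k] V') (h : W →ₗ[k] W') (hf : ∀ g, ρ' g ∘ₗ f = f ∘ₗ ρ g)
    (hh : ∀ g, σ' g ∘ₗ h = h ∘ₗ σ g) : Balanced ρ σ →ₗ[k] Balanced ρ' σ' :=
  Submodule.mapQ _ _ (TensorProduct.map f h) (balancedRel_le ρ σ ρ' σ' f h hf hh)

namespace CyclicRep

variable {k : Type u} {G : Type w} [CommRing k] [Group G]

/-- The cyclic module of coinvariants `M_G = M / ⟨x - g x⟩`. -/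
def coinvariants (M : CyclicRep.{u, v, w} k G) : CyclicModule.{u, v} k :=
  M.toCyclicModule.quot (fun n => Submodule.span k {z | ∃ (g : G) (x : M.X n), z = x - M.ρ n g x})
    (fun n i => by
      rw [Submodule.span_le]
      rintro _ ⟨g, x, rfl⟩
      refine Submodule.subset_span ⟨g, M.d n i x, ?_⟩
      rw [map_sub]
      exact congrArg _ (LinearMap.congr_fun (M.ρ_d g n i) x).symm)
    (fun n i => by
      rw [Submodule.span_le]
      rintro _ ⟨g, x, rfl⟩
      refine Submodule.subset_span ⟨g, M.s n i x, ?_⟩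
      rw [map_sub]
      exact congrArg _ (LinearMap.congr_fun (M.ρ_s g n i) x).symm)
    (fun n => by
      rw [Submodule.span_le]
      rintro _ ⟨g, x, rfl⟩
      refine Submodule.subset_span ⟨g, M.t n x, ?_⟩
      rw [map_sub]
      exact congrArg _ (LinearMap.congr_fun (M.ρ_t g n) x).symm)

/-- The quotient map `M → M_G`. -/
def toCoinvariants (M : CyclicRep.{u, v, w} k G) :
    CyclicHom M.toCyclicModule M.coinvariants where
  f _ := Submodule.mkQ _
  comm_d _ _ := rfl
  comm_s _ _ := rfl
  comm_t _ := rfl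

/-- The product `M ♮ N` with the diagonal action. -/
def tensor (M : CyclicRep.{u, v, w} k G) (N : CyclicRep.{u, v', w} k G) :
    CyclicRep.{u, max v v', w} k G where
  toCyclicModule := M.toCyclicModule.tensor N.toCyclicModule
  ρ n := (M.ρ n).tprod (N.ρ n)
  ρ_d g n i := by
    change TensorProduct.map _ _ ∘ₗ TensorProduct.map _ _ =
      TensorProduct.map _ _ ∘ₗ TensorProduct.map _ _
    simp only [← TensorProduct.map_comp, M.ρ_d, N.ρ_d]
  ρ_s g n i := by
    change TensorProduct.map _ _ ∘ₗ TensorProduct.map _ _ =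
      TensorProduct.map _ _ ∘ₗ TensorProduct.map _ _
    simp only [← TensorProduct.map_comp, M.ρ_s, N.ρ_s]
  ρ_t g n := by
    change TensorProduct.map _ _ ∘ₗ TensorProduct.map _ _ =
      TensorProduct.map _ _ ∘ₗ TensorProduct.map _ _
    simp only [← TensorProduct.map_comp, M.ρ_t, N.ρ_t]

/-- The cyclic module `M ⊗_{kG} W`, where `W` is a left `kG`-module and the structure maps act on
the first factor. -/
def balanced (M : CyclicRep.{u, v, w} k G) {W : Type v'} [AddCommGroup W] [Module k W]
    (σ : Representation k G W) : CyclicModule.{u, max v v'} k :=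
  (M.toCyclicModule.tensor (CyclicModule.const W)).quot (fun n => balancedRel (M.ρ n) σ)
    (fun n i => balancedRel_le _ _ _ _ (M.d n i) LinearMap.id (fun g => M.ρ_d g n i) fun _ => rfl)
    (fun n i => balancedRel_le _ _ _ _ (M.s n i) LinearMap.id (fun g => M.ρ_s g n i) fun _ => rfl)
    (fun n => balancedRel_le _ _ _ _ (M.t n) LinearMap.id (fun g => M.ρ_t g n) fun _ => rfl)

end CyclicRep


/-! ## The cyclic module of an algebra -/

section Tuples

variable {A : Type v}

/-- `(a_0, …, a_{n+1}) ↦ (a_0, …, a_i a_{i+1}, …, a_{n+1})` for `i ≤ n`, and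
`(a_{n+1} a_0, a_1, …, a_n)` for `i = n + 1`. -/
def faceTuple [Mul A] {n : ℕ} (i : Fin (n + 2)) (a : Fin (n + 2) → A) : Fin (n + 1) → A := fun j =>
  if i = Fin.last (n + 1) then
    if j = 0 then a (Fin.last (n + 1)) * a 0 else a j.castSucc
  else if (j : ℕ) < i then a j.castSucc
  else if (j : ℕ) = i then a j.castSucc * a j.succ
  else a j.succ

/-- `(a_0, …, a_n) ↦ (a_0, …, a_i, 1, a_{i+1}, …, a_n)`. -/
def degenTuple [One A] {n : ℕ} (i : Fin (n + 1)) (a : Fin (n + 1) → A) : Fin (n + 2) → A :=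
  i.succ.insertNth 1 a

/-- `(a_0, …, a_n) ↦ (a_1, …, a_n, a_0)`. -/
def rotTuple {n : ℕ} (a : Fin (n + 1) → A) : Fin (n + 1) → A := fun j => a (j + 1)

theorem val_add_one {n : ℕ} (j : Fin (n + 1)) :
    ((j + 1 : Fin (n + 1)) : ℕ) = if (j : ℕ) = n then 0 else (j : ℕ) + 1 := by
  rw [Fin.val_add_one]
  simp [Fin.ext_iff]

/-- A tuple read through natural number indices. -/
def rd {n : ℕ} (a : Fin (n + 1) → A) (j : ℕ) : A := if h : j < n + 1 then a ⟨j, h⟩ else a 0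

theorem rd_val {n : ℕ} (a : Fin (n + 1) → A) (j : Fin (n + 1)) : a j = rd a j := by
  rw [rd, dif_pos j.2]

theorem ext_rd {n : ℕ} {a c : Fin (n + 1) → A} (h : ∀ j < n + 1, rd a j = rd c j) : a = c := by
  funext j
  rw [rd_val a, rd_val c]
  exact h j j.2

theorem rd_face [Mul A] {n : ℕ} (i : Fin (n + 2)) (a : Fin (n + 2) → A) (j : ℕ) (hj : j < n + 1) :
    rd (faceTuple i a) j = if (i : ℕ) = n + 1 then
      if j = 0 then rd a (n + 1) * rd a 0 else rd a j
    else if j < i then rd a j else if j = i then rd a j * rd a (j + 1) else rd a (j + 1) := by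
  rw [rd, dif_pos hj, faceTuple]
  simp only [Fin.ext_iff, rd_val a, Fin.val_last, Fin.val_castSucc, Fin.val_succ, Fin.val_zero]

theorem rd_degen [One A] {n : ℕ} (i : Fin (n + 1)) (a : Fin (n + 1) → A) (j : ℕ)
    (hj : j < n + 2) :
    rd (degenTuple i a) j = if j ≤ i then rd a j else if j = i + 1 then 1 else rd a (j - 1) := by
  rw [rd, dif_pos hj, degenTuple]
  split_ifs with h1 h2
  · rw [Fin.insertNth_apply_below (by rw [Fin.lt_def]; simp; omega)]
    simp [rd_val a]
  · have : (⟨j, hj⟩ : Fin (n + 2)) = i.succ := Fin.ext (by simpa using h2)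
    rw [this, Fin.insertNth_apply_same]
  · rw [Fin.insertNth_apply_above (by rw [Fin.lt_def]; simp; omega)]
    simp [rd_val a]

theorem rd_rot {n : ℕ} (a : Fin (n + 1) → A) (j : ℕ) (hj : j < n + 1) :
    rd (rotTuple a) j = if j = n then rd a 0 else rd a (j + 1) := by
  rw [rd, dif_pos hj, rotTuple, rd_val a, val_add_one]
  split_ifs <;> rfl

theorem rotTuple_iterate {n : ℕ} (a : Fin (n + 1) → A) (r : ℕ) :
    rotTuple^[r] a = fun j : Fin (n + 1) => a (Fin.ofNat (n + 1) (j + r)) := by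
  induction r with
  | zero => funext j; exact congrArg a (Fin.ext (Nat.mod_eq_of_lt j.2).symm)
  | succ r ih =>
    rw [Function.iterate_succ_apply', ih]
    funext j
    refine congrArg a (Fin.ext ?_)
    simp only [Fin.val_ofNat, val_add_one]
    split_ifs with h
    · rw [h, zero_add, show n + (r + 1) = r + (n + 1) by ring, Nat.add_mod_right]
    · congr 1; ring

theorem rotTuple_iterate_self {n : ℕ} (a : Fin (n + 1) → A) : rotTuple^[n + 1] a = a := by
  rw [rotTuple_iterate]
  funext j
  refine congrArg a (Fin.ext ?_)
  simp only [Fin.val_ofNat, Nat.add_mod_right]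
  exact Nat.mod_eq_of_lt j.2

theorem face_face [Semigroup A] {n : ℕ} (i j : Fin (n + 2)) (h : i ≤ j) (a : Fin (n + 3) → A) :
    faceTuple i (faceTuple j.succ a) = faceTuple j (faceTuple i.castSucc a) := by
  rw [Fin.le_def] at h
  have hi := i.2
  have hj := j.2
  refine ext_rd fun l hl => ?_
  rw [rd_face _ _ _ hl, rd_face _ _ _ hl]
  simp only [rd_face _ a _ (show l < n + 2 by omega), rd_face _ a _ (show l + 1 < n + 2 by omega),
    rd_face _ a _ (show n + 1 < n + 2 by omega), rd_face _ a _ (show 0 < n + 2 by omega),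
    Fin.val_succ, Fin.val_castSucc]
  grind [mul_assoc]

theorem degen_degen [One A] {n : ℕ} (i j : Fin (n + 1)) (h : i ≤ j) (a : Fin (n + 1) → A) :
    degenTuple i.castSucc (degenTuple j a) = degenTuple j.succ (degenTuple i a) := by
  rw [Fin.le_def] at h
  have hi := i.2
  have hj := j.2
  refine ext_rd fun l hl => ?_
  rw [rd_degen _ _ _ hl, rd_degen _ _ _ hl]
  simp only [Fin.val_succ, Fin.val_castSucc]
  grind [rd_degen]

theorem face_degen_lt [Monoid A] {n : ℕ} (i : Fin (n + 2)) (j : Fin (n + 1)) (h : i ≤ j.castSucc)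
    (a : Fin (n + 2) → A) :
    faceTuple i.castSucc (degenTuple j.succ a) = degenTuple j (faceTuple i a) := by
  rw [Fin.le_def] at h
  have hi := i.2
  have hj := j.2
  refine ext_rd fun l hl => ?_
  rw [rd_face _ _ _ hl, rd_degen _ _ _ hl]
  simp only [Fin.val_castSucc] at h
  simp only [Fin.val_castSucc]
  grind [rd_degen, rd_face]

theorem face_degen_self [Monoid A] {n : ℕ} (j : Fin (n + 1)) (a : Fin (n + 1) → A) :
    faceTuple j.castSucc (degenTuple j a) = a := by
  have hj := j.2
  refine ext_rd fun l hl => ?_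
  rw [rd_face _ _ _ hl]
  simp only [Fin.val_castSucc]
  grind [rd_degen, mul_one]

theorem face_degen_succ [Monoid A] {n : ℕ} (j : Fin (n + 1)) (a : Fin (n + 1) → A) :
    faceTuple j.succ (degenTuple j a) = a := by
  have hj := j.2
  refine ext_rd fun l hl => ?_
  rw [rd_face _ _ _ hl]
  simp only [Fin.val_succ]
  grind [rd_degen, one_mul]

theorem face_degen_gt [Monoid A] {n : ℕ} (i : Fin (n + 2)) (j : Fin (n + 1)) (h : j.castSucc < i)
    (a : Fin (n + 2) → A) :
    faceTuple i.succ (degenTuple j.castSucc a) = degenTuple j (faceTuple i a) := by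
  rw [Fin.lt_def] at h
  have hi := i.2
  have hj := j.2
  refine ext_rd fun l hl => ?_
  rw [rd_face _ _ _ hl, rd_degen _ _ _ hl]
  simp only [Fin.val_castSucc] at h
  simp only [Fin.val_succ]
  grind [rd_degen, rd_face]

theorem face_rot [Mul A] {n : ℕ} (i : Fin (n + 1)) (a : Fin (n + 2) → A) :
    faceTuple i.castSucc (rotTuple a) = rotTuple (faceTuple i.succ a) := by
  have hi := i.2
  refine ext_rd fun l hl => ?_
  rw [rd_face _ _ _ hl, rd_rot _ _ hl]
  simp only [Fin.val_castSucc]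
  grind [rd_rot, rd_face]

theorem face_last_rot [Mul A] {n : ℕ} (a : Fin (n + 2) → A) :
    faceTuple (Fin.last (n + 1)) (rotTuple a) = faceTuple 0 a := by
  refine ext_rd fun l hl => ?_
  rw [rd_face _ _ _ hl, rd_face _ _ _ hl]
  simp only [Fin.val_last, Fin.val_zero]
  grind [rd_rot]

theorem degen_rot [One A] {n : ℕ} (i : Fin n) (a : Fin (n + 1) → A) :
    degenTuple i.castSucc (rotTuple a) = rotTuple (degenTuple i.succ a) := by
  have hi := i.2
  refine ext_rd fun l hl => ?_
  rw [rd_degen _ _ _ hl, rd_rot _ _ hl]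
  simp only [Fin.val_castSucc]
  grind [rd_rot, rd_degen]

theorem degen_last_rot [One A] {n : ℕ} (a : Fin (n + 1) → A) :
    degenTuple (Fin.last n) (rotTuple a) = rotTuple (rotTuple (degenTuple 0 a)) := by
  refine ext_rd fun l hl => ?_
  rw [rd_degen _ _ _ hl, rd_rot _ _ hl]
  simp only [Fin.val_last]
  grind [rd_rot, rd_degen]

end Tuples

section Algebra

variable {k : Type u} [CommRing k]

theorem tupleMap_aux {A : Type v} [AddCommGroup A] [Module k A] {n m : ℕ}
    {F : (Fin n → A) → (Fin m → A)}
    (hF : ∀ a i, ∃ (j : Fin m) (l : A →ₗ[k] A),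
      ∀ x, F (Function.update a i x) = Function.update (F a) j (l x)) (a : Fin n → A) (i : Fin n) :
    ∃ l : A →ₗ[k] (⨂[k] _ : Fin m, A),
      ∀ x, PiTensorProduct.tprod k (F (Function.update a i x)) = l x := by
  obtain ⟨j, l, h⟩ := hF a i
  exact ⟨(PiTensorProduct.tprod k).toLinearMap (F a) j ∘ₗ l, fun x => by rw [h]; rfl⟩

/-- The linear map `a_1 ⊗ … ⊗ a_n ↦ F(a)_1 ⊗ … ⊗ F(a)_m`, for `F` such that each entry of `a`
enters linearly into exactly one entry of `F a`. -/
def tupleMap {A : Type v} [AddCommGroup A] [Module k A] {n m : ℕ} (F : (Fin n → A) → (Fin m → A))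
    (hF : ∀ a i, ∃ (j : Fin m) (l : A →ₗ[k] A),
      ∀ x, F (Function.update a i x) = Function.update (F a) j (l x)) :
    (⨂[k] _ : Fin n, A) →ₗ[k] (⨂[k] _ : Fin m, A) :=
  PiTensorProduct.lift
    { toFun := fun a => PiTensorProduct.tprod k (F a)
      map_update_add' := fun {hdec} a i x y => by
        obtain ⟨l, h⟩ := tupleMap_aux hF a i
        rw [Subsingleton.elim hdec (instDecidableEqFin n), h, h, h, map_add]
      map_update_smul' := fun {hdec} a i c x => by
        obtain ⟨l, h⟩ := tupleMap_aux hF a i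
        rw [Subsingleton.elim hdec (instDecidableEqFin n), h, h, map_smul] }

@[simp]
theorem tupleMap_tprod {A : Type v} [AddCommGroup A] [Module k A] {n m : ℕ}
    (F : (Fin n → A) → (Fin m → A)) (hF) (a : Fin n → A) :
    tupleMap (k := k) F hF (PiTensorProduct.tprod k a) = PiTensorProduct.tprod k (F a) :=
  PiTensorProduct.lift.tprod a

variable (k) (A : Type v) [Ring A] [Algebra k A]

theorem face_update {n : ℕ} (i : Fin (n + 2)) (a : Fin (n + 2) → A) (r : Fin (n + 2)) :
    ∃ (j : Fin (n + 1)) (l : A →ₗ[k] A), ∀ x,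
      faceTuple i (Function.update a r x) = Function.update (faceTuple i a) j (l x) := by
  have hi := i.2
  have hr := r.2
  by_cases h1 : (i : ℕ) = n + 1
  · by_cases h2 : (r : ℕ) = n + 1
    · refine ⟨0, LinearMap.mulRight k (a 0), fun x => funext fun l => ?_⟩
      simp only [faceTuple, Function.update_apply, Fin.ext_iff, LinearMap.mulRight_apply,
        Fin.val_last, Fin.val_zero, Fin.val_castSucc, Fin.val_succ]
      grind
    · by_cases h3 : (r : ℕ) = 0
      · refine ⟨0, LinearMap.mulLeft k (a (Fin.last _)), fun x => funext fun l => ?_⟩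
        simp only [faceTuple, Function.update_apply, Fin.ext_iff, LinearMap.mulLeft_apply,
          Fin.val_last, Fin.val_zero, Fin.val_castSucc, Fin.val_succ]
        grind
      · refine ⟨⟨r, by omega⟩, LinearMap.id, fun x => funext fun l => ?_⟩
        simp only [faceTuple, Function.update_apply, Fin.ext_iff, LinearMap.id_apply,
          Fin.val_last, Fin.val_zero, Fin.val_castSucc, Fin.val_succ]
        grind
  · by_cases h2 : (r : ℕ) < i
    · refine ⟨⟨r, by omega⟩, LinearMap.id, fun x => funext fun l => ?_⟩
      simp only [faceTuple, Function.update_apply, Fin.ext_iff, LinearMap.id_apply,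
        Fin.val_last, Fin.val_zero, Fin.val_castSucc, Fin.val_succ]
      grind
    · by_cases h3 : (r : ℕ) = i
      · refine ⟨⟨i, by omega⟩, LinearMap.mulRight k (a ⟨i + 1, by omega⟩),
          fun x => funext fun l => ?_⟩
        simp only [faceTuple, Function.update_apply, Fin.ext_iff, LinearMap.mulRight_apply,
          Fin.val_last, Fin.val_zero, Fin.val_castSucc, Fin.val_succ]
        grind
      · by_cases h4 : (r : ℕ) = i + 1
        · refine ⟨⟨i, by omega⟩, LinearMap.mulLeft k (a i), fun x => funext fun l => ?_⟩
          have hl : (l : ℕ) = i → l.castSucc = i := fun h => Fin.ext h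
          simp only [faceTuple, Function.update_apply, Fin.ext_iff, LinearMap.mulLeft_apply,
            Fin.val_last, Fin.val_zero, Fin.val_castSucc, Fin.val_succ]
          grind
        · refine ⟨⟨r - 1, by omega⟩, LinearMap.id, fun x => funext fun l => ?_⟩
          simp only [faceTuple, Function.update_apply, Fin.ext_iff, LinearMap.id_apply,
            Fin.val_last, Fin.val_zero, Fin.val_castSucc, Fin.val_succ]
          grind

theorem degen_update {n : ℕ} (i : Fin (n + 1)) (a : Fin (n + 1) → A) (r : Fin (n + 1)) :
    ∃ (j : Fin (n + 2)) (l : A →ₗ[k] A), ∀ x,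
      degenTuple i (Function.update a r x) = Function.update (degenTuple i a) j (l x) :=
  ⟨i.succ.succAbove r, LinearMap.id, fun _ => Fin.insertNth_update _ _ _ _ _⟩

theorem rot_update {n : ℕ} (a : Fin (n + 1) → A) (r : Fin (n + 1)) :
    ∃ (j : Fin (n + 1)) (l : A →ₗ[k] A), ∀ x,
      rotTuple (Function.update a r x) = Function.update (rotTuple a) j (l x) := by
  refine ⟨r - 1, LinearMap.id, fun x => funext fun l => ?_⟩
  simp only [rotTuple, Function.update_apply, LinearMap.id_apply, eq_sub_iff_add_eq]

/-- The cyclic module `A^♮` of a unital `k`-algebra: `A^♮([n]) = A^{⊗ (n+1)}`. -/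
def algCyclic : CyclicModule.{u, max u v} k where
  X n := ⨂[k] _ : Fin (n + 1), A
  d n i := tupleMap (faceTuple i) (face_update k A i)
  s n i := tupleMap (degenTuple i) (degen_update k A i)
  t n := tupleMap rotTuple (rot_update k A)
  d_d n i j h := PiTensorProduct.ext (MultilinearMap.ext fun a => by simp [face_face i j h])
  s_s n i j h := PiTensorProduct.ext (MultilinearMap.ext fun a => by simp [degen_degen i j h])
  d_s_lt n i j h := PiTensorProduct.ext (MultilinearMap.ext fun a => by simp [face_degen_lt i j h])
  d_s_self n j := PiTensorProduct.ext (MultilinearMap.ext fun a => by simp [face_degen_self])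
  d_s_succ n j := PiTensorProduct.ext (MultilinearMap.ext fun a => by simp [face_degen_succ])
  d_s_gt n i j h := PiTensorProduct.ext (MultilinearMap.ext fun a => by simp [face_degen_gt i j h])
  t_pow n := PiTensorProduct.ext (MultilinearMap.ext fun a => by
    have key : ∀ r, ((tupleMap rotTuple (rot_update k A) :
        Module.End k (⨂[k] _ : Fin (n + 1), A)) ^ r) (PiTensorProduct.tprod k a) =
        PiTensorProduct.tprod k (rotTuple^[r] a) := by
      intro r
      induction r with
      | zero => rfl
      | succ r ih =>
        rw [pow_succ', Module.End.mul_apply, ih, tupleMap_tprod, Function.iterate_succ_apply']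
    have := key (n + 1)
    rw [rotTuple_iterate_self] at this
    exact this)
  d_t n i := PiTensorProduct.ext (MultilinearMap.ext fun a => by simp [face_rot])
  d_last_t n := PiTensorProduct.ext (MultilinearMap.ext fun a => by simp [face_last_rot])
  s_t n i := PiTensorProduct.ext (MultilinearMap.ext fun a => by simp [degen_rot])
  s_last_t n := PiTensorProduct.ext (MultilinearMap.ext fun a => by simp [degen_last_rot])

end Algebra


/-! ## The cyclic modules `A^♮` and `G^{k♮}` with their `G`-actions -/

section Actions

variable (k : Type u) [CommRing k] (A : Type v) [Ring A] [Algebra k A] (G : Type w) [Group G]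

theorem lmapDomain_comp_lmapDomain {α β γ : Type*} (f : α → β) (g : β → γ) :
    Finsupp.lmapDomain k k g ∘ₗ Finsupp.lmapDomain k k f = Finsupp.lmapDomain k k (g ∘ f) :=
  (Finsupp.lmapDomain_comp k k f g).symm

/-- The diagonal action of `G` on `A^{⊗ (n+1)}`. -/
def algAct [MulSemiringAction G A] [SMulCommClass G k A] (n : ℕ) :
    Representation k G (⨂[k] _ : Fin (n + 1), A) where
  toFun g := PiTensorProduct.map fun _ => DistribSMul.toLinearMap k A g
  map_one' := PiTensorProduct.ext (MultilinearMap.ext fun a => by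
    change PiTensorProduct.map _ (PiTensorProduct.tprod k a) = PiTensorProduct.tprod k a
    simp)
  map_mul' g h := PiTensorProduct.ext (MultilinearMap.ext fun a => by
    change PiTensorProduct.map _ (PiTensorProduct.tprod k a) =
      PiTensorProduct.map _ (PiTensorProduct.map _ (PiTensorProduct.tprod k a))
    simp [mul_smul])

theorem algAct_tprod [MulSemiringAction G A] [SMulCommClass G k A] {n : ℕ} (g : G)
    (a : Fin (n + 1) → A) : algAct k A G n g (PiTensorProduct.tprod k a) =
      PiTensorProduct.tprod k fun i => g • a i :=
  PiTensorProduct.map_tprod _ _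

/-- `A^♮` with the diagonal action of `G`. -/
def algRep [MulSemiringAction G A] [SMulCommClass G k A] : CyclicRep.{u, max u v, w} k G where
  toCyclicModule := algCyclic k A
  ρ := algAct k A G
  ρ_d g n i := PiTensorProduct.ext (MultilinearMap.ext fun a => by
    change algAct k A G n g (tupleMap _ (face_update k A i) (PiTensorProduct.tprod k a)) =
      tupleMap _ (face_update k A i) (algAct k A G (n + 1) g (PiTensorProduct.tprod k a))
    rw [algAct_tprod, tupleMap_tprod, tupleMap_tprod, algAct_tprod]
    congr 1
    funext j
    simp only [faceTuple]
    split_ifs <;> simp [smul_mul'])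
  ρ_s g n i := PiTensorProduct.ext (MultilinearMap.ext fun a => by
    change algAct k A G (n + 1) g (tupleMap _ (degen_update k A i) (PiTensorProduct.tprod k a)) =
      tupleMap _ (degen_update k A i) (algAct k A G n g (PiTensorProduct.tprod k a))
    rw [algAct_tprod, tupleMap_tprod, tupleMap_tprod, algAct_tprod]
    congr 1
    funext j
    simp only [degenTuple]
    refine Fin.succAboveCases i.succ ?_ (fun l => ?_) j <;> simp)
  ρ_t g n := PiTensorProduct.ext (MultilinearMap.ext fun a => by
    change algAct k A G n g (tupleMap _ (rot_update k A) (PiTensorProduct.tprod k a)) =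
      tupleMap _ (rot_update k A) (algAct k A G n g (PiTensorProduct.tprod k a))
    rw [algAct_tprod, tupleMap_tprod, tupleMap_tprod, algAct_tprod]
    rfl)

/-- The left `G`-action `g · (g_0 ⊗ … ⊗ g_n) = g g_0 ⊗ … ⊗ g g_n` on `(kG)^{⊗ (n+1)}`. -/
def tupleRep (n : ℕ) : Representation k G ((Fin (n + 1) → G) →₀ k) where
  toFun g := Finsupp.lmapDomain k k fun x j => g * x j
  map_one' := by
    simp only [one_mul]
    exact Finsupp.lmapDomain_id k k
  map_mul' g h := by
    rw [Module.End.mul_eq_comp, lmapDomain_comp_lmapDomain]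
    congr 1
    funext x j
    exact mul_assoc g h (x j)

theorem val_succAbove {n : ℕ} (i : Fin (n + 1)) (l : Fin n) :
    ((i.succAbove l : Fin (n + 1)) : ℕ) = if (l : ℕ) < i then (l : ℕ) else l + 1 := by
  simp only [Fin.succAbove, Fin.lt_def, Fin.val_castSucc]
  split_ifs <;> simp

theorem val_predAbove {n : ℕ} (i : Fin n) (l : Fin (n + 1)) :
    ((i.predAbove l : Fin n) : ℕ) = if (i : ℕ) < l then (l : ℕ) - 1 else l := by
  simp only [Fin.predAbove, Fin.lt_def, Fin.val_castSucc]
  split_ifs <;> simp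

/-- The cyclic module `G^{k♮}`: `G^{k♮}([n]) = (kG)^{⊗ (n+1)}` is the free `k`-module on the
elements `g_0 ⊗ … ⊗ g_n`; faces omit an entry, degeneracies repeat an entry and `t_n` rotates. The
right action is `(g_0 ⊗ … ⊗ g_n) · g = g⁻¹ g_0 ⊗ … ⊗ g⁻¹ g_n`. -/
def groupRep : CyclicRep.{u, max u w, w} k G where
  X n := (Fin (n + 1) → G) →₀ k
  d n i := Finsupp.lmapDomain k k fun g => g ∘ i.succAbove
  s n i := Finsupp.lmapDomain k k fun g => g ∘ i.predAbove
  t n := Finsupp.lmapDomain k k rotTuple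
  d_d n i j h := by
    simp only [lmapDomain_comp_lmapDomain]
    congr 1
    funext g l
    simp only [Function.comp_apply]
    congr 1
    rw [Fin.le_def] at h
    try simp only [Fin.val_castSucc] at h
    simp only [Fin.ext_iff, val_succAbove, val_predAbove, val_add_one, Fin.val_succ,
      Fin.val_castSucc, Fin.val_last, Fin.val_zero]
    grind
  s_s n i j h := by
    simp only [lmapDomain_comp_lmapDomain]
    congr 1
    funext g l
    simp only [Function.comp_apply]
    congr 1
    rw [Fin.le_def] at h
    try simp only [Fin.val_castSucc] at h
    simp only [Fin.ext_iff, val_succAbove, val_predAbove, val_add_one, Fin.val_succ,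
      Fin.val_castSucc, Fin.val_last, Fin.val_zero]
    grind
  d_s_lt n i j h := by
    simp only [lmapDomain_comp_lmapDomain]
    congr 1
    funext g l
    simp only [Function.comp_apply]
    congr 1
    rw [Fin.le_def] at h
    try simp only [Fin.val_castSucc] at h
    simp only [Fin.ext_iff, val_succAbove, val_predAbove, val_add_one, Fin.val_succ,
      Fin.val_castSucc, Fin.val_last, Fin.val_zero]
    grind
  d_s_self n j := by
    simp only [lmapDomain_comp_lmapDomain]
    rw [← Finsupp.lmapDomain_id]
    congr 1
    funext g l
    simp only [Function.comp_apply, id]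
    congr 1
    simp only [Fin.ext_iff, val_succAbove, val_predAbove, val_add_one, Fin.val_succ,
      Fin.val_castSucc, Fin.val_last, Fin.val_zero]
    grind
  d_s_succ n j := by
    simp only [lmapDomain_comp_lmapDomain]
    rw [← Finsupp.lmapDomain_id]
    congr 1
    funext g l
    simp only [Function.comp_apply, id]
    congr 1
    simp only [Fin.ext_iff, val_succAbove, val_predAbove, val_add_one, Fin.val_succ,
      Fin.val_castSucc, Fin.val_last, Fin.val_zero]
    grind
  d_s_gt n i j h := by
    simp only [lmapDomain_comp_lmapDomain]
    congr 1
    funext g l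
    simp only [Function.comp_apply]
    congr 1
    rw [Fin.lt_def, Fin.val_castSucc] at h
    simp only [Fin.ext_iff, val_succAbove, val_predAbove, val_add_one, Fin.val_succ,
      Fin.val_castSucc, Fin.val_last, Fin.val_zero]
    grind
  t_pow n := by
    have key : ∀ r, (Finsupp.lmapDomain k k (rotTuple (A := G) (n := n)) :
        Module.End k ((Fin (n + 1) → G) →₀ k)) ^ r = Finsupp.lmapDomain k k rotTuple^[r] := by
      intro r
      induction r with
      | zero => exact (Finsupp.lmapDomain_id k k).symm
      | succ r ih =>
        rw [pow_succ, ih, Module.End.mul_eq_comp, lmapDomain_comp_lmapDomain,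
          Function.iterate_succ]
    rw [key, show (rotTuple (A := G) (n := n))^[n + 1] = id from funext rotTuple_iterate_self]
    exact Finsupp.lmapDomain_id k k
  d_t n i := by
    simp only [lmapDomain_comp_lmapDomain]
    congr 1
    funext g l
    simp only [Function.comp_apply, rotTuple]
    congr 1
    have := l.2
    have := i.2
    simp only [Fin.ext_iff, val_succAbove, val_predAbove, val_add_one, Fin.val_succ,
      Fin.val_castSucc, Fin.val_last, Fin.val_zero]
    grind
  d_last_t n := by
    simp only [lmapDomain_comp_lmapDomain]
    congr 1
    funext g l
    simp only [Function.comp_apply, rotTuple]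
    congr 1
    have := l.2
    simp only [Fin.ext_iff, val_succAbove, val_predAbove, val_add_one, Fin.val_succ,
      Fin.val_castSucc, Fin.val_last, Fin.val_zero]
    grind
  s_t n i := by
    simp only [lmapDomain_comp_lmapDomain]
    congr 1
    funext g l
    simp only [Function.comp_apply, rotTuple]
    congr 1
    have := l.2
    have := i.2
    simp only [Fin.ext_iff, val_succAbove, val_predAbove, val_add_one, Fin.val_succ,
      Fin.val_castSucc, Fin.val_last, Fin.val_zero]
    grind
  s_last_t n := by
    simp only [lmapDomain_comp_lmapDomain]
    congr 1
    funext g l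
    simp only [Function.comp_apply, rotTuple]
    congr 1
    have := l.2
    simp only [Fin.ext_iff, val_succAbove, val_predAbove, val_add_one, Fin.val_succ,
      Fin.val_castSucc, Fin.val_last, Fin.val_zero]
    grind
  ρ := tupleRep k G
  ρ_d g n i := by
    simp only [tupleRep, MonoidHom.coe_mk, OneHom.coe_mk, lmapDomain_comp_lmapDomain]
    rfl
  ρ_s g n i := by
    simp only [tupleRep, MonoidHom.coe_mk, OneHom.coe_mk, lmapDomain_comp_lmapDomain]
    rfl
  ρ_t g n := by
    simp only [tupleRep, MonoidHom.coe_mk, OneHom.coe_mk, lmapDomain_comp_lmapDomain]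
    rfl

/-- `A ♮ G = A^♮ ♮ G^{k♮}` with the diagonal action of `G`. -/
def algGroup [MulSemiringAction G A] [SMulCommClass G k A] :
    CyclicRep.{u, max (max u v) (max u w), w} k G :=
  (algRep k A G).tensor (groupRep k G)

end Actions

/-! ## The homogeneous summand of the crossed product -/

section Homogeneous

variable (k : Type u) [CommRing k] (A : Type v) [Ring A] [Algebra k A] (G : Type w) [Group G]
  [MulSemiringAction G A] [SMulCommClass G k A]

/-- The elementary tensor `a_0 g_0 ⊗ … ⊗ a_n g_n` in `(A ⋊ G)^{⊗ (n+1)}`. The crossed product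
`A ⋊ G`, with `(a g)(b h) = a g(b) gh`, is the skew group algebra `SkewMonoidAlgebra A G`. -/
def crossedTensor {n : ℕ} (a : Fin (n + 1) → A) (g : Fin (n + 1) → G) :
    (algCyclic k (SkewMonoidAlgebra A G)).X n :=
  PiTensorProduct.tprod k fun i => SkewMonoidAlgebra.single (g i) (a i)

/-- The span of the tensors `a_0 g_0 ⊗ … ⊗ a_n g_n` with `g_0 ⋯ g_n = e`. -/
def homogeneousSpan (n : ℕ) : Submodule k ((algCyclic k (SkewMonoidAlgebra A G)).X n) :=
  Submodule.span k {z | ∃ (a : Fin (n + 1) → A) (g : Fin (n + 1) → G),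
    (List.ofFn g).prod = 1 ∧ z = crossedTensor k A G a g}

theorem homogeneousSpan_t (n : ℕ) : ∀ x ∈ homogeneousSpan k A G n,
    (algCyclic k (SkewMonoidAlgebra A G)).t n x ∈ homogeneousSpan k A G n := by
  intro x hx
  refine (Submodule.span_le.mpr ?_ :
    homogeneousSpan k A G n ≤ (homogeneousSpan k A G n).comap _) hx
  rintro _ ⟨a, g, h, rfl⟩
  refine Submodule.subset_span ⟨rotTuple a, rotTuple g, ?_, ?_⟩
  · rw [List.ofFn_succ, List.prod_cons] at h
    rw [List.ofFn_succ', List.concat_eq_append, List.prod_append, List.prod_singleton]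
    have h1 : (fun i : Fin n => rotTuple g i.castSucc) = fun i => g i.succ := by
      funext i
      simp [rotTuple]
    have h2 : rotTuple g (Fin.last n) = g 0 := by simp [rotTuple]
    rw [h1, h2]
    exact mul_eq_one_comm.mp h
  · exact tupleMap_tprod rotTuple (rot_update k _) _

theorem homogeneousSpan_t_pow (n r : ℕ) : ∀ x ∈ homogeneousSpan k A G n,
    (((algCyclic k (SkewMonoidAlgebra A G)).t n : Module.End k _) ^ r) x ∈
      homogeneousSpan k A G n := by
  induction r with
  | zero => exact fun x hx => hx
  | succ r ih =>
    intro x hx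
    rw [pow_succ]
    exact ih _ (homogeneousSpan_t k A G n x hx)

theorem homogeneousSpan_d_zero (n : ℕ) : ∀ x ∈ homogeneousSpan k A G (n + 1),
    (algCyclic k (SkewMonoidAlgebra A G)).d n 0 x ∈ homogeneousSpan k A G n := by
  intro x hx
  refine (Submodule.span_le.mpr ?_ :
    homogeneousSpan k A G (n + 1) ≤ (homogeneousSpan k A G n).comap _) hx
  rintro _ ⟨a, g, h, rfl⟩
  refine Submodule.subset_span ⟨Fin.cons (a 0 * g 0 • a 1) fun i => a i.succ.succ,
    Fin.cons (g 0 * g 1) fun i => g i.succ.succ, ?_, ?_⟩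
  · rw [List.ofFn_succ, List.ofFn_succ] at h
    rw [List.ofFn_succ]
    simpa [mul_assoc] using h
  · refine (tupleMap_tprod (faceTuple 0) (face_update k _ 0) _).trans (congrArg _ ?_)
    funext j
    have h0 : (0 : Fin (n + 2)) ≠ Fin.last (n + 1) := by simp [Fin.ext_iff]
    refine Fin.cases ?_ (fun l => ?_) j
    · simp [faceTuple, h0, SkewMonoidAlgebra.single_mul_single]
    · simp [faceTuple, h0]

theorem homogeneousSpan_s_zero (n : ℕ) : ∀ x ∈ homogeneousSpan k A G n,
    (algCyclic k (SkewMonoidAlgebra A G)).s n 0 x ∈ homogeneousSpan k A G (n + 1) := by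
  intro x hx
  refine (Submodule.span_le.mpr ?_ :
    homogeneousSpan k A G n ≤ (homogeneousSpan k A G (n + 1)).comap _) hx
  rintro _ ⟨a, g, h, rfl⟩
  refine Submodule.subset_span ⟨degenTuple 0 a, degenTuple 0 g, ?_, ?_⟩
  · rw [List.ofFn_succ] at h
    have h1 : degenTuple 0 g = Fin.cons (g 0) (Fin.cons 1 fun i : Fin n => g i.succ) := by
      funext j
      rw [rd_val (degenTuple 0 g), rd_degen _ _ _ j.2]
      refine Fin.cases ?_ (fun l => ?_) j
      · simp [rd]
      · refine Fin.cases ?_ (fun l => ?_) l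
        · simp
        · simp [rd_val g]
    rw [h1, List.ofFn_succ, List.ofFn_succ]
    simpa using h
  · refine (tupleMap_tprod (degenTuple 0) (degen_update k _ 0) _).trans (congrArg _ ?_)
    funext j
    simp only [degenTuple]
    refine Fin.succAboveCases (0 : Fin (n + 1)).succ ?_ (fun l => ?_) j
    · simp only [Fin.insertNth_apply_same]
      rfl
    · simp only [Fin.insertNth_apply_succAbove]

theorem homogeneousSpan_d (n : ℕ) (i : Fin (n + 2)) : ∀ x ∈ homogeneousSpan k A G (n + 1),
    (algCyclic k (SkewMonoidAlgebra A G)).d n i x ∈ homogeneousSpan k A G n := by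
  induction i using Fin.induction with
  | zero => exact homogeneousSpan_d_zero k A G n
  | succ i ih =>
    intro x hx
    have h1 := LinearMap.congr_fun ((algCyclic k (SkewMonoidAlgebra A G)).d_t n i) x
    have h2 := LinearMap.congr_fun ((algCyclic k (SkewMonoidAlgebra A G)).t_pow n)
      ((algCyclic k (SkewMonoidAlgebra A G)).d n i.succ x)
    rw [pow_succ, Module.End.mul_apply] at h2
    simp only [LinearMap.comp_apply] at h1
    rw [← h1, Module.End.one_apply] at h2
    rw [← h2]
    exact homogeneousSpan_t_pow k A G n n _ (ih _ (homogeneousSpan_t k A G _ x hx))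

theorem homogeneousSpan_s (n : ℕ) (i : Fin (n + 1)) : ∀ x ∈ homogeneousSpan k A G n,
    (algCyclic k (SkewMonoidAlgebra A G)).s n i x ∈ homogeneousSpan k A G (n + 1) := by
  induction i using Fin.induction with
  | zero => exact homogeneousSpan_s_zero k A G n
  | succ i ih =>
    intro x hx
    have h1 := LinearMap.congr_fun ((algCyclic k (SkewMonoidAlgebra A G)).s_t n i) x
    have h2 := LinearMap.congr_fun ((algCyclic k (SkewMonoidAlgebra A G)).t_pow (n + 1))
      ((algCyclic k (SkewMonoidAlgebra A G)).s n i.succ x)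
    rw [pow_succ, Module.End.mul_apply] at h2
    simp only [LinearMap.comp_apply] at h1
    rw [← h1, Module.End.one_apply] at h2
    rw [← h2]
    exact homogeneousSpan_t_pow k A G (n + 1) (n + 1) _ (ih _ (homogeneousSpan_t k A G _ x hx))

/-- The homogeneous summand `(A ⋊ G)^♮_e`. -/
def homogeneous : CyclicModule.{u, max u v w} k :=
  (algCyclic k (SkewMonoidAlgebra A G)).sub (homogeneousSpan k A G) (homogeneousSpan_d k A G)
    (homogeneousSpan_s k A G) (homogeneousSpan_t k A G)

/-- The element `a_0 g_0 ⊗ … ⊗ a_n g_n` of the homogeneous summand, for `g_0 ⋯ g_n = e`. -/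
def homogeneousTensor {n : ℕ} (a : Fin (n + 1) → A) (g : Fin (n + 1) → G)
    (h : (List.ofFn g).prod = 1) : (homogeneous k A G).X n :=
  ⟨crossedTensor k A G a g, Submodule.subset_span ⟨a, g, h, rfl⟩⟩

end Homogeneous


/-! ## The Hochschild, cyclic, negative cyclic and periodic cyclic complexes -/

/-- The four flavours of cyclic complexes. -/
inductive Flavour
  | hochschild
  | cyclic
  | negative
  | periodic

/-- The powers of the formal variable `u` that occur in `C`, in `C[u⁻¹,u]] / C[[u]]`, in `C[[u]]`
and in `C[u⁻¹,u]]`. -/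
def Flavour.exponents : Flavour → Set ℤ
  | .hochschild => {0}
  | .cyclic => {j | j < 0}
  | .negative => {j | 0 ≤ j}
  | .periodic => Set.univ

/-- The pairs `(j, m)` such that `x u^j` with `x` of degree `m` has total degree `n` (the variable
`u` has degree `-2`) and `u^j` is allowed. -/
abbrev UIndex (F : Flavour) (n : ℤ) :=
  {x : ℤ × ℕ // x.1 ∈ F.exponents ∧ (x.2 : ℤ) = n + 2 * x.1}

section Complexes

variable {k : Type u} [CommRing k]

/-- The chains of degree `n`: formal sums `∑_j x_j u^j` with `x_j ∈ M([n + 2j])`. As `M([m])` is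
there only for `m ≥ 0`, these are automatically Laurent series in `u`. -/
abbrev Chains (F : Flavour) (M : CyclicModule.{u, v} k) (n : ℤ) : Type v :=
  ∀ x : UIndex F n, M.X x.1.2

/-- The coefficient of `u^j` in `uB x`, where `x` has degree `n`. -/
def uB (F : Flavour) (M : CyclicModule.{u, v} k) (n j : ℤ) :
    ∀ m : ℕ, (m : ℤ) + 1 = n + 2 * j → (Chains F M n →ₗ[k] M.X m)
  | 0, _ => 0
  | m + 1, hm => open Classical in
    if hj : j - 1 ∈ F.exponents then
      M.B m ∘ₗ LinearMap.proj (⟨(j - 1, m), hj, by push_cast at hm ⊢; linarith⟩ : UIndex F n)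
    else 0

/-- The differential `b + uB`; powers of `u` that are not allowed are dropped. -/
def chainsD (F : Flavour) (M : CyclicModule.{u, v} k) (n n' : ℤ) (h : n' + 1 = n) :
    Chains F M n →ₗ[k] Chains F M n' :=
  LinearMap.pi fun x =>
    M.b x.1.2 ∘ₗ LinearMap.proj
      (⟨(x.1.1, x.1.2 + 1), x.2.1, by have := x.2.2; push_cast; linarith⟩ : UIndex F n) +
    uB F M n x.1.1 x.1.2 (by have := x.2.2; linarith)

theorem chainsD_chainsD (F : Flavour) (M : CyclicModule.{u, v} k) (n n' n'' : ℤ) (h : n' + 1 = n)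
    (h' : n'' + 1 = n') : chainsD F M n' n'' h' ∘ₗ chainsD F M n n' h = 0 := by
  refine LinearMap.ext fun z => funext fun x => ?_
  obtain ⟨⟨j, m⟩, hj, hm⟩ := x
  have hbb := fun m x => LinearMap.congr_fun (M.b_b m) x
  have hBB := fun m x => LinearMap.congr_fun (M.B_B m) x
  have hbB := fun m x => LinearMap.congr_fun (M.b_B_add_B_b m) x
  have hbB0 := fun x => LinearMap.congr_fun M.b_B_zero x
  simp only [LinearMap.comp_apply, LinearMap.add_apply, LinearMap.zero_apply] at hbb hBB hbB hbB0
  rcases m with _ | _ | m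
  · by_cases h1 : j - 1 ∈ F.exponents
    · simp [chainsD, uB, h1, hbb, hbB0]
    · simp [chainsD, uB, h1, hbb]
  · by_cases h1 : j - 1 ∈ F.exponents
    · simp [chainsD, uB, h1, hbb, hbB]
    · simp [chainsD, uB, h1, hbb]
  · by_cases h1 : j - 1 ∈ F.exponents
    · by_cases h2 : j - 1 - 1 ∈ F.exponents
      · simp only [chainsD, uB, h1, h2, LinearMap.comp_apply, LinearMap.add_apply,
          LinearMap.pi_apply, LinearMap.proj_apply, dif_pos, map_add, hbb, hBB, zero_add, add_zero,
          hbB, LinearMap.zero_apply, Pi.zero_apply]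
      · simp [chainsD, uB, h1, h2, hbb, hbB]
    · simp [chainsD, uB, h1, hbb]

/-- The Hochschild, cyclic, negative cyclic or periodic cyclic complex of a cyclic module. -/
def CC (F : Flavour) (M : CyclicModule.{u, v} k) : ChainComplex (ModuleCat.{v} k) ℤ where
  X n := ModuleCat.of k (Chains F M n)
  d n n' := if h : n' + 1 = n then ModuleCat.ofHom (chainsD F M n n' h) else 0
  shape n n' h := dif_neg h
  d_comp_d' n n' n'' h h' := by
    have h1 : n' + 1 = n := h
    have h2 : n'' + 1 = n' := h'
    rw [dif_pos h1, dif_pos h2, ← ModuleCat.ofHom_comp, chainsD_chainsD]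
    rfl

/-- The map on chains given by a family of linear maps, coefficientwise in `u`. -/
def chainsMap (F : Flavour) {M : CyclicModule.{u, v} k} {N : CyclicModule.{u, v'} k}
    (f : ∀ m, M.X m →ₗ[k] N.X m) (n : ℤ) : Chains F M n →ₗ[k] Chains F N n :=
  LinearMap.pi fun x => f x.1.2 ∘ₗ LinearMap.proj x

theorem CyclicHom.comm_b {M : CyclicModule.{u, v} k} {N : CyclicModule.{u, v'} k}
    (φ : CyclicHom M N) (n : ℕ) : φ.f n ∘ₗ M.b n = N.b n ∘ₗ φ.f (n + 1) := by
  simp only [CyclicModule.b, lcomp_sum, sum_lcomp, LinearMap.comp_smul, LinearMap.smul_comp,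
    φ.comm_d]

theorem CyclicHom.comm_t_pow {M : CyclicModule.{u, v} k} {N : CyclicModule.{u, v'} k}
    (φ : CyclicHom M N) (n r : ℕ) : φ.f n ∘ₗ ((M.t n : Module.End k (M.X n)) ^ r) =
      ((N.t n : Module.End k (N.X n)) ^ r) ∘ₗ φ.f n := by
  induction r with
  | zero => rfl
  | succ r ih =>
    rw [pow_succ, pow_succ, Module.End.mul_eq_comp, Module.End.mul_eq_comp, ← LinearMap.comp_assoc,
      ih, LinearMap.comp_assoc, φ.comm_t, LinearMap.comp_assoc]

theorem CyclicHom.comm_B {M : CyclicModule.{u, v} k} {N : CyclicModule.{u, v'} k}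
    (φ : CyclicHom M N) (n : ℕ) : φ.f (n + 1) ∘ₗ M.B n = N.B n ∘ₗ φ.f n := by
  have h1 : φ.f n ∘ₗ M.norm n = N.norm n ∘ₗ φ.f n := by
    simp only [CyclicModule.norm, lcomp_sum, sum_lcomp, LinearMap.comp_smul, LinearMap.smul_comp,
      φ.comm_t_pow]
  have h2 : φ.f (n + 1) ∘ₗ (M.tInv (n + 1) + (-1 : k) ^ n • (1 : Module.End k (M.X (n + 1)))) =
      (N.tInv (n + 1) + (-1 : k) ^ n • (1 : Module.End k (N.X (n + 1)))) ∘ₗ φ.f (n + 1) := by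
    rw [LinearMap.comp_add, LinearMap.add_comp, CyclicModule.tInv, φ.comm_t_pow,
      LinearMap.comp_smul, LinearMap.smul_comp]
    rfl
  rw [CyclicModule.B, CyclicModule.B, ← LinearMap.comp_assoc, h2, LinearMap.comp_assoc,
    ← LinearMap.comp_assoc _ _ (φ.f (n + 1)), φ.comm_s, LinearMap.comp_assoc, h1]
  rfl

theorem chainsMap_comm (F : Flavour) {M : CyclicModule.{u, v} k} {N : CyclicModule.{u, v'} k}
    (φ : CyclicHom M N) (n n' : ℤ) (h : n' + 1 = n) :
    chainsMap F φ.f n' ∘ₗ chainsD F M n n' h = chainsD F N n n' h ∘ₗ chainsMap F φ.f n := by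
  refine LinearMap.ext fun z => funext fun x => ?_
  obtain ⟨⟨j, m⟩, hj, hm⟩ := x
  have hb := fun m x => LinearMap.congr_fun (φ.comm_b m) x
  have hB := fun m x => LinearMap.congr_fun (φ.comm_B m) x
  simp only [LinearMap.comp_apply] at hb hB
  rcases m with _ | m
  · simp [chainsMap, chainsD, uB, hb]
  · by_cases h1 : j - 1 ∈ F.exponents
    · simp [chainsMap, chainsD, uB, h1, hb, hB]
    · simp [chainsMap, chainsD, uB, h1, hb]

/-- The chain map induced by a morphism of cyclic modules. -/
def CCmap (F : Flavour) {M N : CyclicModule.{u, v} k} (φ : CyclicHom M N) : CC F M ⟶ CC F N where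
  f n := ModuleCat.ofHom (chainsMap F φ.f n)
  comm' n n' h := by
    have h1 : n' + 1 = n := h
    simp only [CC, dif_pos h1, ← ModuleCat.ofHom_comp, chainsMap_comm]

/-! ## Product totalisations -/

/-- Two commuting differentials `∂ : X (p+1) q → X p q` and `δ : X p (q+1) → X p q`. -/
structure DoubleComplex (k : Type u) [CommRing k] where
  X : ℤ → ℕ → Type v
  [grp : ∀ p q, AddCommGroup (X p q)]
  [mod : ∀ p q, Module k (X p q)]
  del : ∀ p q, X (p + 1) q →ₗ[k] X p q
  delta : ∀ p q, X p (q + 1) →ₗ[k] X p q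
  del_del : ∀ p q, del p q ∘ₗ del (p + 1) q = 0
  delta_delta : ∀ p q, delta p q ∘ₗ delta p (q + 1) = 0
  del_delta : ∀ p q, del p q ∘ₗ delta (p + 1) q = delta p q ∘ₗ del p (q + 1)

attribute [instance] DoubleComplex.grp DoubleComplex.mod

namespace DoubleComplex

/-- The sign `(-1)^p`. -/
def sign (p : ℤ) : ℤ := (p.negOnePow : ℤ)

variable (D : DoubleComplex.{u, v} k)

/-- `∏_{p+q=n} X p q`. -/
abbrev totX (n : ℤ) : Type v := ∀ x : {x : ℤ × ℕ // x.1 + (x.2 : ℤ) = n}, D.X x.1.1 x.1.2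

/-- The total differential, `∂ + (-1)^p δ` on `X p (q+1)`. -/
def totD (n n' : ℤ) (h : n' + 1 = n) : D.totX n →ₗ[k] D.totX n' :=
  LinearMap.pi fun x =>
    D.del x.1.1 x.1.2 ∘ₗ LinearMap.proj (R := k) (φ := fun x : {x : ℤ × ℕ // x.1 + (x.2 : ℤ) = n} =>
      D.X x.1.1 x.1.2) ⟨(x.1.1 + 1, x.1.2), by have := x.2; linarith⟩ +
    sign x.1.1 • (D.delta x.1.1 x.1.2 ∘ₗ LinearMap.proj (R := k)
      (φ := fun x : {x : ℤ × ℕ // x.1 + (x.2 : ℤ) = n} => D.X x.1.1 x.1.2)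
      ⟨(x.1.1, x.1.2 + 1), by have := x.2; push_cast; linarith⟩)

theorem totD_apply (n n' : ℤ) (h : n' + 1 = n) (z : D.totX n) (p : ℤ) (q : ℕ)
    (hx : p + (q : ℤ) = n') : D.totD n n' h z ⟨(p, q), hx⟩ =
      D.del p q (z ⟨(p + 1, q), by linarith⟩) +
        sign p • D.delta p q (z ⟨(p, q + 1), by push_cast; linarith⟩) := rfl

theorem totD_totD (n n' n'' : ℤ) (h : n' + 1 = n) (h' : n'' + 1 = n') :
    D.totD n' n'' h' ∘ₗ D.totD n n' h = 0 := by
  refine LinearMap.ext fun z => funext fun x => ?_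
  obtain ⟨⟨p, q⟩, hx⟩ := x
  have h1 := fun x => LinearMap.congr_fun (D.del_del p q) x
  have h2 := fun x => LinearMap.congr_fun (D.delta_delta p q) x
  have h3 := fun x => LinearMap.congr_fun (D.del_delta p q) x
  simp only [LinearMap.comp_apply, LinearMap.zero_apply] at h1 h2 h3
  have hs : sign (p + 1) = - sign p := by simp [sign, Int.negOnePow_succ]
  rw [LinearMap.comp_apply, totD_apply, totD_apply, totD_apply]
  simp only [map_add, map_neg, map_zsmul, h1, h2, h3, hs, smul_zero, add_zero, zero_add, neg_smul,
    LinearMap.zero_apply, Pi.zero_apply]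
  abel

/-- The product totalisation `Tot^∏`. -/
def tot : ChainComplex (ModuleCat.{v} k) ℤ where
  X n := ModuleCat.of k (D.totX n)
  d n n' := if h : n' + 1 = n then ModuleCat.ofHom (D.totD n n' h) else 0
  shape n n' h := dif_neg h
  d_comp_d' n n' n'' h h' := by
    have h1 : n' + 1 = n := h
    have h2 : n'' + 1 = n' := h'
    rw [dif_pos h1, dif_pos h2, ← ModuleCat.ofHom_comp, totD_totD]
    rfl

/-- A morphism of double complexes. -/
structure Hom (D : DoubleComplex.{u, v} k) (E : DoubleComplex.{u, v'} k) where
  f : ∀ p q, D.X p q →ₗ[k] E.X p q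
  comm_del : ∀ p q, f p q ∘ₗ D.del p q = E.del p q ∘ₗ f (p + 1) q
  comm_delta : ∀ p q, f p q ∘ₗ D.delta p q = E.delta p q ∘ₗ f p (q + 1)

/-- The induced map of totalisations. -/
def totMap {D E : DoubleComplex.{u, v} k} (φ : Hom D E) : D.tot ⟶ E.tot where
  f n := ModuleCat.ofHom (LinearMap.pi fun x => φ.f x.1.1 x.1.2 ∘ₗ LinearMap.proj (R := k)
    (φ := fun x : {x : ℤ × ℕ // x.1 + (x.2 : ℤ) = n} => D.X x.1.1 x.1.2) x)
  comm' n n' h := by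
    have h1 : n' + 1 = n := h
    simp only [tot, dif_pos h1, ← ModuleCat.ofHom_comp]
    congr 1
    refine LinearMap.ext fun z => funext fun x => ?_
    obtain ⟨⟨p, q⟩, hx⟩ := x
    have h2 := fun x => LinearMap.congr_fun (φ.comm_del p q) x
    have h3 := fun x => LinearMap.congr_fun (φ.comm_delta p q) x
    simp only [LinearMap.comp_apply] at h2 h3
    change E.totD n n' h1 _ ⟨(p, q), hx⟩ = φ.f p q (D.totD n n' h1 z ⟨(p, q), hx⟩)
    rw [totD_apply, totD_apply, map_add, map_zsmul, h2, h3]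
    rfl

end DoubleComplex

end Complexes


/-! ## Group homology -/

section GroupHomology

variable {k : Type u} [CommRing k] {G : Type w} [Group G]

theorem tupleRep_b (q : ℕ) (g : G) : tupleRep k G q g ∘ₗ (groupRep k G).b q =
    (groupRep k G).b q ∘ₗ tupleRep k G (q + 1) g := by
  change (groupRep k G).ρ q g ∘ₗ (groupRep k G).b q =
    (groupRep k G).b q ∘ₗ (groupRep k G).ρ (q + 1) g
  simp only [CyclicModule.b, lcomp_sum, sum_lcomp, LinearMap.comp_smul, LinearMap.smul_comp]
  exact Finset.sum_congr rfl fun (i : Fin (q + 2)) _ =>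
    congrArg (fun f => (-1 : k) ^ (i : ℕ) • f) ((groupRep k G).ρ_d g q i)

theorem balanced_zero {V W V' W' : Type*} [AddCommGroup V] [Module k V] [AddCommGroup W]
    [Module k W] [AddCommGroup V'] [Module k V'] [AddCommGroup W'] [Module k W']
    {ρ : Representation k G V} {σ : Representation k G W} {ρ' : Representation k G V'}
    {σ' : Representation k G W'} {φ : Balanced ρ σ →ₗ[k] Balanced ρ' σ'}
    (h : ∀ x y, φ (Submodule.Quotient.mk (x ⊗ₜ y)) = 0) : φ = 0 :=
  Submodule.linearMap_qext _ (TensorProduct.ext' h)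

/-- A chain complex of `kG`-modules. The action is recorded as a left action `ρ`; the
corresponding right action is `x · g = ρ g⁻¹ x`. -/
structure EquivariantComplex (k : Type u) (G : Type w) [CommRing k] [Group G] where
  C : ChainComplex (ModuleCat.{v} k) ℤ
  ρ : ∀ p, Representation k G (C.X p)
  comm : ∀ p p' g, ρ p' g ∘ₗ (C.d p p').hom = (C.d p p').hom ∘ₗ ρ p g

theorem groupDoubleAux {V : Type*} [AddCommGroup V] [Module k V] (ρ : Representation k G V) (q : ℕ)
    (x : V) (y : (Fin (q + 3) → G) →₀ k) : (balancedRel ρ (tupleRep k G q)).mkQ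
      (x ⊗ₜ[k] (groupRep k G).b q ((groupRep k G).b (q + 1) y)) = 0 := by
  have h : (groupRep k G).b q ((groupRep k G).b (q + 1) y) = 0 :=
    LinearMap.congr_fun ((groupRep k G).b_b q) y
  rw [h]
  exact (congrArg _ (TensorProduct.tmul_zero _ x)).trans (map_zero _)

/-- The double complex `M_p ⊗_{kG} C_q^{Hoch}(G)`, where `C_•^{Hoch}(G)` is the Hochschild complex
of `G^{k♮}`. -/
def groupDouble (M : EquivariantComplex.{u, v, w} k G) : DoubleComplex.{u, max u v w} k where
  X p q := Balanced (M.ρ p) (tupleRep k G q)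
  del p q := balancedMap _ _ _ _ (M.C.d (p + 1) p).hom LinearMap.id (M.comm _ _) fun _ => rfl
  delta p q := balancedMap _ _ _ _ LinearMap.id ((groupRep k G).b q) (fun _ => rfl) (tupleRep_b q)
  del_del p q := Submodule.linearMap_qext _ (TensorProduct.ext' fun x y => by
    have h : (M.C.d (p + 1) p).hom ((M.C.d (p + 1 + 1) (p + 1)).hom x) = 0 := by
      rw [← LinearMap.comp_apply, ← ModuleCat.hom_comp, M.C.d_comp_d]
      rfl
    simp [balancedMap, h])
  delta_delta p q := balanced_zero fun x y => groupDoubleAux (M.ρ p) q x y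
  del_delta p q := Submodule.linearMap_qext _ (TensorProduct.ext' fun x y => rfl)

/-- The group homology complex `C_•(G; M) = Tot^∏ (M_• ⊗_{kG} C_•^{Hoch}(G))`. -/
def groupChains (M : EquivariantComplex.{u, v, w} k G) :
    ChainComplex (ModuleCat.{max u v w} k) ℤ :=
  (groupDouble M).tot

/-- The automorphism of a cyclic module given by a group element. -/
def CyclicRep.actHom (M : CyclicRep.{u, v, w} k G) (g : G) :
    CyclicHom M.toCyclicModule M.toCyclicModule where
  f n := M.ρ n g
  comm_d := M.ρ_d g
  comm_s := M.ρ_s g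
  comm_t := M.ρ_t g

/-- The action of `G` on `Chains F M n`, coefficientwise. -/
def chainsRep (F : Flavour) (M : CyclicRep.{u, v, w} k G) (n : ℤ) :
    Representation k G (Chains F M.toCyclicModule n) where
  toFun g := chainsMap F (fun m => M.ρ m g) n
  map_one' := LinearMap.ext fun z => funext fun x => LinearMap.congr_fun (map_one (M.ρ x.1.2)) (z x)
  map_mul' g h := LinearMap.ext fun z => funext fun x =>
    LinearMap.congr_fun (map_mul (M.ρ x.1.2) g h) (z x)

/-- The complex `CC F M` with the action of `G`. -/
def equivariantCC (F : Flavour) (M : CyclicRep.{u, v, w} k G) : EquivariantComplex.{u, v, w} k G where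
  C := CC F M.toCyclicModule
  ρ n := chainsRep F M n
  comm n n' g := by
    by_cases h : n' + 1 = n
    · rw [show (CC F M.toCyclicModule).d n n' = ModuleCat.ofHom (chainsD F _ n n' h) from dif_pos h]
      exact chainsMap_comm F (M.actHom g) n n' h
    · rw [show (CC F M.toCyclicModule).d n n' = 0 from dif_neg h]
      exact LinearMap.ext fun z => (chainsRep F M n' g).map_zero

/-- A `G`-equivariant morphism of cyclic modules. -/
structure CyclicRepHom (M : CyclicRep.{u, v, w} k G) (N : CyclicRep.{u, v', w} k G) extends
    CyclicHom M.toCyclicModule N.toCyclicModule where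
  comm_ρ : ∀ n g, N.ρ n g ∘ₗ f n = f n ∘ₗ M.ρ n g

/-- The morphism `M ⊗_{kG} W → M' ⊗_{kG} W'` induced by equivariant maps `M → M'`, `W → W'`. -/
def balancedHom {M : CyclicRep.{u, v, w} k G} {M' : CyclicRep.{u, v', w} k G}
    (φ : CyclicRepHom M M') {W W' : Type*} [AddCommGroup W] [Module k W] [AddCommGroup W']
    [Module k W'] (σ : Representation k G W) (σ' : Representation k G W') (f : W →ₗ[k] W')
    (hf : ∀ g, σ' g ∘ₗ f = f ∘ₗ σ g) : CyclicHom (M.balanced σ) (M'.balanced σ') where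
  f n := balancedMap (M.ρ n) σ (M'.ρ n) σ' (φ.f n) f (φ.comm_ρ n) hf
  comm_d n i := Submodule.linearMap_qext _ (TensorProduct.ext' fun x y =>
    congrArg (balancedRel (M'.ρ n) σ').mkQ
      (congrArg (· ⊗ₜ[k] f y) (LinearMap.congr_fun (φ.comm_d n i) x)))
  comm_s n i := Submodule.linearMap_qext _ (TensorProduct.ext' fun x y =>
    congrArg (balancedRel (M'.ρ (n + 1)) σ').mkQ
      (congrArg (· ⊗ₜ[k] f y) (LinearMap.congr_fun (φ.comm_s n i) x)))
  comm_t n := Submodule.linearMap_qext _ (TensorProduct.ext' fun x y =>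
    congrArg (balancedRel (M'.ρ n) σ').mkQ
      (congrArg (· ⊗ₜ[k] f y) (LinearMap.congr_fun (φ.comm_t n) x)))

/-- The identity of `M`. -/
def CyclicRepHom.id (M : CyclicRep.{u, v, w} k G) : CyclicRepHom M M where
  f _ := LinearMap.id
  comm_d _ _ := rfl
  comm_s _ _ := rfl
  comm_t _ := rfl
  comm_ρ _ _ := rfl

/-- The map `id ⊗ b : M ⊗_{kG} C_{q+1}^{Hoch}(G) → M ⊗_{kG} C_q^{Hoch}(G)`. -/
def balancedB (M : CyclicRep.{u, v, w} k G) (q : ℕ) :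
    CyclicHom (M.balanced (tupleRep k G (q + 1))) (M.balanced (tupleRep k G q)) :=
  balancedHom (.id M) _ _ ((groupRep k G).b q) (tupleRep_b q)

/-- The double complex whose entry at `(p, q)` is the `u`-adically completed tensor product
`CC F M_p ⊗_{kG} C_q^{Hoch}(G)`: its elements are the formal sums `∑_j x_j u^j` with coefficients
`x_j` in `M([p + 2j]) ⊗_{kG} C_q^{Hoch}(G)`. In other words, its `q`-th row is the complex `CC F` of
the cyclic module `M ⊗_{kG} C_q^{Hoch}(G)`. -/
def completedDouble (F : Flavour) (M : CyclicRep.{u, v, w} k G) :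
    DoubleComplex.{u, max u v w} k where
  X p q := Chains F (M.balanced (tupleRep k G q)) p
  del p q := chainsD F _ (p + 1) p rfl
  delta p q := chainsMap F (balancedB M q).f p
  del_del p q := chainsD_chainsD F _ _ _ _ _ _
  delta_delta p q := LinearMap.ext fun z => funext fun x => by
    have h : (balancedB M q).f x.1.2 ∘ₗ (balancedB M (q + 1)).f x.1.2 = 0 :=
      balanced_zero (k := k) (G := G) fun y y' => (groupDoubleAux (M.ρ x.1.2) q y y')
    exact LinearMap.congr_fun h (z x)
  del_delta p q := (chainsMap_comm F (balancedB M q) _ _ _).symm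

/-- The group homology complex with values in `CC F M`, with `u`-adically completed tensor
products. -/
def completedGroupChains (F : Flavour) (M : CyclicRep.{u, v, w} k G) :
    ChainComplex (ModuleCat.{max u v w} k) ℤ :=
  (completedDouble F M).tot

/-- The morphism of double complexes induced by an equivariant map of cyclic modules. -/
def completedDoubleHom (F : Flavour) {M : CyclicRep.{u, v, w} k G} {N : CyclicRep.{u, v', w} k G}
    (φ : CyclicRepHom M N) : DoubleComplex.Hom (completedDouble F M) (completedDouble F N) where
  f := fun p q => chainsMap F (balancedHom φ (tupleRep k G q) (tupleRep k G q) LinearMap.id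
      fun _ => rfl).f p
  comm_del := fun p q => chainsMap_comm F _ _ _ rfl
  comm_delta := fun p q => LinearMap.ext fun z => funext fun x => by
        have h : (balancedHom φ (tupleRep k G q) (tupleRep k G q) LinearMap.id
              fun _ => rfl).f x.1.2 ∘ₗ (balancedB M q).f x.1.2 =
            (balancedB N q).f x.1.2 ∘ₗ (balancedHom φ (tupleRep k G (q + 1)) (tupleRep k G (q + 1))
              LinearMap.id fun _ => rfl).f x.1.2 :=
          Submodule.linearMap_qext _ (TensorProduct.ext' fun y y' => rfl)
        exact LinearMap.congr_fun h (z x)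

/-- For fixed `y`, the map `x ↦ x ⊗ y` from `M` to `M ⊗_{kG} W`. -/
def tmulHom (M : CyclicRep.{u, v, w} k G) {W : Type*} [AddCommGroup W] [Module k W]
    (σ : Representation k G W) (y : W) : CyclicHom M.toCyclicModule (M.balanced σ) where
  f n := (balancedRel (M.ρ n) σ).mkQ ∘ₗ (TensorProduct.mk k (M.X n) W).flip y
  comm_d _ _ := rfl
  comm_s _ _ := rfl
  comm_t _ := rfl

/-- The comparison map from the uncompleted tensor product,
`(∑_j x_j u^j) ⊗ y ↦ ∑_j (x_j ⊗ y) u^j`. -/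
def completion (F : Flavour) (M : CyclicRep.{u, v, w} k G) :
    groupChains (equivariantCC F M) ⟶ completedGroupChains F M :=
  DoubleComplex.totMap
    { f := fun p q => LinearMap.pi fun x : UIndex F p =>
        balancedMap (chainsRep F M p) (tupleRep k G q) (M.ρ x.1.2) (tupleRep k G q)
          (LinearMap.proj x) LinearMap.id (fun _ => rfl) (fun _ => rfl)
      comm_del := fun p q => Submodule.linearMap_qext _ (TensorProduct.ext' fun z y => by
        have hd : (CC F M.toCyclicModule).d (p + 1) p =
            ModuleCat.ofHom (chainsD F M.toCyclicModule (p + 1) p rfl) := dif_pos rfl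
        have key := LinearMap.congr_fun
          (chainsMap_comm F (tmulHom M (tupleRep k G q) y) (p + 1) p rfl) z
        change chainsMap F (tmulHom M (tupleRep k G q) y).f p
          (((CC F M.toCyclicModule).d (p + 1) p).hom z) =
          chainsD F _ (p + 1) p rfl (chainsMap F (tmulHom M (tupleRep k G q) y).f (p + 1) z)
        rw [hd]
        exact key)
      comm_delta := fun p q => Submodule.linearMap_qext _ (TensorProduct.ext' fun y y' => rfl) }

end GroupHomology


/-! ## The maps -/

section Maps

variable (k : Type u) [CommRing k] (A : Type v) [Ring A] [Algebra k A] (G : Type w) [Group G]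
  [MulSemiringAction G A] [SMulCommClass G k A]

/-- The element `(a_0 ⊗ … ⊗ a_n) ♮ (g_0 ⊗ … ⊗ g_n)` of `A ♮ G`. -/
def algGroupTensor {n : ℕ} (a : Fin (n + 1) → A) (g : Fin (n + 1) → G) : (algGroup k A G).X n :=
  PiTensorProduct.tprod k a ⊗ₜ[k] Finsupp.single g (1 : k)

/-- `x ⊗ y ↦ (sum of the coefficients of y) x`. -/
def forgetTuple (V : Type*) [AddCommGroup V] [Module k V] (I : Type*) :
    V ⊗[k] (I →₀ k) →ₗ[k] V :=
  (TensorProduct.rid k V).toLinearMap ∘ₗ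
    TensorProduct.map LinearMap.id (Finsupp.linearCombination k fun _ : I => (1 : k))

theorem forgetTuple_comm {V V' I I' : Type*} [AddCommGroup V] [Module k V] [AddCommGroup V']
    [Module k V'] (f : V →ₗ[k] V') (h : I → I') :
    forgetTuple k V' I' ∘ₗ TensorProduct.map f (Finsupp.lmapDomain k k h) =
      f ∘ₗ forgetTuple k V I :=
  TensorProduct.ext' fun x y => by
    simp [forgetTuple, Finsupp.linearCombination_mapDomain, Function.comp_def]

/-- The map `A ♮ G → A^♮`, `(a_0 ⊗ … ⊗ a_n) ♮ (g_0 ⊗ … ⊗ g_n) ↦ a_0 ⊗ … ⊗ a_n`. -/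
def forgetGroup : CyclicRepHom (algGroup k A G) (algRep k A G) where
  f n := forgetTuple k (⨂[k] _ : Fin (n + 1), A) (Fin (n + 1) → G)
  comm_d n i := forgetTuple_comm k ((algCyclic k A).d n i) _
  comm_s n i := forgetTuple_comm k ((algCyclic k A).s n i) _
  comm_t n := forgetTuple_comm k ((algCyclic k A).t n) _
  comm_ρ n g := (forgetTuple_comm k (algAct k A G n g) _).symm

/-- The map of group homology complexes induced by `A ♮ G → A^♮`. -/
def completedForget (F : Flavour) :
    completedGroupChains F (algGroup k A G) ⟶ completedGroupChains F (algRep k A G) :=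
  DoubleComplex.totMap (completedDoubleHom F (forgetGroup k A G))

variable {k A G}

/-- `(g ⊗ h) ↦ g ⊗ (g_ℓ, h_0, …, h_q)`. -/
def prependAux {m : ℕ} (ℓ : Fin (m + 1)) (q : ℕ) :
    ((Fin (m + 1) → G) →₀ k) ⊗[k] ((Fin (q + 1) → G) →₀ k) →ₗ[k]
      ((Fin (m + 1) → G) →₀ k) ⊗[k] ((Fin (q + 2) → G) →₀ k) :=
  TensorProduct.lift (Finsupp.linearCombination k fun g : Fin (m + 1) → G =>
    TensorProduct.mk k _ _ (Finsupp.single g (1 : k)) ∘ₗ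
      Finsupp.lmapDomain k k fun h : Fin (q + 1) → G => (Fin.cons (g ℓ) h : Fin (q + 2) → G))

/-- `x ⊗ g ⊗ h ↦ x ⊗ g ⊗ (g_ℓ, h_0, …, h_q)`. -/
def prepend (V : Type*) [AddCommGroup V] [Module k V] {m : ℕ} (ℓ : Fin (m + 1)) (q : ℕ) :
    (V ⊗[k] ((Fin (m + 1) → G) →₀ k)) ⊗[k] ((Fin (q + 1) → G) →₀ k) →ₗ[k]
      (V ⊗[k] ((Fin (m + 1) → G) →₀ k)) ⊗[k] ((Fin (q + 2) → G) →₀ k) :=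
  (TensorProduct.assoc k _ _ _).symm.toLinearMap ∘ₗ
    TensorProduct.map LinearMap.id (prependAux ℓ q) ∘ₗ (TensorProduct.assoc k _ _ _).toLinearMap

theorem prepend_tmul {V : Type*} [AddCommGroup V] [Module k V] {m : ℕ} (ℓ : Fin (m + 1)) (q : ℕ)
    (x : V) (g : Fin (m + 1) → G) (h : Fin (q + 1) → G) :
    prepend (k := k) V ℓ q ((x ⊗ₜ Finsupp.single g 1) ⊗ₜ Finsupp.single h 1) =
      (x ⊗ₜ Finsupp.single g 1) ⊗ₜ Finsupp.single (Fin.cons (g ℓ) h : Fin (q + 2) → G) 1 := by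
  simp [prepend, prependAux]

theorem prepend_le {V : Type*} [AddCommGroup V] [Module k V] (ρ : Representation k G V) {m : ℕ}
    (ℓ : Fin (m + 1)) (q : ℕ) : balancedRel (ρ.tprod (tupleRep k G m)) (tupleRep k G q) ≤
      (balancedRel (ρ.tprod (tupleRep k G m)) (tupleRep k G (q + 1))).comap (prepend V ℓ q) := by
  rw [balancedRel, Submodule.span_le]
  rintro _ ⟨γ, z, y, rfl⟩
  rw [SetLike.mem_coe, Submodule.mem_comap]
  rw [← Submodule.Quotient.mk_eq_zero, map_sub, Submodule.Quotient.mk_sub, sub_eq_zero]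
  let N := balancedRel (ρ.tprod (tupleRep k G m)) (tupleRep k G (q + 1))
  have key : N.mkQ ∘ₗ prepend V ℓ q ∘ₗ
      TensorProduct.map (ρ.tprod (tupleRep k G m) γ⁻¹) LinearMap.id =
      N.mkQ ∘ₗ prepend V ℓ q ∘ₗ TensorProduct.map LinearMap.id (tupleRep k G q γ) := by
    ext x g h
    simp only [LinearMap.comp_apply, TensorProduct.AlgebraTensorModule.curry_apply,
      TensorProduct.curry_apply, LinearMap.coe_restrictScalars, Finsupp.lsingle_apply,
      TensorProduct.map_tmul, LinearMap.id_apply, Representation.tprod_apply, tupleRep,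
      MonoidHom.coe_mk, OneHom.coe_mk, Finsupp.lmapDomain_apply, Finsupp.mapDomain_single]
    rw [prepend_tmul, prepend_tmul]
    refine (Submodule.Quotient.eq N).mpr (Submodule.subset_span
      ⟨γ, x ⊗ₜ Finsupp.single g 1, Finsupp.single (Fin.cons (γ⁻¹ * g ℓ) h) 1, ?_⟩)
    have hc : (fun j => γ * (Fin.cons (γ⁻¹ * g ℓ) h : Fin (q + 2) → G) j) =
        (Fin.cons (g ℓ) fun j => γ * h j : Fin (q + 2) → G) := by
      funext j
      refine Fin.cases ?_ (fun j => ?_) j <;> simp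
    simp [tupleRep, hc]
  exact LinearMap.congr_fun key (z ⊗ₜ y)

/-- The contracting homotopy on `(A ♮ G)([m]) ⊗_{kG} C_q^{Hoch}(G)` obtained by splitting off the
`ℓ`-th tensor factor of `(kG)^{⊗ (m+1)}` as the free generator:
`(x ♮ (g_0 ⊗ … ⊗ g_m)) ⊗ (h_0 ⊗ … ⊗ h_q) ↦ (x ♮ (g_0 ⊗ … ⊗ g_m)) ⊗ (g_ℓ ⊗ h_0 ⊗ … ⊗ h_q)`. -/
def homotopy {m : ℕ} (ℓ : Fin (m + 1)) (q : ℕ) :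
    ((algGroup k A G).balanced (tupleRep k G q)).X m →ₗ[k]
      ((algGroup k A G).balanced (tupleRep k G (q + 1))).X m :=
  Submodule.mapQ _ _ (prepend (⨂[k] _ : Fin (m + 1), A) ℓ q) (prepend_le (algAct k A G m) ℓ q)

end Maps

section Perturbation

variable {k : Type u} [CommRing k] (D : DoubleComplex.{u, v} k)

/-- All families with entries in `X p q`, for all `p` and `q`. -/
abbrev DoubleComplex.All : Type v := ∀ (p : ℤ) (q : ℕ), D.X p q

/-- The differential `∂ ⊗ id`. -/
def DoubleComplex.opDel : Module.End k D.All :=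
  LinearMap.pi fun p => LinearMap.pi fun q =>
    D.del p q ∘ₗ LinearMap.proj q ∘ₗ LinearMap.proj (p + 1)

/-- The differential `δ_G = id ⊗ b`, with the Koszul sign `(-1)^p`. -/
def DoubleComplex.opDelta : Module.End k D.All :=
  LinearMap.pi fun p => LinearMap.pi fun q =>
    DoubleComplex.sign p • (D.delta p q ∘ₗ LinearMap.proj (q + 1) ∘ₗ LinearMap.proj p)

/-- The operator of bidegree `(0, 1)` given by `h`, with the Koszul sign `(-1)^p`. -/
def DoubleComplex.opH (h : ∀ p q, D.X p q →ₗ[k] D.X p (q + 1)) : Module.End k D.All :=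
  LinearMap.pi fun p => LinearMap.pi fun q => match q with
    | 0 => 0
    | q + 1 => DoubleComplex.sign p • (h p q ∘ₗ LinearMap.proj q ∘ₗ LinearMap.proj p)

/-- The element
`f - δ_G H f + ∑_{q ≥ 1} ((-H∂)^q f - ∂ (-H∂)^{q-1} H f - δ_G (-H∂)^q H f)`
of the total complex, for `f` in `X n 0`. The term with index `q` is the component in
`X (n-q) q`. -/
def DoubleComplex.perturb (h : ∀ p q, D.X p q →ₗ[k] D.X p (q + 1)) (n : ℤ) (f : D.X n 0) :
    D.totX n := fun x =>
  let F : D.All := Pi.single n (Pi.single 0 f)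
  let H := D.opH h
  let T := -(H * D.opDel)
  match x with
  | ⟨(p, 0), _⟩ => (F - D.opDelta (H F)) p 0
  | ⟨(p, q + 1), _⟩ =>
    ((T ^ (q + 1)) F - D.opDel ((T ^ q) (H F)) - D.opDelta ((T ^ (q + 1)) (H F))) p (q + 1)

end Perturbation

section Maps

variable {k : Type u} [CommRing k] {A : Type v} [Ring A] [Algebra k A] {G : Type w} [Group G]
  [MulSemiringAction G A] [SMulCommClass G k A]

/-- The map `x ↦ x ⊗ e` from `CC F (A ♮ G)_n` to `CC F (A ♮ G)_n ⊗_{kG} C_0^{Hoch}(G)`. -/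
def tensorOne (F : Flavour) (n : ℤ) (z : Chains F (algGroup k A G).toCyclicModule n) :
    (completedDouble F (algGroup k A G)).X n 0 :=
  chainsMap F (tmulHom (algGroup k A G) (tupleRep k G 0) (Finsupp.single (fun _ => 1) 1)).f n z

/-- The value on the class of `f ∈ CC F (A ♮ G)_n` of the map
`Q : CC F (A ♮ G)_G → C_•(G; CC F (A ♮ G))`, computed with the homotopies that split off the
tensor factors `ℓ`. -/
def Qlift (F : Flavour) (ℓ : ∀ m : ℕ, Fin (m + 1)) (n : ℤ)
    (f : Chains F (algGroup k A G).toCyclicModule n) :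
    (completedDouble F (algGroup k A G)).totX n :=
  (completedDouble F (algGroup k A G)).perturb
    (fun p q => chainsMap F (fun m => homotopy (ℓ m) q) p) n (tensorOne F n f)

end Maps

end CrossedCyclic

end

/-!
Write `D` for the double complex with entries `CC F (A ♮ G)_p ⊗_{kG} C_q(G)`, differentials `∂` and
`δ`, and product totalisation `Ĉ(G; CC F (A ♮ G))`.

*The isomorphism `θ`.* Its inverse sends the class of `(a_0 ⊗ … ⊗ a_n) ♮ (h_0 ⊗ … ⊗ h_n)` to
`⨂_j h_{j-1}⁻¹(a_j) h_{j-1}⁻¹h_j`, with indices modulo `n + 1`. In this direction no iterated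
products occur, compatibility with the rotations is immediate, and compatibility with the zeroth
face and degeneracy implies the rest (`CyclicHom.ofZero`). It is injective because `A ⋊ G` is a
direct sum of copies of `A` (`ofCrossed_toCrossed`), and every generator of the homogeneous summand
is the image of the element that the formula for `θ` prescribes (`toHomogeneous_tensor`).

*The morphism `Q`.* The columns of `D`, augmented by the map to `CC F (A ♮ G)_G`, are contracted by
the operator `H` prepending the entry `g_ℓ`: with `E` the projector onto row `0` given by the
augmentation and its section `[x ♮ g] ↦ (x ♮ g) ⊗ g_ℓ`, one has `δH + Hδ = 1 - E` (with Koszul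
signs). For `T = -H∂` this gives `δT = -∂ + E∂ + Tδ`, and the formula for `Q([f])` collapses to
`∑_q T^q E f`. Thus it depends only on the class of `f`, and it commutes with the differentials
(`ColumnContraction.series_aug`, `ColumnContraction.totD_series`). It is a section of the
augmentation of the totalisation. The latter is a quasi-isomorphism since `H` solves `d w = z` in
its kernel up to terms in higher rows, and the filtration by rows is complete
(`ColumnContraction.quasiIso_augHom`); hence so is `Q`.

*Forgetting `G`.* For fixed `q` the map `(A ♮ G) ⊗_{kG} C_q(G) → A^♮ ⊗_{kG} C_q(G)` has the section
`x ⊗ h ↦ (x ♮ (h_0, …, h_0)) ⊗ h`, and the simplicial homotopy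
`(x ♮ g) ⊗ h ↦ (s_j x ♮ (g_0, …, g_j, h_0, …, h_0)) ⊗ h` contracts the Hochschild complex of its
kernel. This homotopy commutes with neither `B` nor `δ`. But `uB` raises the degree in the cyclic
module and `δ` preserves it, whereas `b` lowers it by one. So the homotopy again solves
`d w = z` in the kernel up to terms of higher degree, and the filtration by this degree is
complete for every flavour (`quasiIso_rowDoubleHom`).

*The completion.* As `C_q(G)` is free on the tuples `(e, t_1, …, t_q)`, the comparison map is,
entry by entry, the map from a direct sum over `G^q` of products over the powers of `u` to
the corresponding product of direct sums. It is bijective if one of the two index sets is finite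
(`bijective_pi_mapRange`), and for the Hochschild and cyclic flavours only finitely many powers of
`u` occur in each degree.
-/

section

open CategoryTheory TensorProduct

noncomputable section

namespace CrossedCyclic

universe u v v' w

/-! ### Quasi-isomorphisms from complete filtrations -/

section QuasiIsoCriterion

variable {k : Type u} [CommRing k]

/-- The kernel of a morphism of complexes of modules, as a complex of submodules. -/
def kernelComplex {C D : ChainComplex (ModuleCat.{v} k) ℤ} (f : C ⟶ D) :
    ChainComplex (ModuleCat.{v} k) ℤ where
  X n := ModuleCat.of k (LinearMap.ker (f.f n).hom)
  d n n' := ModuleCat.ofHom ((C.d n n').hom.restrict fun z hz => by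
    have h := LinearMap.congr_fun (congrArg ModuleCat.Hom.hom (f.comm n n')) z
    rw [LinearMap.mem_ker] at hz ⊢
    exact h.symm.trans ((congrArg (D.d n n').hom hz).trans (map_zero _)))
  shape n n' h := by
    ext z
    have := C.shape n n' h
    simp [LinearMap.restrict_apply, this]
  d_comp_d' n n' n'' _ _ := by
    ext z
    exact LinearMap.congr_fun (congrArg ModuleCat.Hom.hom (C.d_comp_d n n' n'')) z.1

/-- The inclusion of the kernel complex. -/
def kernelInclusion {C D : ChainComplex (ModuleCat.{v} k) ℤ} (f : C ⟶ D) :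
    kernelComplex f ⟶ C where
  f _ := ModuleCat.ofHom (Submodule.subtype _)
  comm' _ _ _ := rfl

theorem quasiIso_of_surjective_of_acyclic_kernel {C D : ChainComplex (ModuleCat.{v} k) ℤ}
    (f : C ⟶ D) (hs : ∀ n, Function.Surjective (f.f n).hom)
    (hk : ∀ n (z : C.X n), (f.f n).hom z = 0 → (∀ n', n' + 1 = n → (C.d n n').hom z = 0) →
      ∃ w : C.X (n + 1), (f.f (n + 1)).hom w = 0 ∧ (C.d (n + 1) n).hom w = z) : QuasiIso f := by
  let S : ShortComplex (ChainComplex (ModuleCat.{v} k) ℤ) :=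
    ShortComplex.mk (kernelInclusion f) f (by
      ext n z
      exact z.2)
  have hS : S.ShortExact := HomologicalComplex.shortExact_of_degreewise_shortExact S fun n =>
    LinearMap.shortExact_shortComplexKer (hs n)
  have hz : ∀ n, Limits.IsZero (S.X₁.homology n) := fun n => by
    rw [← HomologicalComplex.exactAt_iff_isZero_homology,
      HomologicalComplex.exactAt_iff' _ (n + 1) n (n - 1) (by simp) (by simp),
      ShortComplex.moduleCat_exact_iff]
    intro z hz
    obtain ⟨w, hw, hw'⟩ := hk n z.1 z.2 fun n' hn => by
      obtain rfl : n' = n - 1 := by omega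
      exact congrArg Subtype.val hz
    exact ⟨⟨w, hw⟩, Subtype.ext hw'⟩
  rw [quasiIso_iff]
  intro n
  rw [quasiIsoAt_iff_isIso_homologyMap]
  have hm : Mono (HomologicalComplex.homologyMap S.g n) :=
    (hS.homology_exact₂ n).mono_g ((hz n).eq_of_src _ _)
  have he : Epi (HomologicalComplex.homologyMap S.g n) :=
    (hS.homology_exact₃ n (n - 1) (by simp)).epi_f ((hz (n - 1)).eq_of_tgt _ _)
  exact isIso_of_mono_of_epi (HomologicalComplex.homologyMap S.g n)

/-- Successive approximation in a complete filtered module: if each `z ∈ S` of filtration `i` is a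
boundary `d w` up to an element of `S` of filtration `i + 1`, with `w ∈ S'` of filtration `i`, then
each `z ∈ S` of filtration `0` is the boundary of an element of `S'`. -/
theorem exists_preimage_of_complete_filtration {V W : Type*} [AddCommGroup V] [AddCommGroup W]
    [Module k V] [Module k W] (d : W →ₗ[k] V) (FV : ℕ → Submodule k V) (FW : ℕ → Submodule k W)
    (S : Submodule k V) (S' : Submodule k W)
    (hcomplete : ∀ w : ℕ → W, (∀ i, w i ∈ FW i ⊓ S') →
      ∃ x ∈ S', ∀ N, x - ∑ i ∈ Finset.range N, w i ∈ FW N)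
    (hsep : ∀ v : V, (∀ i, v ∈ FV i) → v = 0)
    (hanti : ∀ i, FV (i + 1) ≤ FV i)
    (hd : ∀ i, ∀ w ∈ FW (i + 1), d w ∈ FV i)
    (happrox : ∀ i, ∀ z ∈ FV i ⊓ S, ∃ w ∈ FW i ⊓ S', z - d w ∈ FV (i + 1) ⊓ S)
    (z : V) (hz : z ∈ FV 0 ⊓ S) : ∃ w ∈ S', d w = z := by
  choose! φ hφ hφ' using happrox
  let r : ℕ → V := fun i => Nat.rec z (fun i x => x - d (φ i x)) i
  have hr : ∀ i, r i ∈ FV i ⊓ S := fun i => by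
    induction i with
    | zero => exact hz
    | succ i ih => exact hφ' i _ ih
  obtain ⟨x, hx, hlim⟩ := hcomplete (fun i => φ i (r i)) fun i => hφ i _ (hr i)
  have hsum : ∀ N, d (∑ i ∈ Finset.range N, φ i (r i)) = z - r N := fun N => by
    induction N with
    | zero => simp [r]
    | succ N ih =>
      rw [Finset.sum_range_succ, map_add, ih]
      change _ = z - (r N - d (φ N (r N)))
      abel
  refine ⟨x, hx, sub_eq_zero.mp (hsep _ fun i => ?_)⟩
  have h1 := hd i _ (hlim (i + 1))
  rw [map_sub, hsum] at h1
  have h2 := (FV i).sub_mem h1 (hanti i (hr (i + 1)).1)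
  convert h2 using 1
  abel

end QuasiIsoCriterion

/-! ### The perturbation lemma for columns with a contraction -/

section Perturbation

variable {k : Type u} [CommRing k]

theorem sum_range_eq_sum_range_of_lt {M : Type*} [AddCommMonoid M] {a : ℕ → M} {m N : ℕ}
    (ha : ∀ i, m < i → a i = 0) (h : m < N) :
    ∑ i ∈ Finset.range (m + 1), a i = ∑ i ∈ Finset.range N, a i :=
  Finset.sum_subset (Finset.range_subset_range.mpr h) fun i _ hi =>
    ha i (by simpa using hi)

theorem DoubleComplex.sign_mul_self (p : ℤ) : DoubleComplex.sign p * DoubleComplex.sign p = 1 := by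
  simp only [DoubleComplex.sign, ← Units.val_mul, ← Int.negOnePow_add, ← two_mul]
  simp

theorem DoubleComplex.sign_add_one (p : ℤ) :
    DoubleComplex.sign (p + 1) = -DoubleComplex.sign p := by
  simp [DoubleComplex.sign, Int.negOnePow_succ]

/-- An augmentation `X p 0 → C p` of the columns of a double complex over a complex `C`, together
with a contraction `(h, sec)` of each augmented column. The contraction is not assumed to be
compatible with the differential `∂`. -/
structure ColumnContraction (D : DoubleComplex.{u, v} k)
    (C : ChainComplex (ModuleCat.{v} k) ℤ) where
  h : ∀ p q, D.X p q →ₗ[k] D.X p (q + 1)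
  aug : ∀ p, D.X p 0 →ₗ[k] C.X p
  sec : ∀ p, C.X p →ₗ[k] D.X p 0
  aug_sec : ∀ p x, aug p (sec p x) = x
  aug_delta : ∀ p x, aug p (D.delta p 0 x) = 0
  aug_del : ∀ p x, aug p (D.del p 0 x) = (C.d (p + 1) p).hom (aug (p + 1) x)
  delta_h_zero : ∀ p x, D.delta p 0 (h p 0 x) = x - sec p (aug p x)
  delta_h : ∀ p q x, D.delta p (q + 1) (h p (q + 1) x) + h p q (D.delta p q x) = x

namespace ColumnContraction

variable {D : DoubleComplex.{u, v} k} {C : ChainComplex (ModuleCat.{v} k) ℤ}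
  (K : ColumnContraction D C)

/-- The projector `sec ∘ aug` on row `0`, extended by `0`. -/
def opE : Module.End k D.All :=
  LinearMap.pi fun p => LinearMap.pi fun q => match q with
    | 0 => K.sec p ∘ₗ K.aug p ∘ₗ LinearMap.proj 0 ∘ₗ LinearMap.proj p
    | _ + 1 => 0

theorem opDel_apply (z : D.All) (p : ℤ) (q : ℕ) : D.opDel z p q = D.del p q (z (p + 1) q) := rfl

theorem opDelta_apply (z : D.All) (p : ℤ) (q : ℕ) :
    D.opDelta z p q = DoubleComplex.sign p • D.delta p q (z p (q + 1)) := rfl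

theorem opH_zero (z : D.All) (p : ℤ) : D.opH K.h z p 0 = 0 := rfl

theorem opH_succ (z : D.All) (p : ℤ) (q : ℕ) :
    D.opH K.h z p (q + 1) = DoubleComplex.sign p • K.h p q (z p q) := rfl

theorem opE_zero (z : D.All) (p : ℤ) : K.opE z p 0 = K.sec p (K.aug p (z p 0)) := rfl

theorem opE_succ (z : D.All) (p : ℤ) (q : ℕ) : K.opE z p (q + 1) = 0 := rfl

theorem opDel_opDel (z : D.All) : D.opDel (D.opDel z) = 0 :=
  funext fun p => funext fun q => LinearMap.congr_fun (D.del_del p q) _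

theorem opDelta_opDel (z : D.All) : D.opDelta (D.opDel z) = -D.opDel (D.opDelta z) :=
  funext fun p => funext fun q => by
    have h := LinearMap.congr_fun (D.del_delta p q) (z (p + 1) (q + 1))
    simp only [LinearMap.comp_apply] at h
    change _ = -(D.opDel (D.opDelta z) p q)
    rw [opDelta_apply, opDel_apply, opDel_apply, opDelta_apply, map_zsmul, h,
      DoubleComplex.sign_add_one, neg_smul, neg_neg]

theorem opDelta_opH (z : D.All) :
    D.opDelta (D.opH K.h z) = z - K.opE z - D.opH K.h (D.opDelta z) :=
  funext fun p => funext fun q => by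
    change _ = z p q - K.opE z p q - D.opH K.h (D.opDelta z) p q
    rw [opDelta_apply, opH_succ, map_zsmul, smul_smul, DoubleComplex.sign_mul_self, one_smul]
    cases q with
    | zero => rw [opE_zero, opH_zero, K.delta_h_zero, sub_zero]
    | succ q =>
      rw [opE_succ, opH_succ, opDelta_apply, map_zsmul, smul_smul, DoubleComplex.sign_mul_self,
        one_smul, sub_zero, eq_sub_iff_add_eq, K.delta_h]

theorem opE_opDel_opH (z : D.All) : K.opE (D.opDel (D.opH K.h z)) = 0 :=
  funext fun p => funext fun q => by
    cases q with
    | zero =>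
      rw [opE_zero, opDel_apply, opH_zero, map_zero, map_zero, map_zero]
      rfl
    | succ q => rfl

/-- The perturbation operator `-H∂`. -/
def opT : Module.End k D.All := -(D.opH K.h * D.opDel)

theorem opT_apply (z : D.All) : K.opT z = -D.opH K.h (D.opDel z) := rfl

theorem opT_pow_succ (q : ℕ) (z : D.All) : (K.opT ^ (q + 1)) z = K.opT ((K.opT ^ q) z) := by
  rw [pow_succ']
  rfl

theorem opT_opDel (z : D.All) : K.opT (D.opDel z) = 0 := by
  rw [opT_apply, opDel_opDel, map_zero, neg_zero]

/-- The commutation rule `δT = -∂ + E∂ + Tδ`. -/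
theorem opDelta_opT (z : D.All) :
    D.opDelta (K.opT z) = -D.opDel z + K.opE (D.opDel z) + K.opT (D.opDelta z) := by
  rw [opT_apply, opT_apply, map_neg, opDelta_opH, opDelta_opDel, map_neg]
  abel

theorem opE_opDel_opT (z : D.All) : K.opE (D.opDel (K.opT z)) = 0 := by
  rw [opT_apply, map_neg, map_neg, opE_opDel_opH, neg_zero]

theorem opE_opDel_opT_pow_opH (q : ℕ) (z : D.All) :
    K.opE (D.opDel ((K.opT ^ q) (D.opH K.h z))) = 0 := by
  cases q with
  | zero => exact K.opE_opDel_opH z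
  | succ q =>
    rw [opT_pow_succ]
    exact K.opE_opDel_opT _

/-- The expression in parentheses for `q + 1` is `T` of the one for `q`, up to a term in the image
of `∂`, which the next `T` kills because `T∂ = 0`. -/
theorem opT_perturb_term (f : D.All) (hf : D.opDelta f = 0) (q : ℕ) :
    K.opT ((K.opT ^ q) f - D.opDelta ((K.opT ^ q) (D.opH K.h f))) =
      (K.opT ^ (q + 1)) (K.opE f) := by
  induction q with
  | zero =>
    rw [pow_zero, Module.End.one_apply, Module.End.one_apply, opDelta_opH, hf, map_zero, sub_zero,
      sub_sub_cancel]
    rfl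
  | succ q ih =>
    have h : (K.opT ^ (q + 1)) f - D.opDelta ((K.opT ^ (q + 1)) (D.opH K.h f)) =
        K.opT ((K.opT ^ q) f - D.opDelta ((K.opT ^ q) (D.opH K.h f))) +
          D.opDel ((K.opT ^ q) (D.opH K.h f)) := by
      rw [opT_pow_succ, opT_pow_succ, opDelta_opT, opE_opDel_opT_pow_opH, map_sub]
      abel
    rw [h, map_add, opT_opDel, add_zero, ih, ← opT_pow_succ]

/-- The term with index `q + 1` of the perturbation series of `f` in row `0` is
`(-H∂)^(q+1)` of the normalisation `E f` of `f`. -/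
theorem perturb_term (f : D.All) (hf : D.opDelta f = 0) (q : ℕ) :
    (K.opT ^ (q + 1)) f - D.opDel ((K.opT ^ q) (D.opH K.h f)) -
      D.opDelta ((K.opT ^ (q + 1)) (D.opH K.h f)) = (K.opT ^ (q + 1)) (K.opE f) := by
  rw [← K.opT_perturb_term f hf q, opT_pow_succ, opT_pow_succ, opDelta_opT, opE_opDel_opT_pow_opH,
    map_sub]
  abel

/-- The total differential of the series `∑ (-H∂)^q S`, in row `q`. -/
theorem opDel_add_opDelta_opT (S : D.All) (hS : D.opDelta S = 0) (q : ℕ) :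
    D.opDel ((K.opT ^ q) S) + D.opDelta ((K.opT ^ (q + 1)) S) =
      (K.opT ^ q) (K.opE (D.opDel S)) := by
  induction q with
  | zero =>
    rw [zero_add, pow_one, opDelta_opT, hS, map_zero]
    simp
  | succ q ih =>
    rw [opT_pow_succ _ (q + 1), opDelta_opT, opT_pow_succ _ q (K.opE _), ← ih, map_add, opT_opDel,
      opT_pow_succ, opE_opDel_opT]
    abel

/-- The family with the single entry `x` in `X n 0`. -/
def row₀ (n : ℤ) (x : D.X n 0) : D.All := Pi.single n (Pi.single 0 x)

theorem row₀_self (n : ℤ) (x : D.X n 0) : row₀ n x n 0 = x := by simp [row₀]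

theorem row₀_ne {n p : ℤ} (h : p ≠ n) (x : D.X n 0) (q : ℕ) : row₀ n x p q = 0 := by
  simp [row₀, Pi.single_eq_of_ne h]

theorem row₀_succ (n p : ℤ) (x : D.X n 0) (q : ℕ) : row₀ n x p (q + 1) = 0 := by
  by_cases h : p = n
  · subst h
    simp [row₀]
  · exact row₀_ne h x _

theorem opDelta_row₀ (n : ℤ) (x : D.X n 0) : D.opDelta (row₀ n x) = 0 :=
  funext fun p => funext fun q => by
    rw [opDelta_apply, row₀_succ, map_zero, smul_zero]
    rfl

theorem opE_row₀ (n : ℤ) (x : D.X n 0) : K.opE (row₀ n x) = row₀ n (K.sec n (K.aug n x)) :=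
  funext fun p => funext fun q => by
    cases q with
    | zero =>
      rw [opE_zero]
      by_cases h : p = n
      · subst h
        rw [row₀_self, row₀_self]
      · rw [row₀_ne h, row₀_ne h, map_zero, map_zero]
    | succ q => rw [opE_succ, row₀_succ]

theorem opE_opDel_row₀ (n : ℤ) (x : C.X (n + 1)) :
    K.opE (D.opDel (row₀ (n + 1) (K.sec (n + 1) x))) = row₀ n (K.sec n ((C.d (n + 1) n).hom x)) :=
  funext fun p => funext fun q => by
    cases q with
    | zero =>
      rw [opE_zero, opDel_apply]
      by_cases h : p = n
      · subst h
        rw [row₀_self, row₀_self, K.aug_del, K.aug_sec]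
      · rw [row₀_ne h, row₀_ne (by omega), map_zero, map_zero, map_zero]
    | succ q => rw [opE_succ, row₀_succ]

theorem row₀_add (n : ℤ) (x y : D.X n 0) : row₀ n (x + y) = row₀ n x + row₀ n y := by
  simp [row₀, Pi.single_add]

theorem row₀_smul (n : ℤ) (c : k) (x : D.X n 0) : row₀ n (c • x) = c • row₀ n x := by
  simp [row₀, Pi.single_smul]

/-- The series `x ↦ ∑ (-H∂)^q (sec x)`; the term with index `q` is the entry in row `q`. -/
def series (n : ℤ) : C.X n →ₗ[k] D.totX n where
  toFun x y := (K.opT ^ y.1.2) (row₀ n (K.sec n x)) y.1.1 y.1.2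
  map_add' x x' := funext fun y => by
    rw [map_add, row₀_add, map_add]
    rfl
  map_smul' c x := funext fun y => by
    rw [map_smul, row₀_smul, map_smul]
    rfl

theorem totD_series (n : ℤ) (x : C.X (n + 1)) :
    D.totD (n + 1) n rfl (K.series (n + 1) x) = K.series n ((C.d (n + 1) n).hom x) :=
  funext fun ⟨(p, q), hpq⟩ => by
    rw [DoubleComplex.totD_apply]
    have h := K.opDel_add_opDelta_opT (row₀ (n + 1) (K.sec (n + 1) x)) (opDelta_row₀ _ _) q
    rw [opE_opDel_row₀] at h
    exact congrFun (congrFun h p) q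

/-- The morphism of complexes `∑ (-H∂)^q ∘ sec` from `C` to the product totalisation. -/
def seriesHom : C ⟶ D.tot where
  f n := ModuleCat.ofHom (K.series n)
  comm' n n' h := by
    have h1 : n' + 1 = n := h
    subst h1
    ext x
    change D.tot.d _ _ (K.series _ x) = _
    rw [show D.tot.d (n' + 1) n' = ModuleCat.ofHom (D.totD (n' + 1) n' rfl) from dif_pos rfl]
    exact K.totD_series n' x

/-- On the class of an element `f` of row `0`, the series is the perturbation formula in `f`. -/
theorem series_aug (n : ℤ) (f : D.X n 0) : K.series n (K.aug n f) = D.perturb K.h n f :=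
  funext fun ⟨(p, q), hpq⟩ => by
    cases q with
    | zero =>
      have h := K.opDelta_opH (row₀ n f)
      rw [opDelta_row₀, map_zero, sub_zero, opE_row₀] at h
      change row₀ n _ p 0 = (row₀ n f - D.opDelta (D.opH K.h (row₀ n f))) p 0
      rw [h, sub_sub_cancel]
    | succ q =>
      have h := K.perturb_term (row₀ n f) (opDelta_row₀ n f) q
      rw [opE_row₀] at h
      exact (congrFun (congrFun h p) (q + 1)).symm

theorem aug_totD (n : ℤ) (z : D.totX (n + 1)) :
    K.aug n (D.totD (n + 1) n rfl z ⟨(n, 0), by simp⟩) =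
      (C.d (n + 1) n).hom (K.aug (n + 1) (z ⟨(n + 1, 0), by simp⟩)) := by
  rw [DoubleComplex.totD_apply, map_add, map_zsmul, K.aug_delta, smul_zero, add_zero, K.aug_del]

/-- The augmentation of the product totalisation. -/
def augHom : D.tot ⟶ C where
  f n := ModuleCat.ofHom (K.aug n ∘ₗ LinearMap.proj (R := k)
    (φ := fun x : {x : ℤ × ℕ // x.1 + (x.2 : ℤ) = n} => D.X x.1.1 x.1.2) ⟨(n, 0), by simp⟩)
  comm' n n' h := by
    have h1 : n' + 1 = n := h
    subst h1
    rw [show D.tot.d (n' + 1) n' = ModuleCat.ofHom (D.totD (n' + 1) n' rfl) from dif_pos rfl]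
    ext z
    exact (K.aug_totD n' z).symm

theorem seriesHom_augHom : K.seriesHom ≫ K.augHom = 𝟙 C := by
  ext n x
  change K.aug n (row₀ n (K.sec n x) n 0) = x
  rw [row₀_self, K.aug_sec]

/-- The elements of the totalisation that vanish in the rows below `i`. -/
def rowFiltration (D : DoubleComplex.{u, v} k) (n : ℤ) (i : ℕ) : Submodule k (D.totX n) where
  carrier := {z | ∀ x, x.1.2 < i → z x = 0}
  add_mem' {a b} ha hb x hx := by
    rw [Pi.add_apply, ha x hx, hb x hx, add_zero]
  zero_mem' _ _ := rfl
  smul_mem' c a ha x hx := by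
    rw [Pi.smul_apply, ha x hx, smul_zero]

/-- The operator `H` on the totalisation, raising the total degree by one. -/
def totH (n : ℤ) : D.totX n →ₗ[k] D.totX (n + 1) :=
  LinearMap.pi fun ⟨(p, q), hpq⟩ => match q, hpq with
    | 0, _ => 0
    | q + 1, hpq => DoubleComplex.sign p • (K.h p q ∘ₗ LinearMap.proj (R := k)
        (φ := fun x : {x : ℤ × ℕ // x.1 + (x.2 : ℤ) = n} => D.X x.1.1 x.1.2)
        ⟨(p, q), by push_cast at hpq ⊢; linarith⟩)

theorem totH_zero (n : ℤ) (z : D.totX n) (p : ℤ) (hp : p + ((0 : ℕ) : ℤ) = n + 1) :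
    K.totH n z ⟨(p, 0), hp⟩ = 0 := rfl

theorem totH_succ (n : ℤ) (z : D.totX n) (p : ℤ) (q : ℕ) (hp : p + ((q + 1 : ℕ) : ℤ) = n + 1) :
    K.totH n z ⟨(p, q + 1), hp⟩ =
      DoubleComplex.sign p • K.h p q (z ⟨(p, q), by push_cast at hp ⊢; linarith⟩) := rfl

/-- A cycle in the kernel of the augmentation that vanishes below row `j` is the boundary of its
image under `H`, up to terms vanishing below row `j + 1`: its entry in row `j` is annihilated by
`δ`, and `∂H` only contributes to row `j + 1`. -/
theorem sub_totD_totH_mem (n i : ℤ) (hi : i + 1 = n) (j : ℕ) (z : D.totX n)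
    (hz : z ∈ rowFiltration D n j) (haug : K.aug n (z ⟨(n, 0), by simp⟩) = 0)
    (hcycle : D.totD n i hi z = 0) :
    z - D.totD (n + 1) n rfl (K.totH n z) ∈ rowFiltration D n (j + 1) := by
  rintro ⟨⟨p, q⟩, hpq⟩ hq
  change z ⟨(p, q), hpq⟩ - D.totD (n + 1) n rfl (K.totH n z) ⟨(p, q), hpq⟩ = 0
  rw [DoubleComplex.totD_apply, totH_succ, map_zsmul, smul_smul, DoubleComplex.sign_mul_self,
    one_smul]
  cases q with
  | zero =>
    obtain rfl : p = n := by simpa using hpq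
    rw [totH_zero, map_zero, zero_add, K.delta_h_zero, haug, map_zero, sub_zero, sub_self]
  | succ q =>
    have hq : q < j := by simpa using hq
    have h1 := congrFun hcycle ⟨(p, q), by push_cast at hpq ⊢; linarith⟩
    rw [DoubleComplex.totD_apply, hz ⟨(p + 1, q), _⟩ hq, map_zero, zero_add] at h1
    have h2 : D.delta p q (z ⟨(p, q + 1), hpq⟩) = 0 := by
      have := congrArg (DoubleComplex.sign p • ·) h1
      simpa [smul_smul, DoubleComplex.sign_mul_self] using this
    have h3 := K.delta_h p q (z ⟨(p, q + 1), hpq⟩)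
    rw [h2, map_zero, add_zero] at h3
    rw [totH_succ, h3, hz ⟨(p + 1, q), _⟩ hq, map_zero, smul_zero, map_zero, zero_add, sub_self]

/-- Successive approximation by `H` along the filtration by rows shows that the kernel of the
augmentation is acyclic. -/
theorem quasiIso_augHom : QuasiIso K.augHom := by
  refine quasiIso_of_surjective_of_acyclic_kernel _ (fun n x => ?_) fun n z hz hz' => ?_
  · exact ⟨K.series n x, LinearMap.congr_fun (congrArg (fun φ => (φ.f n).hom)
      K.seriesHom_augHom) x⟩
  · let pr : ∀ n, D.totX n →ₗ[k] C.X n := fun n => K.aug n ∘ₗ LinearMap.proj (R := k)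
      (φ := fun x : {x : ℤ × ℕ // x.1 + (x.2 : ℤ) = n} => D.X x.1.1 x.1.2) ⟨(n, 0), by simp⟩
    have hd : ∀ m, D.tot.d (m + 1) m = ModuleCat.ofHom (D.totD (m + 1) m rfl) :=
      fun _ => dif_pos rfl
    have hcyc : D.totD n (n - 1) (by ring) z = 0 := by
      have h1 : D.tot.d n (n - 1) = ModuleCat.ofHom (D.totD n (n - 1) (by ring)) :=
        dif_pos (by ring)
      have h2 := hz' (n - 1) (by ring)
      rwa [h1] at h2
    suffices h : ∃ w ∈ LinearMap.ker (pr (n + 1)), D.totD (n + 1) n rfl w = z by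
      obtain ⟨w, hw, hw'⟩ := h
      exact ⟨w, hw, by rw [hd]; exact hw'⟩
    refine exists_preimage_of_complete_filtration (D.totD (n + 1) n rfl)
      (rowFiltration D n) (rowFiltration D (n + 1))
      (LinearMap.ker (pr n) ⊓ LinearMap.ker (D.totD n (n - 1) (by ring)))
      (LinearMap.ker (pr (n + 1))) ?_ ?_ ?_ ?_ ?_ z ⟨fun _ h => absurd h (by simp), hz, hcyc⟩
    · -- a sum of terms vanishing below row `i` is finite in each row
      intro w hw
      refine ⟨fun y => ∑ i ∈ Finset.range (y.1.2 + 1), w i y, ?_, fun N y hy => ?_⟩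
      · have := (hw 0).2
        simpa [pr, LinearMap.mem_ker] using this
      · rw [Pi.sub_apply, Finset.sum_apply, sub_eq_zero]
        exact sum_range_eq_sum_range_of_lt (fun i hi => (hw i).1 y hi) hy
    · exact fun v hv => funext fun y => hv (y.1.2 + 1) y (Nat.lt_succ_self _)
    · exact fun i z hz y hy => hz y (by omega)
    · rintro i w hw ⟨⟨p, q⟩, hpq⟩ hq
      have hq : q < i := hq
      rw [DoubleComplex.totD_apply, hw _ (Nat.lt_succ_of_lt hq), hw _ (Nat.succ_lt_succ hq),
        map_zero, map_zero, smul_zero, add_zero]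
    · rintro i z ⟨hz, haug, hcyc⟩
      refine ⟨K.totH n z, ⟨?_, ?_⟩,
        K.sub_totD_totH_mem n (n - 1) (by ring) i z hz haug hcyc, ?_, ?_⟩
      · rintro ⟨⟨p, q⟩, hpq⟩ hq
        cases q with
        | zero => rfl
        | succ q =>
          have hq : q + 1 < i := hq
          rw [totH_succ, hz ⟨(p, q), _⟩ (show q < i by omega), map_zero, smul_zero]
      · change K.aug (n + 1) 0 = 0
        rw [map_zero]
      · rw [SetLike.mem_coe, LinearMap.mem_ker, map_sub, LinearMap.mem_ker.mp haug, zero_sub,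
          neg_eq_zero]
        refine (K.aug_totD n (K.totH n z)).trans ?_
        rw [totH_zero, map_zero, map_zero]
      · rw [SetLike.mem_coe, LinearMap.mem_ker, map_sub, LinearMap.mem_ker.mp hcyc, zero_sub,
          neg_eq_zero]
        exact LinearMap.congr_fun (D.totD_totD (n + 1) n (n - 1) rfl (by ring)) _

/-- The series is a section of the augmentation. -/
theorem quasiIso_seriesHom : QuasiIso K.seriesHom := by
  have := K.quasiIso_augHom
  have h : QuasiIso (K.seriesHom ≫ K.augHom) := by
    rw [K.seriesHom_augHom]
    infer_instance
  exact quasiIso_of_comp_right K.seriesHom K.augHom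

end ColumnContraction
end Perturbation

/-! ### Contracting the columns of the group homology double complex -/

section Columns

variable {k : Type u} [CommRing k] {G : Type w}

/-- The Hochschild boundary of `G^{k♮}`, with source and target written as free modules. -/
def barB (k : Type u) [CommRing k] (G : Type w) (q : ℕ) :
    ((Fin (q + 2) → G) →₀ k) →ₗ[k] ((Fin (q + 1) → G) →₀ k) :=
  ∑ i : Fin (q + 2), (-1 : k) ^ (i : ℕ) • Finsupp.lmapDomain k k fun g => g ∘ i.succAbove

theorem barB_single (q : ℕ) (b : Fin (q + 2) → G) :
    barB k G q (Finsupp.single b 1) =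
      ∑ i : Fin (q + 2), (-1 : k) ^ (i : ℕ) • Finsupp.single (b ∘ i.succAbove) 1 := by
  simp [barB]

theorem cons_comp_succAbove_succ {n : ℕ} (a : G) (b : Fin (n + 1) → G) (i : Fin (n + 1)) :
    (Fin.cons a b : Fin (n + 2) → G) ∘ i.succ.succAbove =
      (Fin.cons a (b ∘ i.succAbove) : Fin (n + 1) → G) := by
  funext j
  refine Fin.cases ?_ (fun j => ?_) j <;> simp

/-- Prepending an entry is a contraction of the bar complex. -/
theorem barB_cons (q : ℕ) (a : G) (b : Fin (q + 2) → G) :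
    barB k G (q + 1) (Finsupp.single (Fin.cons a b : Fin (q + 3) → G) 1) =
      Finsupp.single b 1 - Finsupp.lmapDomain k k
        (fun b : Fin (q + 1) → G => (Fin.cons a b : Fin (q + 2) → G))
        (barB k G q (Finsupp.single b 1)) := by
  have h0 : (Fin.cons a b : Fin (q + 3) → G) ∘ (0 : Fin (q + 3)).succAbove = b := by
    funext j
    simp
  rw [barB_single, barB_single, Fin.sum_univ_succ, h0, map_sum,
    sub_eq_add_neg, ← Finset.sum_neg_distrib, Fin.val_zero, pow_zero, one_smul]
  congr 1
  refine Finset.sum_congr rfl fun i _ => ?_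
  rw [cons_comp_succAbove_succ, map_smul, Finsupp.lmapDomain_apply, Finsupp.mapDomain_single,
    Fin.val_succ, pow_succ, mul_neg_one, neg_smul]

theorem barB_zero_cons (a : G) (b : Fin 1 → G) :
    barB k G 0 (Finsupp.single (Fin.cons a b : Fin 2 → G) 1) =
      Finsupp.single b 1 - Finsupp.single (fun _ => a) 1 := by
  have h1 : (Fin.cons a b : Fin 2 → G) ∘ (1 : Fin 2).succAbove = fun _ => a := by
    funext j
    rw [Subsingleton.elim j 0]
    rfl
  have h0 : (Fin.cons a b : Fin 2 → G) ∘ (0 : Fin 2).succAbove = b := by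
    funext j
    simp
  rw [barB_single, Fin.sum_univ_two, h0, h1]
  simp [sub_eq_add_neg]

theorem prepend_tmul_right {V : Type*} [AddCommGroup V] [Module k V] {m : ℕ} (ℓ : Fin (m + 1))
    (q : ℕ) (x : V) (g : Fin (m + 1) → G) (y : (Fin (q + 1) → G) →₀ k) :
    prepend (k := k) V ℓ q ((x ⊗ₜ Finsupp.single g 1) ⊗ₜ y) =
      (x ⊗ₜ Finsupp.single g 1) ⊗ₜ Finsupp.lmapDomain k k
        (fun h : Fin (q + 1) → G => (Fin.cons (g ℓ) h : Fin (q + 2) → G)) y := by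
  simp [prepend, prependAux]

/-- `x ⊗ g ↦ (x ⊗ g) ⊗ g_ℓ`. -/
def markEntry (V : Type*) [AddCommGroup V] [Module k V] {m : ℕ} (ℓ : Fin (m + 1)) :
    V ⊗[k] ((Fin (m + 1) → G) →₀ k) →ₗ[k]
      (V ⊗[k] ((Fin (m + 1) → G) →₀ k)) ⊗[k] ((Fin 1 → G) →₀ k) :=
  (TensorProduct.assoc k _ _ _).symm.toLinearMap ∘ₗ
    TensorProduct.map LinearMap.id (Finsupp.linearCombination k fun g : Fin (m + 1) → G =>
      Finsupp.single g (1 : k) ⊗ₜ Finsupp.single (fun _ => g ℓ) (1 : k))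

theorem markEntry_tmul {V : Type*} [AddCommGroup V] [Module k V] {m : ℕ} (ℓ : Fin (m + 1))
    (x : V) (g : Fin (m + 1) → G) : markEntry V ℓ (x ⊗ₜ Finsupp.single g (1 : k)) =
      (x ⊗ₜ Finsupp.single g 1) ⊗ₜ Finsupp.single (fun _ => g ℓ) 1 := by
  simp [markEntry]

theorem forgetTuple_tmul {V : Type*} [AddCommGroup V] [Module k V] {I : Type*} (x : V)
    (y : I →₀ k) : forgetTuple k V I (x ⊗ₜ y) =
      Finsupp.linearCombination k (fun _ => (1 : k)) y • x := by
  simp [forgetTuple]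

/-- Linear maps out of `V ⊗ k[I]` are determined by their values on `x ⊗ i`. -/
theorem tmul_single_ext {V Z I : Type*} [AddCommGroup V] [Module k V] [AddCommGroup Z]
    [Module k Z] {f f' : V ⊗[k] (I →₀ k) →ₗ[k] Z}
    (h : ∀ x i, f (x ⊗ₜ Finsupp.single i 1) = f' (x ⊗ₜ Finsupp.single i 1)) : f = f' := by
  refine TensorProduct.ext ?_
  ext x i
  exact h x i

variable [Group G]

/-- Linear maps out of `V ⊗_{kG} C_q(G)` are determined by their values on `x ⊗ (h_0, …, h_q)`. -/
theorem balanced_ext {V Z : Type*} [AddCommGroup V] [Module k V] [AddCommGroup Z] [Module k Z]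
    {q : ℕ} {ρ : Representation k G V} {f f' : Balanced ρ (tupleRep k G q) →ₗ[k] Z}
    (h : ∀ (x : V) (b : Fin (q + 1) → G),
      f (Submodule.Quotient.mk (x ⊗ₜ Finsupp.single b 1)) =
        f' (Submodule.Quotient.mk (x ⊗ₜ Finsupp.single b 1))) : f = f' := by
  exact Submodule.linearMap_qext _ (tmul_single_ext h)

/-- Linear maps out of `(V ⊗ (kG)^{⊗ (m+1)}) ⊗_{kG} C_q(G)` are determined by their values on
`(x ⊗ (g_0, …, g_m)) ⊗ (h_0, …, h_q)`. -/
theorem balanced_tuple_ext {V Z : Type*} [AddCommGroup V] [Module k V] [AddCommGroup Z]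
    [Module k Z] {m q : ℕ} {ρ : Representation k G (V ⊗[k] ((Fin (m + 1) → G) →₀ k))}
    {f f' : Balanced ρ (tupleRep k G q) →ₗ[k] Z}
    (h : ∀ (x : V) (a : Fin (m + 1) → G) (b : Fin (q + 1) → G),
      f (Submodule.Quotient.mk ((x ⊗ₜ Finsupp.single a 1) ⊗ₜ Finsupp.single b 1)) =
        f' (Submodule.Quotient.mk ((x ⊗ₜ Finsupp.single a 1) ⊗ₜ Finsupp.single b 1))) :
    f = f' := by
  refine Submodule.linearMap_qext _ (TensorProduct.ext (TensorProduct.ext ?_))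
  ext x a b
  exact h x a b

theorem tupleRep_single {m : ℕ} (γ : G) (g : Fin (m + 1) → G) (c : k) :
    tupleRep k G m γ (Finsupp.single g c) = Finsupp.single (fun j => γ * g j) c :=
  Finsupp.mapDomain_single

section Rep

variable {V : Type v} [AddCommGroup V] [Module k V] (ρ : Representation k G V)

/-- The span of the elements `x - g x`. -/
def coinvariantsRel : Submodule k V :=
  Submodule.span k {z | ∃ (g : G) (x : V), z = x - ρ g x}

theorem mk_coinvariants_eq (g : G) (x : V) :
    (coinvariantsRel ρ).mkQ (ρ g x) = (coinvariantsRel ρ).mkQ x :=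
  ((Submodule.Quotient.eq (coinvariantsRel ρ)).mpr (Submodule.subset_span ⟨g, x, rfl⟩)).symm

theorem mk_balanced_eq {W : Type*} [AddCommGroup W] [Module k W] (σ : Representation k G W)
    (g : G) (x : V) (y : W) :
    (balancedRel ρ σ).mkQ (ρ g x ⊗ₜ σ g y) = (balancedRel ρ σ).mkQ (x ⊗ₜ y) := by
  refine (Submodule.Quotient.eq _).mpr ?_
  rw [← neg_sub]
  refine Submodule.neg_mem _ (Submodule.subset_span ⟨g, ρ g x, y, ?_⟩)
  rw [← Module.End.mul_apply, ← map_mul, inv_mul_cancel, map_one, Module.End.one_apply]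

/-- The augmentation `V ⊗_{kG} C_0(G) → V_G`, `x ⊗ h ↦ [x]`. -/
def augMap : Balanced ρ (tupleRep k G 0) →ₗ[k] V ⧸ coinvariantsRel ρ :=
  (balancedRel ρ (tupleRep k G 0)).liftQ
    ((coinvariantsRel ρ).mkQ ∘ₗ forgetTuple k V (Fin 1 → G)) (by
      rw [balancedRel, Submodule.span_le]
      rintro _ ⟨g, x, y, rfl⟩
      have h : Finsupp.linearCombination k (fun _ => (1 : k)) (tupleRep k G 0 g y) =
          Finsupp.linearCombination k (fun _ : Fin 1 → G => (1 : k)) y := by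
        simp [tupleRep, Finsupp.linearCombination_mapDomain, Function.comp_def]
      rw [SetLike.mem_coe, LinearMap.mem_ker, map_sub, LinearMap.comp_apply, LinearMap.comp_apply,
        forgetTuple_tmul, forgetTuple_tmul, h, map_smul, map_smul, mk_coinvariants_eq, sub_self])

theorem augMap_mk (x : V) (y : (Fin 1 → G) →₀ k) :
    augMap ρ (Submodule.Quotient.mk (x ⊗ₜ y)) =
      Finsupp.linearCombination k (fun _ => (1 : k)) y • (coinvariantsRel ρ).mkQ x := by
  rw [augMap]
  refine (Submodule.liftQ_apply _ _ _).trans ?_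
  rw [LinearMap.comp_apply, forgetTuple_tmul, map_smul]

/-- The differential `id ⊗ b : V ⊗_{kG} C_{q+1}(G) → V ⊗_{kG} C_q(G)`. -/
def balancedDelta (q : ℕ) : Balanced ρ (tupleRep k G (q + 1)) →ₗ[k] Balanced ρ (tupleRep k G q) :=
  balancedMap ρ _ ρ _ LinearMap.id (barB k G q) (fun _ => rfl) (tupleRep_b q)

theorem balancedDelta_mk (q : ℕ) (x : V) (y : (Fin (q + 2) → G) →₀ k) :
    balancedDelta ρ q (Submodule.Quotient.mk (x ⊗ₜ y)) =
      Submodule.Quotient.mk (x ⊗ₜ barB k G q y) := rfl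

theorem augMap_balancedDelta : augMap ρ ∘ₗ balancedDelta ρ 0 = 0 := by
  refine balanced_ext fun x b => ?_
  rw [LinearMap.comp_apply, balancedDelta_mk, augMap_mk, barB_single, Fin.sum_univ_two]
  simp

variable {m : ℕ} (ℓ : Fin (m + 1))

/-- The section `[x ⊗ g] ↦ (x ⊗ g) ⊗ g_ℓ` of the augmentation. -/
def secMap : (V ⊗[k] ((Fin (m + 1) → G) →₀ k)) ⧸ coinvariantsRel (ρ.tprod (tupleRep k G m)) →ₗ[k]
    Balanced (ρ.tprod (tupleRep k G m)) (tupleRep k G 0) :=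
  (coinvariantsRel (ρ.tprod (tupleRep k G m))).liftQ
    ((balancedRel (ρ.tprod (tupleRep k G m)) (tupleRep k G 0)).mkQ ∘ₗ markEntry V ℓ) (by
      rw [coinvariantsRel, Submodule.span_le]
      rintro _ ⟨γ, z, rfl⟩
      rw [SetLike.mem_coe, LinearMap.mem_ker, map_sub, sub_eq_zero]
      suffices h : (balancedRel (ρ.tprod (tupleRep k G m)) (tupleRep k G 0)).mkQ ∘ₗ markEntry V ℓ =
          ((balancedRel (ρ.tprod (tupleRep k G m)) (tupleRep k G 0)).mkQ ∘ₗ markEntry V ℓ) ∘ₗ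
            (ρ.tprod (tupleRep k G m)) γ from LinearMap.congr_fun h z
      refine tmul_single_ext fun x g => ?_
      have h := mk_balanced_eq (ρ.tprod (tupleRep k G m)) (tupleRep k G 0) γ
        (x ⊗ₜ Finsupp.single g 1) (Finsupp.single (fun _ => g ℓ) 1)
      rw [Representation.tprod_apply, TensorProduct.map_tmul, tupleRep_single, tupleRep_single] at h
      rw [LinearMap.comp_apply, LinearMap.comp_apply, LinearMap.comp_apply,
        Representation.tprod_apply, TensorProduct.map_tmul, tupleRep_single, markEntry_tmul,
        markEntry_tmul, h])

theorem secMap_mk (x : V) (g : Fin (m + 1) → G) :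
    secMap ρ ℓ ((coinvariantsRel (ρ.tprod (tupleRep k G m))).mkQ (x ⊗ₜ Finsupp.single g 1)) =
      Submodule.Quotient.mk ((x ⊗ₜ Finsupp.single g 1) ⊗ₜ Finsupp.single (fun _ => g ℓ) 1) := by
  rw [secMap]
  refine (Submodule.liftQ_apply _ _ _).trans ?_
  rw [LinearMap.comp_apply, markEntry_tmul]
  rfl

theorem augMap_secMap :
    augMap (ρ.tprod (tupleRep k G m)) ∘ₗ secMap ρ ℓ = LinearMap.id := by
  refine Submodule.linearMap_qext _ (tmul_single_ext fun x g => ?_)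
  rw [LinearMap.comp_apply, LinearMap.comp_apply, secMap_mk, augMap_mk,
    Finsupp.linearCombination_single, smul_eq_mul, mul_one, one_smul]
  rfl

/-- The contraction prepending the `ℓ`-th entry of the tuple. -/
def prependMap (q : ℕ) : Balanced (ρ.tprod (tupleRep k G m)) (tupleRep k G q) →ₗ[k]
    Balanced (ρ.tprod (tupleRep k G m)) (tupleRep k G (q + 1)) :=
  Submodule.mapQ _ _ (prepend V ℓ q) (prepend_le ρ ℓ q)

theorem prependMap_mk (q : ℕ) (x : V) (g : Fin (m + 1) → G) (y : (Fin (q + 1) → G) →₀ k) :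
    prependMap ρ ℓ q (Submodule.Quotient.mk ((x ⊗ₜ Finsupp.single g 1) ⊗ₜ y)) =
      Submodule.Quotient.mk ((x ⊗ₜ Finsupp.single g 1) ⊗ₜ Finsupp.lmapDomain k k
        (fun h : Fin (q + 1) → G => (Fin.cons (g ℓ) h : Fin (q + 2) → G)) y) := by
  rw [← prepend_tmul_right]
  rfl

theorem balancedDelta_prependMap_zero :
    balancedDelta (ρ.tprod (tupleRep k G m)) 0 ∘ₗ prependMap ρ ℓ 0 =
      LinearMap.id - secMap ρ ℓ ∘ₗ augMap (ρ.tprod (tupleRep k G m)) := by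
  refine balanced_tuple_ext fun x a b => ?_
  rw [LinearMap.comp_apply, prependMap_mk, balancedDelta_mk, Finsupp.lmapDomain_apply,
    Finsupp.mapDomain_single, LinearMap.sub_apply, LinearMap.comp_apply, augMap_mk,
    Finsupp.linearCombination_single, barB_zero_cons, smul_eq_mul, mul_one, one_smul,
    secMap_mk, TensorProduct.tmul_sub, Submodule.Quotient.mk_sub, LinearMap.id_apply]

theorem balancedDelta_prependMap (q : ℕ) :
    balancedDelta (ρ.tprod (tupleRep k G m)) (q + 1) ∘ₗ prependMap ρ ℓ (q + 1) +
      prependMap ρ ℓ q ∘ₗ balancedDelta (ρ.tprod (tupleRep k G m)) q = LinearMap.id := by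
  refine balanced_tuple_ext fun x a b => ?_
  rw [LinearMap.add_apply, LinearMap.comp_apply, LinearMap.comp_apply, prependMap_mk,
    balancedDelta_mk, balancedDelta_mk, prependMap_mk, Finsupp.lmapDomain_apply,
    Finsupp.mapDomain_single, barB_cons, TensorProduct.tmul_sub, Submodule.Quotient.mk_sub,
    sub_add_cancel, LinearMap.id_apply]

end Rep

/-- The augmentation `M ⊗_{kG} C_0(G) → M_G` as a morphism of cyclic modules. -/
def augCyclic (M : CyclicRep.{u, v, w} k G) :
    CyclicHom (M.balanced (tupleRep k G 0)) M.coinvariants where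
  f n := augMap (M.ρ n)
  comm_d n i := balanced_ext fun x b => by
    exact (augMap_mk _ _ _).trans (congrArg (M.coinvariants.d n i) (augMap_mk (M.ρ (n + 1)) x _)
      |>.trans (map_smul _ _ _)).symm
  comm_s n i := balanced_ext fun x b => by
    exact (augMap_mk _ _ _).trans (congrArg (M.coinvariants.s n i) (augMap_mk (M.ρ n) x _)
      |>.trans (map_smul _ _ _)).symm
  comm_t n := balanced_ext fun x b => by
    exact (augMap_mk _ _ _).trans (congrArg (M.coinvariants.t n) (augMap_mk (M.ρ n) x _)
      |>.trans (map_smul _ _ _)).symm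

end Columns

section Q

variable {k : Type u} [CommRing k] {A : Type v} [Ring A] [Algebra k A] {G : Type w} [Group G]
  [MulSemiringAction G A] [SMulCommClass G k A]

/-- The columns of the completed group homology complex with values in `CC F (A ♮ G)` are
contracted onto `CC F (A ♮ G)_G` by the homotopies splitting off the entries `ℓ`. -/
def algGroupContraction (F : Flavour) (ℓ : ∀ m : ℕ, Fin (m + 1)) :
    ColumnContraction (completedDouble F (algGroup k A G))
      (CC F (algGroup k A G).coinvariants) where
  h p q := chainsMap F (fun m => homotopy (ℓ m) q) p
  aug p := chainsMap F (augCyclic (algGroup k A G)).f p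
  sec p := chainsMap F (M := (algGroup k A G).coinvariants)
    (N := (algGroup k A G).balanced (tupleRep k G 0)) (fun m => secMap (algAct k A G m) (ℓ m)) p
  aug_sec _ z := funext fun x =>
    LinearMap.congr_fun (augMap_secMap (algAct k A G x.1.2) (ℓ x.1.2)) (z x)
  aug_delta _ z := funext fun x =>
    LinearMap.congr_fun (augMap_balancedDelta ((algGroup k A G).ρ x.1.2)) (z x)
  aug_del p z := by
    rw [show (CC F (algGroup k A G).coinvariants).d (p + 1) p =
      ModuleCat.ofHom (chainsD F _ (p + 1) p rfl) from dif_pos rfl]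
    exact LinearMap.congr_fun (chainsMap_comm F (augCyclic (algGroup k A G)) (p + 1) p rfl) z
  delta_h_zero _ z := funext fun x =>
    LinearMap.congr_fun (balancedDelta_prependMap_zero (algAct k A G x.1.2) (ℓ x.1.2)) (z x)
  delta_h _ q z := funext fun x =>
    LinearMap.congr_fun (balancedDelta_prependMap (algAct k A G x.1.2) (ℓ x.1.2) q) (z x)

theorem aug_tensorOne (F : Flavour) (ℓ : ∀ m : ℕ, Fin (m + 1)) (n : ℤ)
    (z : Chains F (algGroup k A G).toCyclicModule n) :
    (algGroupContraction F ℓ).aug n (tensorOne F n z) =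
      chainsMap F (algGroup k A G).toCoinvariants.f n z :=
  funext fun x => by
    refine (augMap_mk ((algGroup k A G).ρ x.1.2) (z x) _).trans ?_
    rw [Finsupp.linearCombination_single, smul_eq_mul, mul_one, one_smul]
    rfl

theorem series_toCoinvariants (F : Flavour) (ℓ : ∀ m : ℕ, Fin (m + 1)) (n : ℤ)
    (z : Chains F (algGroup k A G).toCyclicModule n) :
    ((algGroupContraction F ℓ).seriesHom.f n).hom
      (chainsMap F (algGroup k A G).toCoinvariants.f n z) = Qlift F ℓ n z := by
  rw [← aug_tensorOne F ℓ]
  exact (algGroupContraction F ℓ).series_aug n (tensorOne F n z)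

end Q

/-! ### Rowwise contractions and the filtration by the degree in the cyclic module -/

section Rows

variable {k : Type u} [CommRing k]

/-- The map of product totalisations induced by `φ`, in degree `n`. -/
def DoubleComplex.totMapLin {D E : DoubleComplex.{u, v} k} (φ : DoubleComplex.Hom D E) (n : ℤ) :
    D.totX n →ₗ[k] E.totX n :=
  ((DoubleComplex.totMap φ).f n).hom

theorem DoubleComplex.tot_d (D : DoubleComplex.{u, v} k) (n n' : ℤ) (h : n' + 1 = n) :
    D.tot.d n n' = ModuleCat.ofHom (D.totD n n' h) := dif_pos h

theorem DoubleComplex.totMapLin_totD {D E : DoubleComplex.{u, v} k} (φ : DoubleComplex.Hom D E)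
    (n n' : ℤ) (h : n' + 1 = n) (z : D.totX n) :
    DoubleComplex.totMapLin φ n' (D.totD n n' h z) =
      E.totD n n' h (DoubleComplex.totMapLin φ n z) := by
  have h1 := (DoubleComplex.totMap φ).comm n n'
  rw [DoubleComplex.tot_d _ n n' h, DoubleComplex.tot_d _ n n' h] at h1
  exact (LinearMap.congr_fun (congrArg ModuleCat.Hom.hom h1) z).symm

/-- The double complex whose `q`-th row is the complex `CC F` of the cyclic module `D q`. -/
def rowDouble (F : Flavour) (D : ℕ → CyclicModule.{u, v} k)
    (δ : ∀ q, CyclicHom (D (q + 1)) (D q))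
    (hδ : ∀ q m, (δ q).f m ∘ₗ (δ (q + 1)).f m = 0) : DoubleComplex.{u, v} k where
  X p q := Chains F (D q) p
  del p _ := chainsD F _ (p + 1) p rfl
  delta p q := chainsMap F (δ q).f p
  del_del _ _ := chainsD_chainsD F _ _ _ _ _ _
  delta_delta _ q := LinearMap.ext fun z => funext fun x => LinearMap.congr_fun (hδ q x.1.2) (z x)
  del_delta _ q := (chainsMap_comm F (δ q) _ _ _).symm

theorem uB_eq_zero (F : Flavour) (M : CyclicModule.{u, v} k) (n j : ℤ) (m : ℕ)
    (h : (m : ℤ) + 1 = n + 2 * j) (z : Chains F M n)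
    (hz : ∀ x : UIndex F n, x.1.2 < m → z x = 0) : uB F M n j m h z = 0 := by
  cases m with
  | zero => rfl
  | succ m =>
    rw [uB]
    split_ifs with hj
    · rw [LinearMap.comp_apply, LinearMap.proj_apply, hz _ (Nat.lt_succ_self m), map_zero]
    · rfl

variable {F : Flavour} {D E : ℕ → CyclicModule.{u, v} k}
  {δ : ∀ q, CyclicHom (D (q + 1)) (D q)} {hδ : ∀ q m, (δ q).f m ∘ₗ (δ (q + 1)).f m = 0}
  {ε : ∀ q, CyclicHom (E (q + 1)) (E q)} {hε : ∀ q m, (ε q).f m ∘ₗ (ε (q + 1)).f m = 0}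

/-- The index set of the entries of total degree `n`. -/
abbrev TotIndex (n : ℤ) := {x : ℤ × ℕ // x.1 + (x.2 : ℤ) = n}

/-- The elements all of whose coefficients in cyclic degree below `i` vanish. -/
def degreeFiltration (F : Flavour) (δ : ∀ q, CyclicHom (D (q + 1)) (D q))
    (hδ : ∀ q m, (δ q).f m ∘ₗ (δ (q + 1)).f m = 0) (n : ℤ) (i : ℕ) :
    Submodule k ((rowDouble F D δ hδ).totX n) where
  carrier := {z | ∀ (x : TotIndex n) (y : UIndex F x.1.1), y.1.2 < i →
    (z x : Chains F (D x.1.2) x.1.1) y = 0}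
  add_mem' {a b} ha hb x y hy := by
    change (a x : Chains F (D x.1.2) x.1.1) y + (b x : Chains F (D x.1.2) x.1.1) y = 0
    rw [ha x y hy, hb x y hy, add_zero]
  zero_mem' _ _ _ := rfl
  smul_mem' c a ha x y hy := by
    change c • (a x : Chains F (D x.1.2) x.1.1) y = 0
    rw [ha x y hy, smul_zero]

theorem rowDouble_totD_apply (n n' : ℤ) (h : n' + 1 = n) (z : (rowDouble F D δ hδ).totX n) (p : ℤ)
    (q : ℕ) (hpq : p + (q : ℤ) = n') (j : ℤ) (m : ℕ) (hj : j ∈ F.exponents)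
    (hm : (m : ℤ) = p + 2 * j) :
    ((rowDouble F D δ hδ).totD n n' h z ⟨(p, q), hpq⟩ : Chains F (D q) p) ⟨(j, m), hj, hm⟩ =
      (D q).b m ((z ⟨(p + 1, q), by linarith⟩ : Chains F (D q) (p + 1))
        ⟨(j, m + 1), hj, by push_cast; linarith⟩) +
      uB F (D q) (p + 1) j m (by linarith) (z ⟨(p + 1, q), by linarith⟩) +
      DoubleComplex.sign p • (δ q).f m
        ((z ⟨(p, q + 1), by push_cast; linarith⟩ : Chains F (D (q + 1)) p) ⟨(j, m), hj, hm⟩) := rfl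

/-- The operator on the total complex given by operators `h` of degree one on the rows. -/
def totRowHomotopy (h : ∀ q m, (D q).X m →ₗ[k] (D q).X (m + 1)) (n : ℤ)
    (z : (rowDouble F D δ hδ).totX n) : (rowDouble F D δ hδ).totX (n + 1) :=
  fun ⟨(p, q), hpq⟩ => fun ⟨(_, m), hy⟩ => match m, hy with
    | 0, _ => 0
    | m + 1, hy => h q m ((z ⟨(p - 1, q), by linarith⟩ : Chains F (D q) (p - 1))
        ⟨(_, m), hy.1, by have := hy.2; push_cast at this; linarith⟩)

theorem totRowHomotopy_zero (h : ∀ q m, (D q).X m →ₗ[k] (D q).X (m + 1)) (n : ℤ)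
    (z : (rowDouble F D δ hδ).totX n) (p : ℤ) (q : ℕ) (hpq : p + (q : ℤ) = n + 1) (j : ℤ) (hy) :
    (totRowHomotopy h n z ⟨(p, q), hpq⟩ : Chains F (D q) p) ⟨(j, 0), hy⟩ = 0 := rfl

theorem totRowHomotopy_succ (h : ∀ q m, (D q).X m →ₗ[k] (D q).X (m + 1)) (n : ℤ)
    (z : (rowDouble F D δ hδ).totX n) (p p' : ℤ) (hp : p' + 1 = p) (q : ℕ)
    (hpq : p + (q : ℤ) = n + 1) (j : ℤ) (m : ℕ) (hy) :
    (totRowHomotopy h n z ⟨(p, q), hpq⟩ : Chains F (D q) p) ⟨(j, m + 1), hy⟩ =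
      h q m ((z ⟨(p', q), by linarith⟩ : Chains F (D q) p')
        ⟨(j, m), hy.1, by have := hy.2; push_cast at this; linarith⟩) := by
  obtain rfl : p' = p - 1 := by omega
  rfl

/-- The morphism of double complexes given by morphisms of cyclic modules on the rows. -/
def rowDoubleHom (φ : ∀ q, CyclicHom (D q) (E q))
    (hφ : ∀ q m, (φ q).f m ∘ₗ (δ q).f m = (ε q).f m ∘ₗ (φ (q + 1)).f m) :
    DoubleComplex.Hom (rowDouble F D δ hδ) (rowDouble F E ε hε) where
  f p q := chainsMap F (φ q).f p
  comm_del _ q := chainsMap_comm F (φ q) _ _ rfl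
  comm_delta _ q := LinearMap.ext fun z => funext fun x => LinearMap.congr_fun (hφ q x.1.2) (z x)

/-- The entries of a cycle in the lowest degree `i` of the filtration, and below, are `b`-cycles:
the contributions of `uB` and `δ` to the differential come from entries of degree below `i`. -/
theorem b_entry_eq_zero (n : ℤ) (i : ℕ) (z : (rowDouble F D δ hδ).totX n)
    (hz : z ∈ degreeFiltration F δ hδ n i)
    (hcyc : (rowDouble F D δ hδ).totD n (n - 1) (by ring) z = 0) (p : ℤ) (q : ℕ)
    (hpq : p + (q : ℤ) = n) (j : ℤ) (m : ℕ) (hmi : m < i) (hj : j ∈ F.exponents)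
    (hm : ((m + 1 : ℕ) : ℤ) = p + 2 * j) :
    (D q).b m ((z ⟨(p, q), hpq⟩ : Chains F (D q) p) ⟨(j, m + 1), hj, hm⟩) = 0 := by
  obtain ⟨p, rfl⟩ : ∃ p', p = p' + 1 := ⟨p - 1, by ring⟩
  have hm' : (m : ℤ) = p + 2 * j := by push_cast at hm; linarith
  have h1 := rowDouble_totD_apply (hδ := hδ) n (n - 1) (by ring) z p q (by linarith) j m hj hm'
  rw [hcyc, hz ⟨(p, q + 1), _⟩ ⟨(j, m), _⟩ hmi, uB_eq_zero _ _ _ _ _ _ _ fun y hy =>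
    hz ⟨(p + 1, q), _⟩ y (lt_trans hy hmi), map_zero, smul_zero] at h1
  exact ((add_zero _).trans (add_zero _)).symm.trans h1.symm

/-- A cycle in the kernel of `φ` that vanishes below degree `i` is the boundary of its image under
the contraction, up to terms vanishing below degree `i + 1`. -/
theorem sub_totD_totRowHomotopy_mem (φ : ∀ q, CyclicHom (D q) (E q))
    (h : ∀ q m, (D q).X m →ₗ[k] (D q).X (m + 1))
    (hzero : ∀ q x, (φ q).f 0 x = 0 → (D q).b 0 (h q 0 x) = x)
    (hsucc : ∀ q m x, (φ q).f (m + 1) x = 0 →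
      (D q).b (m + 1) (h q (m + 1) x) + h q m ((D q).b m x) = x)
    (n : ℤ) (i : ℕ) (z : (rowDouble F D δ hδ).totX n) (hz : z ∈ degreeFiltration F δ hδ n i)
    (hφz : ∀ (y : TotIndex n) (y' : UIndex F y.1.1),
      (φ y.1.2).f y'.1.2 ((z y : Chains F (D y.1.2) y.1.1) y') = 0)
    (hcyc : (rowDouble F D δ hδ).totD n (n - 1) (by ring) z = 0) :
    z - (rowDouble F D δ hδ).totD (n + 1) n rfl (totRowHomotopy h n z) ∈
      degreeFiltration F δ hδ n (i + 1) := by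
  rintro ⟨⟨p, q⟩, hpq⟩ ⟨⟨j, m⟩, hj, hm⟩ (hmi : m < i + 1)
  replace hpq : p + (q : ℤ) = n := hpq
  replace hm : (m : ℤ) = p + 2 * j := hm
  refine sub_eq_zero.mpr (Eq.symm ((rowDouble_totD_apply _ _ _ _ _ _ _ _ _ hj hm).trans ?_))
  have huB : uB F (D q) (p + 1) j m (by linarith)
      (totRowHomotopy h n z ⟨(p + 1, q), by linarith⟩) = 0 := by
    refine uB_eq_zero _ _ _ _ _ _ _ ?_
    rintro ⟨⟨j', m'⟩, hy⟩ (hm' : m' < m)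
    cases m' with
    | zero => rfl
    | succ m' =>
      rw [totRowHomotopy_succ h n z (p + 1) p rfl, hz ⟨(p, q), _⟩ _
        (show m' < i by omega), map_zero]
  rw [totRowHomotopy_succ h n z (p + 1) p rfl, huB, add_zero]
  cases m with
  | zero =>
    rw [totRowHomotopy_zero, map_zero, smul_zero, add_zero]
    exact hzero q _ (hφz ⟨(p, q), hpq⟩ ⟨(j, 0), hj, hm⟩)
  | succ m =>
    have hmi : m < i := by omega
    have h2 : (totRowHomotopy h n z ⟨(p, q + 1), by push_cast; linarith⟩ : Chains F (D (q + 1)) p)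
        ⟨(j, m + 1), hj, hm⟩ = 0 := by
      refine (totRowHomotopy_succ h n z p (p - 1) (by ring) _ _ _ _ _).trans ?_
      exact (congrArg (h (q + 1) m) (hz ⟨(p - 1, q + 1), by push_cast; linarith⟩
        ⟨(j, m), hj, by push_cast at hm; linarith⟩ hmi)).trans (map_zero _)
    have h5 : DoubleComplex.sign p • (δ q).f (m + 1)
        ((totRowHomotopy h n z ⟨(p, q + 1), by push_cast; linarith⟩ : Chains F (D (q + 1)) p)
          ⟨(j, m + 1), hj, hm⟩) = 0 :=
      (congrArg (DoubleComplex.sign p • (δ q).f (m + 1) ·) h2).trans (by rw [map_zero, smul_zero])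
    refine (congrArg₂ (· + ·) rfl h5).trans ((add_zero _).trans ?_)
    have h3 := hsucc q m _ (hφz ⟨(p, q), hpq⟩ ⟨(j, m + 1), hj, hm⟩)
    have h4 := b_entry_eq_zero n i z hz hcyc p q hpq j m hmi hj hm
    exact (add_zero _).symm.trans
      ((congrArg _ ((congrArg (h q m) h4).trans (map_zero _)).symm).trans h3)

/-- If the Hochschild complexes of the kernels of surjections `φ q : D q → E q` of cyclic modules
are contractible, then the induced map of product totalisations is a quasi-isomorphism, for every
flavour. Neither `B` nor `δ` has to be compatible with the contraction: the degree `m ≥ 0` in the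
cyclic modules gives a complete filtration, and the contraction solves `D w = z` up to terms of
higher filtration. -/
theorem quasiIso_rowDoubleHom (φ : ∀ q, CyclicHom (D q) (E q))
    (hφ : ∀ q m, (φ q).f m ∘ₗ (δ q).f m = (ε q).f m ∘ₗ (φ (q + 1)).f m)
    (σ : ∀ q m, (E q).X m →ₗ[k] (D q).X m) (hσ : ∀ q m x, (φ q).f m (σ q m x) = x)
    (h : ∀ q m, (D q).X m →ₗ[k] (D q).X (m + 1))
    (hker : ∀ q m x, (φ q).f m x = 0 → (φ q).f (m + 1) (h q m x) = 0)
    (hzero : ∀ q x, (φ q).f 0 x = 0 → (D q).b 0 (h q 0 x) = x)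
    (hsucc : ∀ q m x, (φ q).f (m + 1) x = 0 →
      (D q).b (m + 1) (h q (m + 1) x) + h q m ((D q).b m x) = x) :
    QuasiIso (DoubleComplex.totMap (rowDoubleHom (F := F) (hδ := hδ) (hε := hε) φ hφ)) := by
  refine quasiIso_of_surjective_of_acyclic_kernel _ (fun n x => ?_) fun n z hz hz' => ?_
  · exact ⟨fun y => chainsMap F (σ y.1.2) y.1.1 (x y), funext fun y => funext fun y' =>
      hσ y.1.2 y'.1.2 ((x y : Chains F (E y.1.2) y.1.1) y')⟩
  · let T := rowDouble F D δ hδ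
    have hd := T.tot_d
    let Φ := rowDoubleHom (F := F) (hδ := hδ) (hε := hε) φ hφ
    let Ψ := DoubleComplex.totMapLin Φ
    have hΨ : ∀ n (x : T.totX n), Ψ n x = 0 ↔ ∀ (y : TotIndex n) (y' : UIndex F y.1.1),
        (φ y.1.2).f y'.1.2 ((x y : Chains F (D y.1.2) y.1.1) y') = 0 := fun n x =>
      ⟨fun hx y y' => congrFun (congrFun hx y) y', fun hx =>
        funext fun y => funext fun y' => hx y y'⟩
    suffices h : ∃ w ∈ LinearMap.ker (Ψ (n + 1)), T.totD (n + 1) n rfl w = z by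
      obtain ⟨w, hw, hw'⟩ := h
      exact ⟨w, hw, by rw [hd _ _ rfl]; exact hw'⟩
    have hcyc : T.totD n (n - 1) (by ring) z = 0 := by
      have h2 := hz' (n - 1) (by ring)
      rwa [hd _ _ (by ring)] at h2
    refine exists_preimage_of_complete_filtration (T.totD (n + 1) n rfl)
      (degreeFiltration F δ hδ n) (degreeFiltration F δ hδ (n + 1))
      (LinearMap.ker (Ψ n) ⊓ LinearMap.ker (T.totD n (n - 1) (by ring)))
      (LinearMap.ker (Ψ (n + 1))) ?_ ?_ ?_ ?_ ?_ z
      ⟨fun _ _ h => absurd h (Nat.not_lt_zero _), hz, hcyc⟩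
    · -- a sum of terms vanishing below degree `i` is finite in each degree
      intro w hw
      refine ⟨fun y y' => ∑ i ∈ Finset.range (y'.1.2 + 1),
        (w i y : Chains F (D y.1.2) y.1.1) y', ?_, fun N y y' hy => ?_⟩
      · refine (hΨ _ _).mpr fun y y' => ?_
        rw [map_sum]
        exact Finset.sum_eq_zero fun i _ => (hΨ _ _).mp (hw i).2 y y'
      · have h1 : ((∑ i ∈ Finset.range N, w i) y : Chains F (D y.1.2) y.1.1) y' =
            ∑ i ∈ Finset.range N, (w i y : Chains F (D y.1.2) y.1.1) y' := by
          rw [Finset.sum_apply]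
          exact Finset.sum_apply _ _ _
        refine sub_eq_zero.mpr (Eq.trans ?_ h1.symm)
        exact sum_range_eq_sum_range_of_lt (fun i hi => (hw i).1 y y' hi) hy
    · exact fun v hv => funext fun y => funext fun y' => hv (y'.1.2 + 1) y y' (Nat.lt_succ_self _)
    · exact fun i z hz y y' hy => hz y y' (by omega)
    · rintro i w hw ⟨⟨p, q⟩, hpq⟩ ⟨⟨j, m⟩, hj, hm⟩ (hmi : m < i)
      refine (rowDouble_totD_apply _ _ _ _ _ _ _ _ _ hj hm).trans ?_
      rw [hw ⟨(p + 1, q), _⟩ ⟨(j, m + 1), _⟩ (Nat.succ_lt_succ hmi),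
        hw ⟨(p, q + 1), _⟩ ⟨(j, m), _⟩ (Nat.lt_succ_of_lt hmi),
        uB_eq_zero _ _ _ _ _ _ _ fun y hy => hw ⟨(p + 1, q), _⟩ y
          (show y.1.2 < i + 1 by omega), map_zero, map_zero, smul_zero, add_zero, add_zero]
    · rintro i z ⟨hz, hφz, hcyc⟩
      have hz0 := (hΨ _ _).mp hφz
      have hw : totRowHomotopy h n z ∈ LinearMap.ker (Ψ (n + 1)) := by
        refine (hΨ _ _).mpr ?_
        rintro ⟨⟨p, q⟩, hpq⟩ ⟨⟨j, m⟩, hj, hm⟩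
        cases m with
        | zero => exact map_zero _
        | succ m => exact hker q m _ (hz0 ⟨(p - 1, q), by linarith⟩
            ⟨(j, m), hj, by push_cast at hm ⊢; linarith⟩)
      refine ⟨totRowHomotopy h n z, ⟨?_, hw⟩, ?_, ?_, ?_⟩
      · rintro ⟨⟨p, q⟩, hpq⟩ ⟨⟨j, m⟩, hj, hm⟩ (hmi : m < i)
        cases m with
        | zero => rfl
        | succ m =>
          rw [totRowHomotopy_succ h n z p (p - 1) (by ring), hz ⟨(p - 1, q), _⟩ _
            (show m < i by omega), map_zero]
      · exact sub_totD_totRowHomotopy_mem φ h hzero hsucc n i z hz hz0 hcyc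
      · have h2 : Ψ n (T.totD (n + 1) n rfl (totRowHomotopy h n z)) = 0 := by
          rw [DoubleComplex.totMapLin_totD, LinearMap.mem_ker.mp hw, map_zero]
        rw [SetLike.mem_coe, LinearMap.mem_ker, map_sub, h2, LinearMap.mem_ker.mp hφz, sub_zero]
      · rw [SetLike.mem_coe, LinearMap.mem_ker, map_sub, LinearMap.mem_ker.mp hcyc, zero_sub,
          neg_eq_zero]
        exact LinearMap.congr_fun (T.totD_totD (n + 1) n (n - 1) rfl (by ring)) _

end Rows

/-! ### Contracting the rows onto the complexes of `A^♮` -/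

section Combinatorics

variable {k V : Type*} [CommRing k] [AddCommGroup V] [Module k V]

/-- The alternating sum identity behind the chain homotopy of a simplicial homotopy: `D i j` stands
for `d_i h_j` and `E i j` for `h_j d_i`. -/
theorem sum_simplicial_homotopy (n : ℕ) (D : Fin (n + 2) → Fin (n + 1) → V)
    (E : Fin (n + 1) → Fin n → V)
    (h1 : ∀ (i : Fin (n + 1)) (j : Fin n), i ≤ j.castSucc → D i.castSucc j.succ = E i j)
    (h2 : ∀ (i : Fin (n + 1)) (j : Fin n), j.castSucc < i → D i.succ j.castSucc = E i j)
    (h3 : ∀ j : Fin n, D j.succ.castSucc j.succ = D j.castSucc.succ j.castSucc) :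
    ∑ i : Fin (n + 2), ∑ j : Fin (n + 1), (-1 : k) ^ ((i : ℕ) + (j : ℕ)) • D i j +
        ∑ i : Fin (n + 1), ∑ j : Fin n, (-1 : k) ^ ((i : ℕ) + (j : ℕ)) • E i j =
      D 0 0 - D (Fin.last _) (Fin.last _) := by
  induction n with
  | zero => simp [Fin.sum_univ_two, sub_eq_add_neg]
  | succ n ih =>
    have ih := ih (fun i j => D i.castSucc j.castSucc)
      (fun i j => E i.castSucc j.castSucc)
      (fun i j h => h1 i.castSucc j.castSucc h) (fun i j h => h2 i.castSucc j.castSucc h)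
      (fun j => h3 j.castSucc)
    -- By `h2` and `h1`, the last row and column of `D` cancel against those of `E`, except for the
    -- two corner terms; `h3` identifies one of these with the corner term of the smaller sum.
    have hrow : ∑ j : Fin (n + 1), (-1 : k) ^ (n + 2 + (j : ℕ)) • D (Fin.last (n + 2)) j.castSucc +
        ∑ j : Fin (n + 1), (-1 : k) ^ (n + 1 + (j : ℕ)) • E (Fin.last (n + 1)) j = 0 := by
      rw [← Finset.sum_add_distrib]
      refine Finset.sum_eq_zero fun j _ => ?_
      rw [← Fin.succ_last, h2 _ _ (Fin.castSucc_lt_last j),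
        show n + 2 + (j : ℕ) = n + 1 + j + 1 by ring, pow_succ, mul_neg_one, neg_smul,
        neg_add_cancel]
    have hcol : ∑ i : Fin (n + 1), (-1 : k) ^ ((i : ℕ) + (n + 1)) •
          D i.castSucc.castSucc (Fin.last (n + 1)) +
        ∑ i : Fin (n + 1), (-1 : k) ^ ((i : ℕ) + n) • E i.castSucc (Fin.last n) = 0 := by
      rw [← Finset.sum_add_distrib]
      refine Finset.sum_eq_zero fun i _ => ?_
      rw [← Fin.succ_last n, h1 i.castSucc (Fin.last n)
        (Fin.castSucc_le_castSucc_iff.mpr (Fin.le_last i)), ← add_assoc, pow_succ, mul_neg_one,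
        neg_smul, neg_add_cancel]
    have hmid : D (Fin.last (n + 1)).castSucc (Fin.last (n + 1)) =
      D (Fin.last (n + 1)).castSucc (Fin.last n).castSucc := h3 (Fin.last n)
    have hD : ∑ i : Fin (n + 3), ∑ j : Fin (n + 2), (-1 : k) ^ ((i : ℕ) + (j : ℕ)) • D i j =
        ∑ i : Fin (n + 2), ∑ j : Fin (n + 1),
          (-1 : k) ^ ((i : ℕ) + (j : ℕ)) • D i.castSucc j.castSucc +
        (∑ i : Fin (n + 1), (-1 : k) ^ ((i : ℕ) + (n + 1)) •
          D i.castSucc.castSucc (Fin.last (n + 1)) +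
          D (Fin.last (n + 1)).castSucc (Fin.last (n + 1))) +
        (∑ j : Fin (n + 1), (-1 : k) ^ (n + 2 + (j : ℕ)) • D (Fin.last (n + 2)) j.castSucc -
          D (Fin.last (n + 2)) (Fin.last (n + 1))) := by
      have h (i : Fin (n + 2)) : ∑ j : Fin (n + 2),
          (-1 : k) ^ ((i.castSucc : ℕ) + (j : ℕ)) • D i.castSucc j =
          ∑ j : Fin (n + 1), (-1 : k) ^ ((i : ℕ) + (j : ℕ)) • D i.castSucc j.castSucc +
            (-1 : k) ^ ((i : ℕ) + (n + 1)) • D i.castSucc (Fin.last (n + 1)) :=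
        Fin.sum_univ_castSucc _
      rw [Fin.sum_univ_castSucc (n := n + 2)]
      simp only [h]
      rw [Finset.sum_add_distrib, Fin.sum_univ_castSucc
          (fun i : Fin (n + 2) => (-1 : k) ^ ((i : ℕ) + (n + 1)) • D i.castSucc (Fin.last (n + 1))),
        Fin.sum_univ_castSucc (fun j : Fin (n + 2) =>
          (-1 : k) ^ (((Fin.last (n + 2) : Fin (n + 3)) : ℕ) + (j : ℕ)) • D (Fin.last (n + 2)) j)]
      simp only [Fin.val_castSucc, Fin.val_last]
      rw [Even.neg_one_pow (n := n + 1 + (n + 1)) ⟨_, rfl⟩,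
        Odd.neg_one_pow (n := n + 2 + (n + 1)) ⟨n + 1, by ring⟩, one_smul, neg_smul, one_smul,
        sub_eq_add_neg]
    have hE : ∑ i : Fin (n + 2), ∑ j : Fin (n + 1), (-1 : k) ^ ((i : ℕ) + (j : ℕ)) • E i j =
        ∑ i : Fin (n + 1), ∑ j : Fin n,
          (-1 : k) ^ ((i : ℕ) + (j : ℕ)) • E i.castSucc j.castSucc +
        ∑ i : Fin (n + 1), (-1 : k) ^ ((i : ℕ) + n) • E i.castSucc (Fin.last n) +
        ∑ j : Fin (n + 1), (-1 : k) ^ (n + 1 + (j : ℕ)) • E (Fin.last (n + 1)) j := by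
      have h (i : Fin (n + 1)) : ∑ j : Fin (n + 1),
          (-1 : k) ^ ((i.castSucc : ℕ) + (j : ℕ)) • E i.castSucc j =
          ∑ j : Fin n, (-1 : k) ^ ((i : ℕ) + (j : ℕ)) • E i.castSucc j.castSucc +
            (-1 : k) ^ ((i : ℕ) + n) • E i.castSucc (Fin.last n) :=
        Fin.sum_univ_castSucc _
      rw [Fin.sum_univ_castSucc (n := n + 1)]
      simp only [h]
      rw [Finset.sum_add_distrib]
      rfl
    have ih' := ih
    simp only [Fin.castSucc_zero] at ih'
    rw [hD, hE, hmid]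
    linear_combination (norm := module) ih' + hrow + hcol

end Combinatorics

/-- `(g_0, …, g_m), a ↦ (g_0, …, g_i, a, …, a)`. -/
def fillTuple {G : Type*} {m : ℕ} (i : Fin (m + 1)) (g : Fin (m + 1) → G) (a : G) :
    Fin (m + 2) → G :=
  fun l => if h : (l : ℕ) ≤ i then g ⟨l, lt_of_le_of_lt h i.2⟩ else a

section Fill

variable {G : Type*} {m : ℕ} (g : Fin (m + 1) → G) (a : G)

theorem fillTuple_mul [Mul G] (i : Fin (m + 1)) (γ : G) :
    fillTuple i (fun l => γ * g l) (γ * a) = fun l => γ * fillTuple i g a l := by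
  funext l
  simp only [fillTuple]
  split_ifs <;> rfl

theorem fillTuple_zero : fillTuple 0 g a ∘ (0 : Fin (m + 2)).succAbove = fun _ => a := by
  funext l
  simp [fillTuple]

theorem fillTuple_last : fillTuple (Fin.last m) g a ∘ (Fin.last (m + 1)).succAbove = g := by
  funext l
  simp [fillTuple, Fin.succAbove_last, Nat.le_of_lt_succ l.2]

theorem fillTuple_mid (j : Fin m) : fillTuple j.succ g a ∘ j.succ.castSucc.succAbove =
    fillTuple j.castSucc g a ∘ j.castSucc.succ.succAbove := by
  funext l
  simp only [fillTuple, Function.comp_apply, val_succAbove, Fin.val_succ, Fin.val_castSucc]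
  grind

theorem fillTuple_of_le (g : Fin (m + 2) → G) (i : Fin (m + 2)) (j : Fin (m + 1))
    (h : i ≤ j.castSucc) : fillTuple j.succ g a ∘ i.castSucc.succAbove =
      fillTuple j (g ∘ i.succAbove) a := by
  rw [Fin.le_def, Fin.val_castSucc] at h
  funext l
  simp only [fillTuple, Function.comp_apply, val_succAbove, Fin.val_succ, Fin.val_castSucc]
  have (l : Fin (m + 1)) : i.succAbove l = ⟨if (l : ℕ) < i then (l : ℕ) else l + 1, by
    split_ifs <;> omega⟩ := Fin.ext (val_succAbove i l)
  simp only [this]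
  grind

theorem fillTuple_of_lt (g : Fin (m + 2) → G) (i : Fin (m + 2)) (j : Fin (m + 1))
    (h : j.castSucc < i) : fillTuple j.castSucc g a ∘ i.succ.succAbove =
      fillTuple j (g ∘ i.succAbove) a := by
  rw [Fin.lt_def, Fin.val_castSucc] at h
  funext l
  simp only [fillTuple, Function.comp_apply, val_succAbove, Fin.val_succ, Fin.val_castSucc]
  have (l : Fin (m + 1)) : i.succAbove l = ⟨if (l : ℕ) < i then (l : ℕ) else l + 1, by
    split_ifs <;> omega⟩ := Fin.ext (val_succAbove i l)
  simp only [this]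
  grind

end Fill

section Lift

variable {k : Type u} [CommRing k] {G : Type w} [Group G]
  {V Z : Type*} [AddCommGroup V] [Module k V] [AddCommGroup Z] [Module k Z]

/-- The map out of `V ⊗ k[I]` with values `Φ i x` on `x ⊗ i`. -/
def tensorFreeLift {I : Type*} (Φ : I → V →ₗ[k] Z) : V ⊗[k] (I →₀ k) →ₗ[k] Z :=
  TensorProduct.lift (LinearMap.flip (Finsupp.linearCombination k Φ))

theorem tensorFreeLift_tmul {I : Type*} (Φ : I → V →ₗ[k] Z) (x : V) (i : I) :
    tensorFreeLift Φ (x ⊗ₜ Finsupp.single i 1) = Φ i x := by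
  simp [tensorFreeLift]

/-- The map out of `V ⊗_{kG} C_q(G)` with values `Φ h x` on `x ⊗ h`. -/
def balancedLift (ρ : Representation k G V) {q : ℕ} (Φ : (Fin (q + 1) → G) → V →ₗ[k] Z)
    (hΦ : ∀ γ h x, Φ (fun j => γ * h j) (ρ γ x) = Φ h x) : Balanced ρ (tupleRep k G q) →ₗ[k] Z :=
  (balancedRel ρ (tupleRep k G q)).liftQ (tensorFreeLift Φ) (by
    rw [balancedRel, Submodule.span_le]
    rintro _ ⟨γ, x, y, rfl⟩
    rw [SetLike.mem_coe, LinearMap.mem_ker, map_sub, sub_eq_zero]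
    suffices h : tensorFreeLift Φ ∘ₗ TensorProduct.map (ρ γ⁻¹) LinearMap.id =
        tensorFreeLift Φ ∘ₗ TensorProduct.map LinearMap.id (tupleRep k G q γ) from
      LinearMap.congr_fun h (x ⊗ₜ y)
    refine tmul_single_ext fun x h => ?_
    rw [LinearMap.comp_apply, LinearMap.comp_apply, TensorProduct.map_tmul, TensorProduct.map_tmul,
      tupleRep_single, LinearMap.id_apply, LinearMap.id_apply, tensorFreeLift_tmul,
      tensorFreeLift_tmul, ← hΦ γ, ← Module.End.mul_apply, ← map_mul, mul_inv_cancel, map_one,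
      Module.End.one_apply])

theorem balancedLift_mk (ρ : Representation k G V) {q : ℕ} (Φ : (Fin (q + 1) → G) → V →ₗ[k] Z)
    (hΦ : ∀ γ h x, Φ (fun j => γ * h j) (ρ γ x) = Φ h x) (x : V) (h : Fin (q + 1) → G) :
    balancedLift ρ Φ hΦ (Submodule.Quotient.mk (x ⊗ₜ Finsupp.single h 1)) = Φ h x :=
  (Submodule.liftQ_apply _ _ _).trans (tensorFreeLift_tmul Φ x h)

variable {V' : Type*} [AddCommGroup V'] [Module k V'] (ρ : Representation k G V)
  (ρ' : Representation k G V') {m m' : ℕ}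

/-- The class of `(x ⊗ g) ⊗ h`, as a function of `x`. -/
def mkTuple (q : ℕ) (g : Fin (m + 1) → G) (h : Fin (q + 1) → G) :
    V →ₗ[k] Balanced (ρ.tprod (tupleRep k G m)) (tupleRep k G q) :=
  (balancedRel (ρ.tprod (tupleRep k G m)) (tupleRep k G q)).mkQ ∘ₗ
    (TensorProduct.mk k _ _).flip (Finsupp.single h 1) ∘ₗ
      (TensorProduct.mk k _ _).flip (Finsupp.single g 1)

theorem mkTuple_apply (q : ℕ) (g : Fin (m + 1) → G) (h : Fin (q + 1) → G) (x : V) :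
    mkTuple ρ q g h x =
      Submodule.Quotient.mk ((x ⊗ₜ Finsupp.single g 1) ⊗ₜ Finsupp.single h 1) := rfl

theorem mkTuple_mul (q : ℕ) (g : Fin (m + 1) → G) (h : Fin (q + 1) → G) (γ : G) (x : V) :
    mkTuple ρ q (fun j => γ * g j) (fun j => γ * h j) (ρ γ x) = mkTuple ρ q g h x := by
  have := mk_balanced_eq (ρ.tprod (tupleRep k G m)) (tupleRep k G q) γ
    (x ⊗ₜ Finsupp.single g 1) (Finsupp.single h 1)
  rwa [Representation.tprod_apply, TensorProduct.map_tmul, tupleRep_single, tupleRep_single] at this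

/-- The map `(x ⊗ g) ⊗ h ↦ (f x ⊗ τ g h_0) ⊗ h`. -/
def coneMap (q : ℕ) (f : V →ₗ[k] V') (hf : ∀ g, ρ' g ∘ₗ f = f ∘ₗ ρ g)
    (τ : (Fin (m + 1) → G) → G → Fin (m' + 1) → G)
    (hτ : ∀ g a γ, τ (fun l => γ * g l) (γ * a) = fun l => γ * τ g a l) :
    Balanced (ρ.tprod (tupleRep k G m)) (tupleRep k G q) →ₗ[k]
      Balanced (ρ'.tprod (tupleRep k G m')) (tupleRep k G q) :=
  balancedLift _ (fun h => tensorFreeLift fun g => mkTuple ρ' q (τ g (h 0)) h ∘ₗ f)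
    fun γ h z => by
      suffices h : tensorFreeLift (fun g => mkTuple ρ' q (τ g (γ * h 0)) (fun j => γ * h j) ∘ₗ f) ∘ₗ
          (ρ.tprod (tupleRep k G m)) γ =
            tensorFreeLift fun g => mkTuple ρ' q (τ g (h 0)) h ∘ₗ f from
        LinearMap.congr_fun h z
      refine tmul_single_ext fun x g => ?_
      rw [LinearMap.comp_apply, Representation.tprod_apply, TensorProduct.map_tmul,
        tupleRep_single, tensorFreeLift_tmul, tensorFreeLift_tmul, hτ, LinearMap.comp_apply,
        LinearMap.comp_apply, ← LinearMap.comp_apply f, ← hf, LinearMap.comp_apply, mkTuple_mul]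

theorem coneMap_mkTuple (q : ℕ) (f : V →ₗ[k] V') (hf : ∀ g, ρ' g ∘ₗ f = f ∘ₗ ρ g)
    (τ : (Fin (m + 1) → G) → G → Fin (m' + 1) → G)
    (hτ : ∀ g a γ, τ (fun l => γ * g l) (γ * a) = fun l => γ * τ g a l)
    (g : Fin (m + 1) → G) (h : Fin (q + 1) → G) (x : V) :
    coneMap ρ ρ' q f hf τ hτ (mkTuple ρ q g h x) = mkTuple ρ' q (τ g (h 0)) h (f x) := by
  rw [mkTuple_apply, coneMap, balancedLift_mk, tensorFreeLift_tmul, LinearMap.comp_apply]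

variable (m) in
/-- The map `x ⊗ h ↦ (x ⊗ (h_0, …, h_0)) ⊗ h`. -/
def constMap (q : ℕ) : Balanced ρ (tupleRep k G q) →ₗ[k]
    Balanced (ρ.tprod (tupleRep k G m)) (tupleRep k G q) :=
  balancedLift ρ (fun h => mkTuple ρ q (fun _ => h 0) h) fun γ h x => mkTuple_mul ρ q _ h γ x

theorem constMap_mk (q : ℕ) (h : Fin (q + 1) → G) (x : V) :
    constMap ρ m q (Submodule.Quotient.mk (x ⊗ₜ Finsupp.single h 1)) =
      mkTuple ρ q (fun _ => h 0) h x := balancedLift_mk _ _ _ _ _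

end Lift

theorem CyclicModule.b_apply {k : Type u} [CommRing k] (M : CyclicModule.{u, v} k) (n : ℕ)
    (x : M.X (n + 1)) : M.b n x = ∑ i : Fin (n + 2), (-1 : k) ^ (i : ℕ) • M.d n i x := by
  rw [CyclicModule.b, LinearMap.sum_apply]
  rfl

section RowContraction

variable {k : Type u} [CommRing k] {G : Type w} [Group G] (M : CyclicRep.{u, v, w} k G) (q m : ℕ)

/-- The Hochschild boundary of the row `(M ♮ G) ⊗_{kG} C_q(G)`. -/
def rowB : Balanced ((M.ρ (m + 1)).tprod (tupleRep k G (m + 1))) (tupleRep k G q) →ₗ[k]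
    Balanced ((M.ρ m).tprod (tupleRep k G m)) (tupleRep k G q) :=
  ((M.tensor (groupRep k G)).balanced (tupleRep k G q)).b m

theorem rowB_mkTuple (g : Fin (m + 2) → G) (h : Fin (q + 1) → G) (x : M.X (m + 1)) :
    rowB M q m (mkTuple (M.ρ (m + 1)) q g h x) =
      ∑ i : Fin (m + 2), (-1 : k) ^ (i : ℕ) •
        mkTuple (M.ρ m) q (g ∘ i.succAbove) h (M.d m i x) := by
  have h1 (i : Fin (m + 2)) : ((M.tensor (groupRep k G)).balanced (tupleRep k G q)).d m i
      (mkTuple (M.ρ (m + 1)) q g h x) = mkTuple (M.ρ m) q (g ∘ i.succAbove) h (M.d m i x) :=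
    congrArg (fun y : (Fin (m + 1) → G) →₀ k => (balancedRel ((M.ρ m).tprod (tupleRep k G m))
      (tupleRep k G q)).mkQ ((M.d m i x ⊗ₜ[k] y) ⊗ₜ[k] Finsupp.single h 1))
      (Finsupp.mapDomain_single (f := fun g : Fin (m + 2) → G => g ∘ i.succAbove))
  exact (CyclicModule.b_apply _ m _).trans (Finset.sum_congr rfl fun i _ =>
    congrArg (HSMul.hSMul ((-1 : k) ^ (i : ℕ))) (h1 i))

/-- The `j`-th map `(x ⊗ g) ⊗ h ↦ (s_j x ⊗ (g_0, …, g_j, h_0, …, h_0)) ⊗ h` of the simplicial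
homotopy coning off to `h_0`. -/
def rowCone (j : Fin (m + 1)) : Balanced ((M.ρ m).tprod (tupleRep k G m)) (tupleRep k G q) →ₗ[k]
    Balanced ((M.ρ (m + 1)).tprod (tupleRep k G (m + 1))) (tupleRep k G q) :=
  coneMap (M.ρ m) (M.ρ (m + 1)) q (M.s m j) (fun g => M.ρ_s g m j) (fillTuple j)
    fun g a γ => fillTuple_mul g a j γ

/-- The contracting homotopy of the row `(M ♮ G) ⊗_{kG} C_q(G)` onto `M ⊗_{kG} C_q(G)`. The sign is
negative because the simplicial homotopy runs from the cone map at `i = j = 0` to the identity at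
the last indices. -/
def rowHomotopy : Balanced ((M.ρ m).tprod (tupleRep k G m)) (tupleRep k G q) →ₗ[k]
    Balanced ((M.ρ (m + 1)).tprod (tupleRep k G (m + 1))) (tupleRep k G q) :=
  -∑ j : Fin (m + 1), (-1 : k) ^ (j : ℕ) • rowCone M q m j

theorem rowHomotopy_mkTuple (g : Fin (m + 1) → G) (h : Fin (q + 1) → G) (x : M.X m) :
    rowHomotopy M q m (mkTuple (M.ρ m) q g h x) =
      -∑ j : Fin (m + 1), (-1 : k) ^ (j : ℕ) •
        mkTuple (M.ρ (m + 1)) q (fillTuple j g (h 0)) h (M.s m j x) := by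
  rw [rowHomotopy, LinearMap.neg_apply, LinearMap.sum_apply]
  refine congrArg _ (Finset.sum_congr rfl fun j _ => ?_)
  rw [LinearMap.smul_apply, rowCone, coneMap_mkTuple]

theorem rowB_rowHomotopy_mkTuple (g : Fin (m + 1) → G) (h : Fin (q + 1) → G) (x : M.X m) :
    rowB M q m (rowHomotopy M q m (mkTuple (M.ρ m) q g h x)) =
      -∑ i : Fin (m + 2), ∑ j : Fin (m + 1), (-1 : k) ^ ((i : ℕ) + (j : ℕ)) •
        mkTuple (M.ρ m) q (fillTuple j g (h 0) ∘ i.succAbove) h (M.d m i (M.s m j x)) := by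
  rw [rowHomotopy_mkTuple, map_neg, map_sum, Finset.sum_comm]
  refine congrArg _ (Finset.sum_congr rfl fun j _ => ?_)
  rw [map_smul, rowB_mkTuple, Finset.smul_sum]
  exact Finset.sum_congr rfl fun i _ => by rw [smul_smul, ← pow_add, add_comm (j : ℕ) (i : ℕ)]

theorem rowHomotopy_rowB_mkTuple (g : Fin (m + 2) → G) (h : Fin (q + 1) → G) (x : M.X (m + 1)) :
    rowHomotopy M q m (rowB M q m (mkTuple (M.ρ (m + 1)) q g h x)) =
      -∑ i : Fin (m + 2), ∑ j : Fin (m + 1), (-1 : k) ^ ((i : ℕ) + (j : ℕ)) •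
        mkTuple (M.ρ (m + 1)) q (fillTuple j (g ∘ i.succAbove) (h 0)) h (M.s m j (M.d m i x)) := by
  rw [rowB_mkTuple, map_sum, ← Finset.sum_neg_distrib]
  refine Finset.sum_congr rfl fun i _ => ?_
  rw [map_smul, rowHomotopy_mkTuple, smul_neg, Finset.smul_sum]
  exact congrArg _ (Finset.sum_congr rfl fun j _ => by rw [smul_smul, ← pow_add])

/-- The map `(M ♮ G) ⊗_{kG} C_q(G) → M ⊗_{kG} C_q(G)` forgetting the second factor of `M ♮ G`. -/
def rowForget : Balanced ((M.ρ m).tprod (tupleRep k G m)) (tupleRep k G q) →ₗ[k]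
    Balanced (M.ρ m) (tupleRep k G q) :=
  balancedMap _ _ _ _ (forgetTuple k (M.X m) (Fin (m + 1) → G)) LinearMap.id
    (fun g => (forgetTuple_comm k (M.ρ m g) _).symm) fun _ => rfl

theorem rowForget_mkTuple (g : Fin (m + 1) → G) (h : Fin (q + 1) → G) (x : M.X m) :
    rowForget M q m (mkTuple (M.ρ m) q g h x) =
      Submodule.Quotient.mk (x ⊗ₜ Finsupp.single h 1) := by
  refine congrArg (fun y => Submodule.Quotient.mk (y ⊗ₜ[k] Finsupp.single h 1)) ?_
  refine (forgetTuple_tmul _ _).trans ?_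
  rw [Finsupp.linearCombination_single, smul_eq_mul, mul_one, one_smul]

theorem rowForget_constMap : rowForget M q m ∘ₗ constMap (M.ρ m) m q = LinearMap.id :=
  balanced_ext fun x h => by rw [LinearMap.comp_apply, constMap_mk, rowForget_mkTuple]; rfl

theorem rowB_rowHomotopy_zero : rowB M q 0 ∘ₗ rowHomotopy M q 0 =
    LinearMap.id - constMap (M.ρ 0) 0 q ∘ₗ rowForget M q 0 := by
  refine balanced_tuple_ext fun x g h => ?_
  rw [← mkTuple_apply, LinearMap.comp_apply, LinearMap.sub_apply, LinearMap.comp_apply,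
    rowB_rowHomotopy_mkTuple, rowForget_mkTuple, constMap_mk, LinearMap.id_apply]
  have key := sum_simplicial_homotopy (k := k) 0 (fun i j =>
    mkTuple (M.ρ 0) q (fillTuple j g (h 0) ∘ i.succAbove) h (M.d 0 i (M.s 0 j x)))
    (fun _ j => j.elim0) (fun _ j => j.elim0) (fun _ j => j.elim0) (fun j => j.elim0)
  have h0 := LinearMap.congr_fun (M.d_s_self 0 0) x
  have h1 := LinearMap.congr_fun (M.d_s_succ 0 (Fin.last 0)) x
  rw [LinearMap.comp_apply, Fin.castSucc_zero, LinearMap.id_apply] at h0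
  rw [LinearMap.comp_apply, Fin.succ_last, LinearMap.id_apply] at h1
  rw [fillTuple_zero, fillTuple_last, h0, h1] at key
  simp only [Finset.univ_eq_empty (α := Fin 0), Finset.sum_empty, Finset.sum_const_zero,
    add_zero] at key
  rw [key, neg_sub]

theorem rowB_rowHomotopy_succ :
    rowB M q (m + 1) ∘ₗ rowHomotopy M q (m + 1) + rowHomotopy M q m ∘ₗ rowB M q m =
      LinearMap.id - constMap (M.ρ (m + 1)) (m + 1) q ∘ₗ rowForget M q (m + 1) := by
  refine balanced_tuple_ext fun x g h => ?_
  rw [← mkTuple_apply, LinearMap.add_apply, LinearMap.comp_apply, LinearMap.comp_apply,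
    LinearMap.sub_apply, LinearMap.comp_apply, rowB_rowHomotopy_mkTuple, rowHomotopy_rowB_mkTuple,
    rowForget_mkTuple, constMap_mk, LinearMap.id_apply]
  have key := sum_simplicial_homotopy (k := k) (m + 1) (fun i j =>
    mkTuple (M.ρ (m + 1)) q (fillTuple j g (h 0) ∘ i.succAbove) h
      (M.d (m + 1) i (M.s (m + 1) j x)))
    (fun i j => mkTuple (M.ρ (m + 1)) q (fillTuple j (g ∘ i.succAbove) (h 0)) h
      (M.s m j (M.d m i x)))
    (fun i j hij => by
      rw [fillTuple_of_le _ _ _ _ hij, ← LinearMap.comp_apply (M.d _ _), M.d_s_lt _ _ _ hij]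
      rfl)
    (fun i j hij => by
      rw [fillTuple_of_lt _ _ _ _ hij, ← LinearMap.comp_apply (M.d _ _), M.d_s_gt _ _ _ hij]
      rfl)
    (fun j => by
      rw [fillTuple_mid, ← LinearMap.comp_apply (M.d _ _), M.d_s_self,
        ← LinearMap.comp_apply (M.d _ _), M.d_s_succ])
  have h0 := LinearMap.congr_fun (M.d_s_self (m + 1) 0) x
  have h1 := LinearMap.congr_fun (M.d_s_succ (m + 1) (Fin.last (m + 1))) x
  rw [LinearMap.comp_apply, Fin.castSucc_zero, LinearMap.id_apply] at h0
  rw [LinearMap.comp_apply, Fin.succ_last, LinearMap.id_apply] at h1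
  rw [fillTuple_zero, fillTuple_last, h0, h1] at key
  rw [← neg_add, key, neg_sub]

theorem rowForget_rowHomotopy (z) (hz : rowForget M q m z = 0) :
    rowForget M q (m + 1) (rowHomotopy M q m z) = 0 := by
  have key : rowForget M q (m + 1) ∘ₗ rowHomotopy M q m =
      balancedMap (M.ρ m) (tupleRep k G q) (M.ρ (m + 1)) (tupleRep k G q)
        (-∑ j : Fin (m + 1), (-1 : k) ^ (j : ℕ) • M.s m j) LinearMap.id
        (fun g => by
          rw [LinearMap.comp_neg, LinearMap.neg_comp, lcomp_sum, sum_lcomp]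
          refine congrArg _ (Finset.sum_congr rfl fun j _ => ?_)
          rw [LinearMap.comp_smul, LinearMap.smul_comp, M.ρ_s]) (fun _ => rfl) ∘ₗ
        rowForget M q m := by
    refine balanced_tuple_ext fun x g h => ?_
    rw [← mkTuple_apply, LinearMap.comp_apply, LinearMap.comp_apply, rowForget_mkTuple,
      rowHomotopy_mkTuple, map_neg, map_sum]
    simp only [map_smul, rowForget_mkTuple]
    refine Eq.trans ?_ (congrArg (fun y => Submodule.Quotient.mk (y ⊗ₜ[k] Finsupp.single h 1))
      (show -∑ j : Fin (m + 1), (-1 : k) ^ (j : ℕ) • M.s m j x = _ by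
        rw [LinearMap.neg_apply, LinearMap.sum_apply]; rfl))
    rw [TensorProduct.neg_tmul, TensorProduct.sum_tmul, Submodule.Quotient.mk_neg,
      ← Submodule.mkQ_apply, map_sum]
    rfl
  have h := LinearMap.congr_fun key z
  rwa [LinearMap.comp_apply, LinearMap.comp_apply, hz, map_zero] at h

theorem rowB_rowHomotopy_zero_of_rowForget (z) (hz : rowForget M q 0 z = 0) :
    rowB M q 0 (rowHomotopy M q 0 z) = z := by
  have h := LinearMap.congr_fun (rowB_rowHomotopy_zero M q) z
  rwa [LinearMap.sub_apply, LinearMap.comp_apply, LinearMap.comp_apply, hz, map_zero, sub_zero] at h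

theorem rowB_rowHomotopy_succ_of_rowForget (z) (hz : rowForget M q (m + 1) z = 0) :
    rowB M q (m + 1) (rowHomotopy M q (m + 1) z) + rowHomotopy M q m (rowB M q m z) = z := by
  have h := LinearMap.congr_fun (rowB_rowHomotopy_succ M q m) z
  rwa [LinearMap.sub_apply, LinearMap.comp_apply, hz, map_zero, sub_zero] at h

end RowContraction

theorem balancedDelta_balancedDelta {k : Type u} [CommRing k] {G : Type w} [Group G] {V : Type v}
    [AddCommGroup V] [Module k V] (ρ : Representation k G V) (q : ℕ) :
    balancedDelta ρ q ∘ₗ balancedDelta ρ (q + 1) = 0 :=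
  balanced_zero fun y y' => groupDoubleAux ρ q y y'

/-- Forgetting the `G`-tuples, `C_•(G; CC F (A ♮ G)) → C_•(G; CC F A^♮)`, is a quasi-isomorphism. -/
theorem quasiIso_completedForget {k : Type u} [CommRing k] {A : Type v} [Ring A] [Algebra k A]
    {G : Type w} [Group G] [MulSemiringAction G A] [SMulCommClass G k A] (F : Flavour) :
    QuasiIso (completedForget k A G F) :=
  quasiIso_rowDoubleHom (F := F)
    (D := fun q => (algGroup k A G).balanced (tupleRep k G q))
    (E := fun q => (algRep k A G).balanced (tupleRep k G q))
    (δ := fun q => balancedB (algGroup k A G) q) (ε := fun q => balancedB (algRep k A G) q)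
    (hδ := fun q m => balancedDelta_balancedDelta ((algGroup k A G).ρ m) q)
    (hε := fun q m => balancedDelta_balancedDelta ((algRep k A G).ρ m) q)
    (fun q => balancedHom (forgetGroup k A G) (tupleRep k G q) (tupleRep k G q) LinearMap.id
      fun _ => rfl)
    (fun _ _ => Submodule.linearMap_qext _ (TensorProduct.ext' fun _ _ => rfl))
    (fun q m => constMap ((algRep k A G).ρ m) m q)
    (fun q m => LinearMap.congr_fun (rowForget_constMap (algRep k A G) q m))
    (fun q m => rowHomotopy (algRep k A G) q m)
    (fun q m => rowForget_rowHomotopy (algRep k A G) q m)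
    (fun q => rowB_rowHomotopy_zero_of_rowForget (algRep k A G) q)
    (fun q m => rowB_rowHomotopy_succ_of_rowForget (algRep k A G) q m)

/-! ### The homogeneous summand as coinvariants -/

section Generators

variable {k : Type u} [CommRing k] {M : CyclicModule.{u, v} k} {N : CyclicModule.{u, w} k}

theorem CyclicModule.t_injective (n : ℕ) : Function.Injective (M.t n) := by
  have h (x : M.X n) : (M.t n ^ n) (M.t n x) = x := by
    rw [← Module.End.mul_apply, ← pow_succ, M.t_pow, Module.End.one_apply]
  exact Function.LeftInverse.injective h

/-- Linear maps that commute with the rotations, the zeroth faces and the zeroth degeneracies form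
a morphism of cyclic modules, because the other structure maps are conjugates of these under the
rotations. -/
def CyclicHom.ofZero (f : ∀ n, M.X n →ₗ[k] N.X n)
    (hd : ∀ n x, f n (M.d n 0 x) = N.d n 0 (f (n + 1) x))
    (hs : ∀ n x, f (n + 1) (M.s n 0 x) = N.s n 0 (f n x))
    (ht : ∀ n x, f n (M.t n x) = N.t n (f n x)) : CyclicHom M N where
  f := f
  comm_d n i := LinearMap.ext <| by
    induction i using Fin.induction with
    | zero => exact hd n
    | succ i ih =>
      refine fun x => N.t_injective n ?_
      have h1 := LinearMap.congr_fun (M.d_t n i) x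
      have h2 := LinearMap.congr_fun (N.d_t n i) (f (n + 1) x)
      have h3 := ih (M.t (n + 1) x)
      simp only [LinearMap.comp_apply] at h1 h2 h3 ⊢
      rw [← ht, ← h1, h3, ht, h2]
  comm_s n i := LinearMap.ext <| by
    induction i using Fin.induction with
    | zero => exact hs n
    | succ i ih =>
      refine fun x => N.t_injective (n + 1) ?_
      have h1 := LinearMap.congr_fun (M.s_t n i) x
      have h2 := LinearMap.congr_fun (N.s_t n i) (f n x)
      have h3 := ih (M.t n x)
      simp only [LinearMap.comp_apply] at h1 h2 h3 ⊢
      rw [← ht, ← h1, h3, ht, h2]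
  comm_t n := LinearMap.ext (ht n)

/-- The inverse of a bijective morphism of cyclic modules. -/
def CyclicHom.inverse (φ : CyclicHom M N) (h : ∀ n, Function.Bijective (φ.f n)) :
    CyclicHom N M where
  f n := (LinearEquiv.ofBijective (φ.f n) (h n)).symm
  comm_d n i := LinearMap.ext fun x => (h n).1 <| by
    have h1 := LinearMap.congr_fun (φ.comm_d n i) ((LinearEquiv.ofBijective _ (h (n + 1))).symm x)
    have h2 := LinearEquiv.apply_symm_apply (LinearEquiv.ofBijective _ (h (n + 1))) x
    have h3 := LinearEquiv.apply_symm_apply (LinearEquiv.ofBijective _ (h n)) (N.d n i x)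
    rw [LinearEquiv.ofBijective_apply] at h2 h3
    simp only [LinearMap.comp_apply, LinearEquiv.coe_coe] at h1 ⊢
    rw [h3, h1, h2]
  comm_s n i := LinearMap.ext fun x => (h (n + 1)).1 <| by
    have h1 := LinearMap.congr_fun (φ.comm_s n i) ((LinearEquiv.ofBijective _ (h n)).symm x)
    have h2 := LinearEquiv.apply_symm_apply (LinearEquiv.ofBijective _ (h n)) x
    have h3 := LinearEquiv.apply_symm_apply (LinearEquiv.ofBijective _ (h (n + 1))) (N.s n i x)
    rw [LinearEquiv.ofBijective_apply] at h2 h3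
    simp only [LinearMap.comp_apply, LinearEquiv.coe_coe] at h1 ⊢
    rw [h3, h1, h2]
  comm_t n := LinearMap.ext fun x => (h n).1 <| by
    have h1 := LinearMap.congr_fun (φ.comm_t n) ((LinearEquiv.ofBijective _ (h n)).symm x)
    have h2 := LinearEquiv.apply_symm_apply (LinearEquiv.ofBijective _ (h n)) x
    have h3 := LinearEquiv.apply_symm_apply (LinearEquiv.ofBijective _ (h n)) (N.t n x)
    rw [LinearEquiv.ofBijective_apply] at h2 h3
    simp only [LinearMap.comp_apply, LinearEquiv.coe_coe] at h1 ⊢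
    rw [h3, h1, h2]

end Generators

section Differences

variable {G : Type w} [Group G] {n : ℕ}

theorem succ_sub_one (l : Fin n) : (l.succ - 1 : Fin (n + 1)) = l.castSucc := by
  rw [sub_eq_iff_eq_add, Fin.coeSucc_eq_succ]

theorem zero_sub_one : (0 - 1 : Fin (n + 1)) = Fin.last n := by
  rw [sub_eq_iff_eq_add, Fin.last_add_one]

/-- The cyclic differences `h_{j-1}⁻¹ h_j` of a tuple, where `h_{-1} = h_n`. -/
def differences (h : Fin (n + 1) → G) (j : Fin (n + 1)) : G := (h (j - 1))⁻¹ * h j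

theorem partialProd_differences_castSucc (h : Fin (n + 1) → G) (j : Fin (n + 1)) :
    Fin.partialProd (differences h) j.castSucc = (h (Fin.last n))⁻¹ * h (j - 1) := by
  induction j using Fin.induction with
  | zero => rw [Fin.castSucc_zero, Fin.partialProd_zero, zero_sub_one, inv_mul_cancel]
  | succ l ih =>
    rw [Fin.castSucc_succ, Fin.partialProd_succ, ih, differences, succ_sub_one, mul_assoc,
      mul_inv_cancel_left]

theorem partialProd_differences_succ (h : Fin (n + 1) → G) (j : Fin (n + 1)) :
    Fin.partialProd (differences h) j.succ = (h (Fin.last n))⁻¹ * h j := by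
  rw [Fin.partialProd_succ, partialProd_differences_castSucc, differences, mul_assoc,
    mul_inv_cancel_left]

theorem partialProd_last {M : Type*} [Monoid M] (g : Fin n → M) :
    Fin.partialProd g (Fin.last n) = (List.ofFn g).prod := by
  rw [Fin.partialProd, Fin.val_last, List.take_of_length_le (by simp)]

theorem prod_differences (h : Fin (n + 1) → G) : (List.ofFn (differences h)).prod = 1 := by
  rw [← partialProd_last, ← Fin.succ_last, partialProd_differences_succ, inv_mul_cancel]

theorem partialProd_succ_sub_one (g : Fin (n + 1) → G) (hg : (List.ofFn g).prod = 1)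
    (j : Fin (n + 1)) : Fin.partialProd g (j - 1).succ = Fin.partialProd g j.castSucc := by
  refine Fin.cases ?_ (fun l => ?_) j
  · rw [zero_sub_one, Fin.succ_last, partialProd_last, hg, Fin.castSucc_zero, Fin.partialProd_zero]
  · rw [succ_sub_one, Fin.castSucc_succ]

end Differences

section Theta

/-- Linear maps out of `(A ♮ G)([n])` are determined by their values on the elements
`(a_0 ⊗ … ⊗ a_n) ♮ (h_0 ⊗ … ⊗ h_n)`. -/
theorem algGroup_ext (k : Type u) [CommRing k] (A : Type v) [Ring A] [Algebra k A] (G : Type w)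
    {Z : Type*} [AddCommGroup Z] [Module k Z] {n : ℕ}
    {f f' : (⨂[k] _ : Fin (n + 1), A) ⊗[k] ((Fin (n + 1) → G) →₀ k) →ₗ[k] Z}
    (h : ∀ a h, f (PiTensorProduct.tprod k a ⊗ₜ Finsupp.single h 1) =
      f' (PiTensorProduct.tprod k a ⊗ₜ Finsupp.single h 1)) : f = f' := by
  refine TensorProduct.ext (PiTensorProduct.ext (MultilinearMap.ext fun a => ?_))
  ext i
  exact h a i

open Classical in
/-- The decomposition of `(A ⋊ G)^{⊗ (n+1)}` into copies of `A^{⊗ (n+1)}` indexed by tuples. -/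
def crossedCoeff (k : Type u) [CommRing k] (A : Type v) [Ring A] [Algebra k A] (G : Type w)
    (n : ℕ) : (⨂[k] _ : Fin (n + 1), SkewMonoidAlgebra A G) →ₗ[k]
    (Fin (n + 1) → G) →₀ ⨂[k] _ : Fin (n + 1), A :=
  PiTensorProduct.ofFinsuppEquiv.toLinearMap ∘ₗ
    PiTensorProduct.map fun _ => SkewMonoidAlgebra.coeffLinearEquiv.toLinearMap

open Classical in
theorem crossedCoeff_tprod (k : Type u) [CommRing k] (A : Type v) [Ring A] [Algebra k A]
    (G : Type w) {n : ℕ} (a : Fin (n + 1) → A) (g : Fin (n + 1) → G) :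
    crossedCoeff k A G n (PiTensorProduct.tprod k fun j => SkewMonoidAlgebra.single (g j) (a j)) =
      Finsupp.single g (PiTensorProduct.tprod k a) := by
  rw [crossedCoeff, LinearMap.comp_apply, PiTensorProduct.map_tprod]
  exact PiTensorProduct.ofFinsuppEquiv_tprod_single (R := k) g a

variable (k : Type u) [CommRing k] (A : Type v) [Ring A] [Algebra k A] (G : Type w) [Group G]
  [MulSemiringAction G A] [SMulCommClass G k A]

variable {G} in
/-- For fixed `h`, the map `a_0 ⊗ … ⊗ a_n ↦ ⨂_j h_{j-1}⁻¹(a_j) h_{j-1}⁻¹ h_j`. -/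
def differencesMap {n : ℕ} (h : Fin (n + 1) → G) :
    (⨂[k] _ : Fin (n + 1), A) →ₗ[k] (⨂[k] _ : Fin (n + 1), SkewMonoidAlgebra A G) :=
  PiTensorProduct.map fun j =>
    SkewMonoidAlgebra.lsingle k (differences h j) ∘ₗ DistribSMul.toLinearMap k A (h (j - 1))⁻¹

variable {G} in
theorem differencesMap_tprod {n : ℕ} (h : Fin (n + 1) → G) (a : Fin (n + 1) → A) :
    differencesMap k A h (PiTensorProduct.tprod k a) =
      PiTensorProduct.tprod k fun j =>
        SkewMonoidAlgebra.single (differences h j) ((h (j - 1))⁻¹ • a j) :=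
  PiTensorProduct.map_tprod _ _

/-- The map `(A ♮ G)([n]) → (A ⋊ G)^{⊗ (n+1)}` given by `differencesMap`. -/
def toCrossed (n : ℕ) : (⨂[k] _ : Fin (n + 1), A) ⊗[k] ((Fin (n + 1) → G) →₀ k) →ₗ[k]
    (⨂[k] _ : Fin (n + 1), SkewMonoidAlgebra A G) :=
  tensorFreeLift (differencesMap k A)

theorem toCrossed_tmul {n : ℕ} (a : Fin (n + 1) → A) (h : Fin (n + 1) → G) :
    toCrossed k A G n (PiTensorProduct.tprod k a ⊗ₜ Finsupp.single h 1) =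
      PiTensorProduct.tprod k fun j =>
        SkewMonoidAlgebra.single (differences h j) ((h (j - 1))⁻¹ • a j) := by
  rw [toCrossed, tensorFreeLift_tmul, differencesMap_tprod]

theorem toCrossed_mem (n : ℕ) (z) : toCrossed k A G n z ∈ homogeneousSpan k A G n := by
  suffices h : (homogeneousSpan k A G n).mkQ ∘ₗ toCrossed k A G n = 0 from
    (Submodule.Quotient.mk_eq_zero _).mp (LinearMap.congr_fun h z)
  exact algGroup_ext k A G fun a h => (Submodule.Quotient.mk_eq_zero _).mpr
    (Submodule.subset_span ⟨_, _, prod_differences h, toCrossed_tmul k A G a h⟩)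

theorem toCrossed_algAct (n : ℕ) (γ : G) :
    toCrossed k A G n ∘ₗ ((algAct k A G n).tprod (tupleRep k G n)) γ = toCrossed k A G n := by
  refine algGroup_ext k A G fun a h => ?_
  rw [LinearMap.comp_apply, Representation.tprod_apply, TensorProduct.map_tmul, tupleRep_single,
    algAct_tprod, toCrossed_tmul, toCrossed_tmul]
  congr 1
  funext j
  simp only [differences, mul_inv_rev, smul_smul, mul_assoc, inv_mul_cancel_left, inv_mul_cancel,
    mul_one]

theorem toCrossed_t (n : ℕ) : toCrossed k A G n ∘ₗ
    TensorProduct.map (tupleMap rotTuple (rot_update k A)) (Finsupp.lmapDomain k k rotTuple) =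
      tupleMap rotTuple (rot_update k (SkewMonoidAlgebra A G)) ∘ₗ toCrossed k A G n := by
  refine algGroup_ext k A G fun a h => ?_
  rw [LinearMap.comp_apply, LinearMap.comp_apply, TensorProduct.map_tmul, tupleMap_tprod,
    Finsupp.lmapDomain_apply, Finsupp.mapDomain_single, toCrossed_tmul, toCrossed_tmul,
    tupleMap_tprod]
  congr 1
  funext j
  simp only [differences, rotTuple, sub_add_cancel, add_sub_cancel_right]

theorem toCrossed_d (n : ℕ) : toCrossed k A G n ∘ₗ
    TensorProduct.map (tupleMap (faceTuple 0) (face_update k A 0))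
      (Finsupp.lmapDomain k k (fun g : Fin (n + 2) → G => g ∘ (0 : Fin (n + 2)).succAbove)) =
      tupleMap (faceTuple 0) (face_update k (SkewMonoidAlgebra A G) 0) ∘ₗ
        toCrossed k A G (n + 1) := by
  refine algGroup_ext k A G fun a h => ?_
  rw [LinearMap.comp_apply, LinearMap.comp_apply, TensorProduct.map_tmul, tupleMap_tprod,
    Finsupp.lmapDomain_apply, Finsupp.mapDomain_single, toCrossed_tmul, toCrossed_tmul,
    tupleMap_tprod]
  congr 1
  funext j
  have h0 : (0 : Fin (n + 2)) ≠ Fin.last (n + 1) := by simp [Fin.ext_iff]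
  refine Fin.cases ?_ (fun l => ?_) j
  · have h2 (n : ℕ) : (-1 : Fin (n + 1)) = Fin.last n := by rw [← zero_sub, zero_sub_one]
    simp [faceTuple, h0, differences, h2, SkewMonoidAlgebra.single_mul_single, smul_smul, mul_assoc]
  · simp only [faceTuple, h0, differences, succ_sub_one, Function.comp_apply,
      Fin.zero_succAbove, Fin.val_succ, Fin.val_zero, if_false, Nat.not_lt_zero,
      Nat.succ_ne_zero, Fin.succ_castSucc]

theorem degenTuple_zero {S : Type*} [One S] {n : ℕ} (a : Fin (n + 1) → S) :
    degenTuple 0 a = Fin.cons (a 0) (Fin.cons 1 fun l : Fin n => a l.succ) := by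
  refine ext_rd fun j hj => ?_
  rw [rd_degen _ _ _ hj]
  match j, hj with
  | 0, _ => simp [rd]
  | 1, _ => simp [rd]
  | j + 2, hj =>
    have h : j + 2 - 1 < n + 1 := by omega
    rw [if_neg (by simp), if_neg (by simp), rd, dif_pos h, rd, dif_pos hj]
    rfl

theorem toCrossed_s (n : ℕ) : toCrossed k A G (n + 1) ∘ₗ
    TensorProduct.map (tupleMap (degenTuple 0) (degen_update k A 0))
      (Finsupp.lmapDomain k k (fun g : Fin (n + 1) → G => g ∘ (0 : Fin (n + 1)).predAbove)) =
      tupleMap (degenTuple 0) (degen_update k (SkewMonoidAlgebra A G) 0) ∘ₗ toCrossed k A G n := by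
  refine algGroup_ext k A G fun a h => ?_
  rw [LinearMap.comp_apply, LinearMap.comp_apply, TensorProduct.map_tmul, tupleMap_tprod,
    Finsupp.lmapDomain_apply, Finsupp.mapDomain_single, toCrossed_tmul, toCrossed_tmul,
    tupleMap_tprod]
  congr 1
  rw [degenTuple_zero, degenTuple_zero]
  funext j
  refine Fin.cases ?_ (fun l => Fin.cases ?_ (fun l => ?_) l) j
  · simp only [differences, zero_sub_one, Function.comp_apply, Fin.cons_zero,
      Fin.predAbove_right_last, Fin.predAbove_right_zero]
  · simp only [differences, succ_sub_one, Function.comp_apply, Fin.cons_zero, Fin.cons_succ,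
      Fin.castSucc_zero, Fin.predAbove_zero_succ, Fin.predAbove_right_zero, inv_mul_cancel,
      smul_one]
    rfl
  · simp only [differences, succ_sub_one, Function.comp_apply, Fin.cons_succ, Fin.castSucc_succ,
      Fin.predAbove_zero_succ]

/-- The morphism of cyclic modules `(A ♮ G)_G → (A ⋊ G)^♮_e`, inverse to `θ`. It sends the class of
`(a_0 ⊗ … ⊗ a_n) ♮ (h_0 ⊗ … ⊗ h_n)` to `⨂_j h_{j-1}⁻¹(a_j) h_{j-1}⁻¹ h_j`. -/
def toHomogeneous : CyclicHom (algGroup k A G).coinvariants (homogeneous k A G) :=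
  .ofZero (fun n => (coinvariantsRel ((algAct k A G n).tprod (tupleRep k G n))).liftQ
      ((toCrossed k A G n).codRestrict (homogeneousSpan k A G n) (toCrossed_mem k A G n)) (by
        rw [coinvariantsRel, Submodule.span_le]
        rintro _ ⟨γ, z, rfl⟩
        exact LinearMap.mem_ker.mpr (Subtype.ext (((toCrossed k A G n).map_sub _ _).trans
          (sub_eq_zero.mpr (LinearMap.congr_fun (toCrossed_algAct k A G n γ) z).symm)))))
    (fun n x => by
      induction x using Submodule.Quotient.induction_on with
      | H x => exact Subtype.ext (LinearMap.congr_fun (toCrossed_d k A G n) x))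
    (fun n x => by
      induction x using Submodule.Quotient.induction_on with
      | H x => exact Subtype.ext (LinearMap.congr_fun (toCrossed_s k A G n) x))
    (fun n x => by
      induction x using Submodule.Quotient.induction_on with
      | H x => exact Subtype.ext (LinearMap.congr_fun (toCrossed_t k A G n) x))

theorem toHomogeneous_tensor {n : ℕ} (a : Fin (n + 1) → A) (g : Fin (n + 1) → G)
    (h : (List.ofFn g).prod = 1) :
    (toHomogeneous k A G).f n ((algGroup k A G).toCoinvariants.f n (algGroupTensor k A G
      (fun i => ((g 0)⁻¹ * Fin.partialProd g i.castSucc) • a i)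
      (fun i => (g 0)⁻¹ * Fin.partialProd g i.succ))) = homogeneousTensor k A G a g h := by
  refine Subtype.ext ((toCrossed_tmul k A G _ _).trans (congrArg (PiTensorProduct.tprod k)
    (funext fun j => ?_)))
  have h1 := Fin.partialProd_right_inv g j
  simp only [differences, partialProd_succ_sub_one g h, smul_smul, inv_mul_cancel, one_smul,
    mul_inv_rev, inv_inv, mul_assoc, mul_inv_cancel_left, h1]

/-- The left inverse of `toCrossed` modulo the action of `G`: on `a_0 g_0 ⊗ … ⊗ a_n g_n` it is the
class of `(⨂_j P_j(a_j)) ♮ (⨂_j P_{j+1})`, with `P_j = g_0 ⋯ g_{j-1}`. -/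
def ofCrossed (n : ℕ) : (⨂[k] _ : Fin (n + 1), SkewMonoidAlgebra A G) →ₗ[k]
    ((⨂[k] _ : Fin (n + 1), A) ⊗[k] ((Fin (n + 1) → G) →₀ k)) ⧸
      coinvariantsRel ((algAct k A G n).tprod (tupleRep k G n)) :=
  Finsupp.lsum k (fun g : Fin (n + 1) → G =>
      (coinvariantsRel ((algAct k A G n).tprod (tupleRep k G n))).mkQ ∘ₗ
        (TensorProduct.mk k _ _).flip (Finsupp.single (fun j => Fin.partialProd g j.succ) 1) ∘ₗ
          PiTensorProduct.map fun j =>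
            DistribSMul.toLinearMap k A (Fin.partialProd g j.castSucc)) ∘ₗ crossedCoeff k A G n

theorem ofCrossed_tprod {n : ℕ} (a : Fin (n + 1) → A) (g : Fin (n + 1) → G) :
    ofCrossed k A G n (PiTensorProduct.tprod k fun j => SkewMonoidAlgebra.single (g j) (a j)) =
      Submodule.Quotient.mk (PiTensorProduct.tprod k
        (fun j => Fin.partialProd g j.castSucc • a j) ⊗ₜ
          Finsupp.single (fun j => Fin.partialProd g j.succ) 1) := by
  rw [ofCrossed, LinearMap.comp_apply, crossedCoeff_tprod, Finsupp.lsum_single,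
    LinearMap.comp_apply, LinearMap.comp_apply, PiTensorProduct.map_tprod]
  rfl

theorem ofCrossed_toCrossed (n : ℕ) : ofCrossed k A G n ∘ₗ toCrossed k A G n =
    (coinvariantsRel ((algAct k A G n).tprod (tupleRep k G n))).mkQ := by
  refine algGroup_ext k A G fun a h => ?_
  rw [LinearMap.comp_apply, toCrossed_tmul, ofCrossed_tprod]
  have h1 := mk_coinvariants_eq ((algAct k A G n).tprod (tupleRep k G n)) (h (Fin.last n))⁻¹
    (PiTensorProduct.tprod k a ⊗ₜ Finsupp.single h 1)
  rw [Representation.tprod_apply, TensorProduct.map_tmul, tupleRep_single, algAct_tprod] at h1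
  rw [← h1]
  simp only [partialProd_differences_castSucc, partialProd_differences_succ, smul_smul, mul_assoc,
    mul_inv_cancel, mul_one]
  rfl

theorem toHomogeneous_bijective (n : ℕ) : Function.Bijective ((toHomogeneous k A G).f n) := by
  constructor
  · have h : Function.LeftInverse (fun x : homogeneousSpan k A G n => ofCrossed k A G n x.1)
        ((toHomogeneous k A G).f n) := fun x => by
      induction x using Submodule.Quotient.induction_on with
      | H x => exact LinearMap.congr_fun (ofCrossed_toCrossed k A G n) x
    exact h.injective
  · rintro ⟨x, hx⟩
    have h1 : homogeneousSpan k A G n ≤ LinearMap.range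
        ((homogeneousSpan k A G n).subtype ∘ₗ (toHomogeneous k A G).f n) := by
      refine Submodule.span_le.mpr ?_
      rintro _ ⟨a, g, h, rfl⟩
      exact ⟨(algGroup k A G).toCoinvariants.f n (algGroupTensor k A G
        (fun i => ((g 0)⁻¹ * Fin.partialProd g i.castSucc) • a i)
        (fun i => (g 0)⁻¹ * Fin.partialProd g i.succ)),
        congrArg Subtype.val (toHomogeneous_tensor k A G a g h)⟩
    obtain ⟨y, hy⟩ := h1 hx
    exact ⟨y, Subtype.ext hy⟩

/-- The isomorphism `θ : (A ⋊ G)^♮_e → (A ♮ G)_G`. -/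
def theta : CyclicHom (homogeneous k A G) (algGroup k A G).coinvariants :=
  (toHomogeneous k A G).inverse (toHomogeneous_bijective k A G)

theorem theta_bijective (n : ℕ) : Function.Bijective ((theta k A G).f n) :=
  (LinearEquiv.ofBijective _ (toHomogeneous_bijective k A G n)).symm.bijective

theorem theta_tensor {n : ℕ} (a : Fin (n + 1) → A) (g : Fin (n + 1) → G)
    (h : (List.ofFn g).prod = 1) :
    (theta k A G).f n (homogeneousTensor k A G a g h) =
      (algGroup k A G).toCoinvariants.f n (algGroupTensor k A G
        (fun i => ((g 0)⁻¹ * Fin.partialProd g i.castSucc) • a i)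
        (fun i => (g 0)⁻¹ * Fin.partialProd g i.succ)) := by
  refine (LinearEquiv.symm_apply_eq
    (LinearEquiv.ofBijective _ (toHomogeneous_bijective k A G n))).mpr ?_
  exact (toHomogeneous_tensor k A G a g h).symm

end Theta

/-! ### The completion map -/

section Free

variable {k : Type u} [CommRing k] {G : Type w} [Group G] {V : Type*} [AddCommGroup V] [Module k V]
  (ρ : Representation k G V) (q : ℕ)

/-- The map `x ⊗ (h_0, …, h_q) ↦ h_0⁻¹ x` into the summand of `(h_0⁻¹ h_1, …, h_0⁻¹ h_q)`. -/
def balancedToFree : Balanced ρ (tupleRep k G q) →ₗ[k] ((Fin q → G) →₀ V) :=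
  balancedLift ρ (fun h => Finsupp.lsingle (fun j => (h 0)⁻¹ * h j.succ) ∘ₗ ρ (h 0)⁻¹)
    fun γ h x => by
      simp only [LinearMap.comp_apply, ← Module.End.mul_apply, ← map_mul, mul_inv_rev, mul_assoc,
        inv_mul_cancel_left, inv_mul_cancel, mul_one]

theorem balancedToFree_mk (x : V) (h : Fin (q + 1) → G) :
    balancedToFree ρ q (Submodule.Quotient.mk (x ⊗ₜ Finsupp.single h 1)) =
      Finsupp.single (fun j => (h 0)⁻¹ * h j.succ) (ρ (h 0)⁻¹ x) := by
  rw [balancedToFree, balancedLift_mk]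
  rfl

/-- Because `C_q(G)` is a free `kG`-module on the tuples `(e, t_1, …, t_q)`, the module
`V ⊗_{kG} C_q(G)` is a direct sum of copies of `V`. -/
def balancedFree : Balanced ρ (tupleRep k G q) ≃ₗ[k] ((Fin q → G) →₀ V) :=
  LinearEquiv.ofLinearMap
    (balancedToFree ρ q)
    (Finsupp.lsum k fun t : Fin q → G => (balancedRel ρ (tupleRep k G q)).mkQ ∘ₗ
      (TensorProduct.mk k _ _).flip (Finsupp.single (Fin.cons 1 t : Fin (q + 1) → G) 1))
    (by
      refine Finsupp.lhom_ext' fun t => LinearMap.ext fun x => ?_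
      rw [LinearMap.comp_apply, LinearMap.comp_apply, Finsupp.lsingle_apply, Finsupp.lsum_single]
      refine (balancedToFree_mk _ _ _ _).trans ?_
      simp only [Fin.cons_zero, Fin.cons_succ, inv_one, one_mul, map_one,
        Module.End.one_apply]
      rfl)
    (balanced_ext fun x h => by
      have h1 := mk_balanced_eq ρ (tupleRep k G q) (h 0)⁻¹ x (Finsupp.single h 1)
      have h2 : (Fin.cons 1 fun j => (h 0)⁻¹ * h j.succ : Fin (q + 1) → G) =
          fun j => (h 0)⁻¹ * h j := by
        funext j
        refine Fin.cases ?_ (fun j => ?_) j <;> simp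
      rw [tupleRep_single, ← h2] at h1
      rw [LinearMap.comp_apply, balancedToFree_mk, Finsupp.lsum_single]
      exact h1)

theorem balancedToFree_balancedMap {V' : Type*} [AddCommGroup V'] [Module k V']
    (ρ' : Representation k G V') (f : V →ₗ[k] V') (hf : ∀ g, ρ' g ∘ₗ f = f ∘ₗ ρ g)
    (z : Balanced ρ (tupleRep k G q)) :
    balancedToFree ρ' q (balancedMap ρ _ ρ' _ f LinearMap.id hf (fun _ => rfl) z) =
      Finsupp.mapRange.linearMap f (balancedToFree ρ q z) := by
  suffices h : balancedToFree ρ' q ∘ₗ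
      balancedMap ρ _ ρ' _ f LinearMap.id hf (fun _ => rfl) =
        Finsupp.mapRange.linearMap f ∘ₗ balancedToFree ρ q from LinearMap.congr_fun h z
  refine balanced_ext fun x h => ?_
  have h1 : balancedMap ρ (tupleRep k G q) ρ' (tupleRep k G q) f LinearMap.id hf (fun _ => rfl)
      (Submodule.Quotient.mk (x ⊗ₜ Finsupp.single h 1)) =
        Submodule.Quotient.mk (f x ⊗ₜ Finsupp.single h 1) := rfl
  have h2 := LinearMap.congr_fun (hf (h 0)⁻¹) x
  rw [LinearMap.comp_apply, LinearMap.comp_apply] at h2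
  rw [LinearMap.comp_apply, LinearMap.comp_apply, h1,
    balancedToFree_mk, balancedToFree_mk, Finsupp.mapRange.linearMap_apply,
    Finsupp.mapRange_single, h2]

end Free

/-- Direct sums over `I` commute with products over `X` if `X` or `I` is finite. -/
theorem bijective_pi_mapRange {k I X : Type*} [CommRing k] {V : X → Type*}
    [∀ x, AddCommGroup (V x)] [∀ x, Module k (V x)] (h : Finite X ∨ Finite I) :
    Function.Bijective fun (f : I →₀ ∀ x, V x) (x : X) =>
      Finsupp.mapRange.linearMap (LinearMap.proj (R := k) (φ := V) x) f := by
  classical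
  refine ⟨fun f f' hf => Finsupp.ext fun i => funext fun x =>
    DFunLike.congr_fun (congrFun hf x) i, fun g => ?_⟩
  rcases h with h | h
  · have := Fintype.ofFinite X
    refine ⟨∑ x, Finsupp.mapRange.linearMap (LinearMap.single k V x) (g x),
      funext fun x => Finsupp.ext fun i => ?_⟩
    change (∑ y, Finsupp.mapRange.linearMap (LinearMap.single k V y) (g y)) i x = _
    rw [Finsupp.finsetSum_apply, Finset.sum_apply, Finset.sum_eq_single x]
    · simp
    · intro y _ hy
      simp [Pi.single_eq_of_ne hy.symm]
    · simp
  · exact ⟨Finsupp.equivFunOnFinite.symm fun i x => g x i,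
      funext fun x => Finsupp.ext fun i => rfl⟩

/-- The comparison map from `(∏ V_x) ⊗_{kG} C_q(G)` to `∏ (V_x ⊗_{kG} C_q(G))`. -/
theorem bijective_pi_balancedMap {k G X : Type*} [CommRing k] [Group G] {V : X → Type*}
    [∀ x, AddCommGroup (V x)] [∀ x, Module k (V x)] (σ : Representation k G (∀ x, V x))
    (ρ : ∀ x, Representation k G (V x))
    (hσ : ∀ x g, ρ x g ∘ₗ LinearMap.proj (R := k) (φ := V) x = LinearMap.proj x ∘ₗ σ g)
    (q : ℕ)
    (h : Finite X ∨ Finite G) :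
    Function.Bijective (LinearMap.pi fun x => balancedMap σ (tupleRep k G q) (ρ x) (tupleRep k G q)
      (LinearMap.proj x) LinearMap.id (hσ x) fun _ => rfl) := by
  have h1 := (bijective_pi_mapRange (k := k) (I := Fin q → G) (V := V)
    (h.imp_right fun _ : Finite G => Pi.finite)).comp (balancedFree σ q).bijective
  have h2 := (Function.Bijective.piMap fun x => (balancedFree (ρ x) q).bijective)
  refine (Function.Bijective.of_comp_iff' h2 _).mp ?_
  convert h1 using 1
  funext z x
  exact balancedToFree_balancedMap σ q (ρ x) _ (hσ x) z

theorem isIso_totMap {k : Type u} [CommRing k] {D E : DoubleComplex.{u, v} k}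
    (φ : DoubleComplex.Hom D E) (h : ∀ p q, Function.Bijective (φ.f p q)) :
    IsIso (DoubleComplex.totMap φ) := by
  have (n : ℤ) : IsIso ((DoubleComplex.totMap φ).f n) := by
    refine (ConcreteCategory.isIso_iff_bijective _).mpr ?_
    exact Function.Bijective.piMap fun x : TotIndex n => h x.1.1 x.1.2
  exact HomologicalComplex.Hom.isIso_of_components _

theorem isIso_CCmap {k : Type u} [CommRing k] (F : Flavour) {M N : CyclicModule.{u, v} k}
    (φ : CyclicHom M N) (h : ∀ n, Function.Bijective (φ.f n)) : IsIso (CCmap F φ) := by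
  have (n : ℤ) : IsIso ((CCmap F φ).f n) := by
    refine (ConcreteCategory.isIso_iff_bijective _).mpr ?_
    exact Function.Bijective.piMap fun x : UIndex F n => h x.1.2
  exact HomologicalComplex.Hom.isIso_of_components _

/-- In the Hochschild and cyclic flavours, the chains of a fixed degree involve only finitely many
powers of `u`. -/
theorem finite_UIndex {F : Flavour} (hF : F = .hochschild ∨ F = .cyclic) (n : ℤ) :
    Finite (UIndex F n) := by
  have h (x : UIndex F n) : x.1.1 ∈ Set.Icc (-|n|) 0 := by
    obtain ⟨⟨j, m⟩, hj, hm⟩ := x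
    have hj0 : j ≤ 0 := by
      rcases hF with rfl | rfl
      · exact (Set.mem_singleton_iff.mp hj).le
      · exact le_of_lt hj
    -- `m ≥ 0` and `m = n + 2j` bound `j` from below
    have := le_abs_self n
    have := neg_abs_le n
    simp only [Set.mem_Icc] at hm ⊢
    omega
  refine Finite.of_injective (fun x : UIndex F n => (⟨x.1.1, h x⟩ : Set.Icc (-|n|) (0 : ℤ)))
    fun x y hxy => ?_
  have h1 : x.1.1 = y.1.1 := congrArg Subtype.val hxy
  have h2 := x.2.2
  have h3 := y.2.2
  rw [h1, ← h3] at h2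
  exact Subtype.ext (Prod.ext h1 (Nat.cast_injective h2))

theorem isIso_completion {k : Type u} [CommRing k] {G : Type w} [Group G] (F : Flavour)
    (M : CyclicRep.{u, v, w} k G) (h : F = .hochschild ∨ F = .cyclic ∨ Finite G) :
    IsIso (completion F M) := by
  refine isIso_totMap _ fun p q => bijective_pi_balancedMap (chainsRep F M p)
    (fun x : UIndex F p => M.ρ x.1.2) (fun _ _ => rfl) q ?_
  rw [← or_assoc] at h
  exact h.imp_left fun h => finite_UIndex h p

/-! ### The composite quasi-isomorphism -/

section Composite

variable {k : Type u} [CommRing k] {A : Type v} [Ring A] [Algebra k A] {G : Type w} [Group G]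
  [MulSemiringAction G A] [SMulCommClass G k A]

theorem quasiIso_theta_seriesHom_completedForget (F : Flavour) (ℓ : ∀ m : ℕ, Fin (m + 1)) :
    QuasiIso (CCmap F (theta k A G) ≫ (algGroupContraction F ℓ).seriesHom ≫
      completedForget k A G F) := by
  have := isIso_CCmap F _ (theta_bijective k A G)
  have h := (algGroupContraction (k := k) (A := A) (G := G) F ℓ).quasiIso_seriesHom
  have h' := quasiIso_completedForget (k := k) (A := A) (G := G) F
  have h'' : QuasiIso ((algGroupContraction F ℓ).seriesHom ≫ completedForget k A G F) :=
    quasiIso_comp (hφ := h) (hφ' := h')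
  exact quasiIso_comp (hφ := inferInstance) (hφ' := h'')

theorem exists_quasiIso_comp_completion {F : Flavour}
    {K : ChainComplex (ModuleCat.{max u v w} k) ℤ}
    (f : K ⟶ completedGroupChains F (algRep k A G)) (hf : QuasiIso f)
    (h : F = .hochschild ∨ F = .cyclic ∨ Finite G) :
    ∃ Φ : K ⟶ groupChains (equivariantCC F (algRep k A G)),
      QuasiIso Φ ∧ Φ ≫ completion F (algRep k A G) = f := by
  have := isIso_completion F (algRep k A G) h
  exact ⟨f ≫ inv (completion F (algRep k A G)), quasiIso_comp (hφ := hf) (hφ' := inferInstance), by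
    rw [Category.assoc, IsIso.inv_hom_id, Category.comp_id]⟩

end Composite

end CrossedCyclic

end

end

theorem mainTheorem8 {k : Type*} [Field k] [CharZero k] {A : Type*} [Ring A] [Algebra k A]
    {G : Type*} [Group G] [MulSemiringAction G A] [SMulCommClass G k A]
    (ℓ : ∀ m : ℕ, Fin (m + 1)) :
    ∃ θ : CrossedCyclic.CyclicHom (CrossedCyclic.homogeneous k A G)
        (CrossedCyclic.algGroup k A G).coinvariants,
      (∀ n, Function.Bijective (θ.f n)) ∧
      (∀ (n : ℕ) (a : Fin (n + 1) → A) (g : Fin (n + 1) → G) (h : (List.ofFn g).prod = 1),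
        θ.f n (CrossedCyclic.homogeneousTensor k A G a g h) =
          (CrossedCyclic.algGroup k A G).toCoinvariants.f n
            (CrossedCyclic.algGroupTensor k A G
              (fun i => ((g 0)⁻¹ * Fin.partialProd g i.castSucc) • a i)
              (fun i => (g 0)⁻¹ * Fin.partialProd g i.succ))) ∧
      ∀ F : CrossedCyclic.Flavour,
        ∃ Q : CrossedCyclic.CC F (CrossedCyclic.algGroup k A G).coinvariants ⟶
            CrossedCyclic.completedGroupChains F (CrossedCyclic.algGroup k A G),
          (∀ (n : ℤ) (z : CrossedCyclic.Chains F
              (CrossedCyclic.algGroup k A G).toCyclicModule n),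
            (Q.f n).hom (CrossedCyclic.chainsMap F
                (CrossedCyclic.algGroup k A G).toCoinvariants.f n z) =
              CrossedCyclic.Qlift F ℓ n z) ∧
          QuasiIso (CrossedCyclic.CCmap F θ ≫ Q ≫ CrossedCyclic.completedForget k A G F) ∧
          ((F = .hochschild ∨ F = .cyclic ∨ Finite G) →
            IsIso (CrossedCyclic.completion F (CrossedCyclic.algRep k A G)) ∧
            ∃ Φ : CrossedCyclic.CC F (CrossedCyclic.homogeneous k A G) ⟶
                CrossedCyclic.groupChains
                  (CrossedCyclic.equivariantCC F (CrossedCyclic.algRep k A G)),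
              QuasiIso Φ ∧
              Φ ≫ CrossedCyclic.completion F (CrossedCyclic.algRep k A G) =
                CrossedCyclic.CCmap F θ ≫ Q ≫ CrossedCyclic.completedForget k A G F) := by
  refine ⟨CrossedCyclic.theta k A G, CrossedCyclic.theta_bijective k A G,
    fun _ => CrossedCyclic.theta_tensor k A G, fun F =>
      ⟨(CrossedCyclic.algGroupContraction F ℓ).seriesHom,
        CrossedCyclic.series_toCoinvariants F ℓ, ?_, fun h => ⟨?_, ?_⟩⟩⟩
  · exact CrossedCyclic.quasiIso_theta_seriesHom_completedForget F ℓ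
  · exact CrossedCyclic.isIso_completion F (CrossedCyclic.algRep k A G) h
  · exact CrossedCyclic.exists_quasiIso_comp_completion _
      (CrossedCyclic.quasiIso_theta_seriesHom_completedForget F ℓ) h
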